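/- Let $M$ be a compact (Hausdorff, without boundary) topological manifold of even dimension $N$, let $n\ge 0$, and let $k$ be a field of characteristic $0$ or $p>n$ (for instance $k=\mathbb Q$, or $k=\mathbb F_p$ with $p>n$). Let $H=H^*(M;k)$ be the singular cohomology algebra, with cup product $\bullet$ and unit $e_0$. **The algebra $E_1$.** Let $E_1=(H^{\otimes n}\otimes\Lambda(e_{ij}:1\le i\neq j\le n))/I$, where tensor products and $\Lambda$ are taken in the graded commutative sense, $|e_{ij}|=N-1$, $p_i^*\colon H\to H^{\otimes n}$ is the inclusion of the $i$-th factor, and $I$ is the ideal generated by $e_{ij}e_{jl}+e_{jl}e_{li}+e_{li}e_{ij}$ ($i,j,l$ distinct), $e_{ij}^2$, $e_{ij}-(-1)^Ne_{ji}$ and $(p_i^*(a)-p_j^*(a))\,e_{ij}$ ($a\in H$). Here $p_i^*(a)$ has bidegree $(|a|,0)$ and $e_{ij}$ has bidegree $(0,N-1)$. The group $\Sigma_n$ acts by algebra automorphisms with $\sigma p_i^*(a)=p_{\sigma(i)}^*(a)$ and $\sigma e_{ij}=e_{\sigma(i)\sigma(j)}$. **The algebra $C_n^H$.** Write $s=s^{N-1}$,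 so that $|sa|=|a|+N-1$, and let $$C_n^H=\bigoplus_{r=0}^{\lfloor n/2\rfloor}\Lambda^{n-2r}(H)\otimes\Lambda^r(sH),$$ where $\Lambda^j(V)$ is the part of word length $j$ of the free graded commutative algebra on $V$. For $x_i,y_i\in H$ homogeneous, $x_1\wedge\dots\wedge x_{n-2r}\otimes sy_1\wedge\dots\wedge sy_r$ has bidegree $(\sum_i|x_i|+\sum_i|y_i|,\,r(N-1))$. **Product.** There is a unique bilinear product on $C_n^H$ such that, for homogeneous $x_i,y_i,z_i,t_i\in H$, $$(x_1\wedge\dots\wedge x_{n-2r}\otimes sy_1\wedge\dots\wedge sy_r)\cdot(z_1\wedge\dots\wedge z_{n-2q}\otimes st_1\wedge\dots\wedge st_q)=\frac1{l!}\sum_{\sigma\in\Sigma_{n-2r},\ \tau\in\Sigma_{n-2q}}\varepsilon_{\sigma,\tau}\;\alpha_{\sigma,\tau}\otimes\beta_{\sigma,\tau}\wedge\gamma_{\sigma,\tau}$$ if $l=n-2r-2q\ge 0$, the product being $0$ if $n<2r+2q$. Here $$\alpha_{\sigma,\tau}=(x_{\sigma(1)}\bullet z_{\tau(1)})\wedge\dots\wedge(x_{\sigma(l)}\bullet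 z_{\tau(l)}),$$ $$\beta_{\sigma,\tau}=s(x_{\sigma(l+1)}\bullet x_{\sigma(l+2)}\bullet t_1)\wedge\dots\wedge s(x_{\sigma(l+2q-1)}\bullet x_{\sigma(l+2q)}\bullet t_q),$$ $$\gamma_{\sigma,\tau}=s(z_{\tau(l+1)}\bullet z_{\tau(l+2)}\bullet y_1)\wedge\dots\wedge s(z_{\tau(l+2r-1)}\bullet z_{\tau(l+2r)}\bullet y_r),$$ and $\varepsilon_{\sigma,\tau}$ is the Koszul sign of the rearrangement of all the letters $x_i,y_i,z_i,t_i$ and of the symbols $s$ (of degree $N-1$), the symbol $s$ written before $y_j$ (resp. $t_j$) being the one which stands in front of the factor of $\gamma_{\sigma,\tau}$ (resp. $\beta_{\sigma,\tau}$) containing $y_j$ (resp. $t_j$). In particular the product depends only on the cup product of $H$. **Isomorphism.** There is a linear isomorphism $\Psi\colon C_n^H\to E_1^{\Sigma_n}$ which is multiplicative and preserves (and reflects) bidegrees. **Differential.** Let $\Omega\neq0$ span $H^N$, let $(b_i)$ be a finite homogeneous basis of $H$ and $(b_i')$ a dual basis for Poincaré duality: $|b_i|+|b_i'|=N$, and $b_i\bullet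 b_j'=\delta_{ij}\Omega$ whenever $|b_i|+|b_j'|=N$. (Such data exist when $M$ is connected, non-empty and $k$-oriented.) Then: 1. There is a unique graded derivation $d_1$ of $E_1$ (for the total degree) with $d_1(p_i^*(a))=0$ and $d_1(e_{ij})=p_{ij}^*(\Delta)=\sum_q(-1)^{|b_q'|}p_i^*(b_q)\,p_j^*(b_q')$, where $\Delta=\sum_q(-1)^{|b_q'|}b_q\otimes b_q'$ is the diagonal class; it satisfies $d_1^2=0$. 2. There is a unique graded derivation $d$ of $C_n^H$ of degree $+1$ which maps $\Lambda^{n-2r}(H)\otimes\Lambda^r(sH)$ to $\Lambda^{n-2r+2}(H)\otimes\Lambda^{r-1}(sH)$ (to $0$ if $r=0$) and satisfies, for all homogeneous $a\in H$ (if $n\ge2$, with $n-2$ factors $e_0$ on each side), $$d(e_0\wedge\dots\wedge e_0\otimes sa)=\tfrac12\sum_q(-1)^{|b_q'|}\,e_0\wedge\dots\wedge e_0\wedge(a\bullet b_q)\wedge b_q'.$$ It satisfies $d^2=0$, and in general $$d(x_1\wedge\dots\wedge x_{n-2r}\otimes sy_1\wedge\dots\wedge sy_r)=\tfrac12\sum_{i=1}^r\sum_q(-1)^{\eta_{i,q}}\,x_1\wedge\dots\wedge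 x_{n-2r}\wedge(y_i\bullet b_q)\wedge b_q'\otimes sy_1\wedge\dots\widehat{sy_i}\dots\wedge sy_r,$$ with $\eta_{i,q}=|b_q'|+\sum_j|x_j|+(|y_i|+1)\sum_{j<i}(|y_j|+1)$. 3. $\Psi\circ d=d_1\circ\Psi$. Hence $E_1^{\Sigma_n}$ is stable under $d_1$ and $\Psi\colon(C_n^H,d)\to(E_1,d_1)^{\Sigma_n}$ is an isomorphism of differential graded algebras. The isomorphism $\Psi$ does not depend on the choice of $\Omega$, $(b_i)$, $(b_i')$. -/

import Mathlib

namespace CohenTaylor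

noncomputable section

universe u v

section SingularCohomology

open CategoryTheory Simplicial

/-! ### Singular cohomology and the cup product

Everything is written for a simplicial set `X`; singular cohomology of a space is the case of its
singular simplicial set. -/

/-- The `p`-cochains of `X` with coefficients in `k`. -/
abbrev Cochain (k : Type v) (X : SSet.{u}) (p : ℕ) : Type (max u v) := X _⦋p⦌ → k

/-- `(δ f)(σ) = ∑ i, (-1)^i f(d_i σ)`. -/
def coboundary (k : Type v) [Field k] (X : SSet.{u}) (p : ℕ) :
    Cochain k X p →ₗ[k] Cochain k X (p + 1) where
  toFun f := fun σ => ∑ i : Fin (p + 2), (-1 : k) ^ (i : ℕ) * f (X.δ i σ)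
  map_add' f g := by
    funext σ; simp [mul_add, Finset.sum_add_distrib]
  map_smul' c f := by
    funext σ; simp [Finset.mul_sum, mul_left_comm]

abbrev cocycles (k : Type v) [Field k] (X : SSet.{u}) (p : ℕ) : Submodule k (Cochain k X p) :=
  LinearMap.ker (coboundary k X p)

def coboundaries (k : Type v) [Field k] (X : SSet.{u}) (p : ℕ) :
    Submodule k (Cochain k X p) :=
  match p with
  | 0 => ⊥
  | q + 1 => LinearMap.range (coboundary k X q)

abbrev Cohomology (k : Type v) [Field k] (X : SSet.{u}) (p : ℕ) : Type (max u v) :=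
  cocycles k X p ⧸ (coboundaries k X p).submoduleOf (cocycles k X p)

/-- The front `p`-face of an `n`-simplex, on the vertices `0, …, p`. -/
def front {X : SSet.{u}} {n : ℕ} (p : ℕ) (h : p ≤ n) (σ : X _⦋n⦌) : X _⦋p⦌ :=
  X.map (SimplexCategory.subinterval 0 p (by omega)).op σ

/-- The face of an `n`-simplex on the vertices `p, …, p + q`. -/
def back {X : SSet.{u}} {n : ℕ} (p q : ℕ) (h : p + q ≤ n) (σ : X _⦋n⦌) : X _⦋q⦌ :=
  X.map (SimplexCategory.subinterval p q h).op σ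

/-- The Alexander-Whitney cup product of cochains,
`(f ∪ g)(σ) = f(σ|[0, …, p]) g(σ|[p, …, p + q])`. -/
def cup (k : Type v) [Field k] (X : SSet.{u}) {p q n : ℕ} (h : p + q = n) :
    Cochain k X p →ₗ[k] Cochain k X q →ₗ[k] Cochain k X n :=
  LinearMap.mk₂ k
    (fun f g σ => f (front p (by omega) σ) * g (back p q (by omega) σ))
    (fun _ _ _ => by funext σ; simp [add_mul])
    (fun _ _ _ => by funext σ; simp [mul_assoc])
    (fun _ _ _ => by funext σ; simp [mul_add])
    (fun _ _ _ => by funext σ; simp [mul_left_comm])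

theorem map_op_map_op {X : SSet.{u}} {a b c d : ℕ} (f : ⦋a⦌ ⟶ ⦋b⦌) (g : ⦋b⦌ ⟶ ⦋c⦌)
    (f' : ⦋a⦌ ⟶ ⦋d⦌) (g' : ⦋d⦌ ⟶ ⦋c⦌)
    (h : ∀ j : Fin (a + 1), ((g.toOrderHom (f.toOrderHom j) : Fin (c + 1)) : ℕ) =
      ((g'.toOrderHom (f'.toOrderHom j) : Fin (c + 1)) : ℕ)) (σ : X _⦋c⦌) :
    X.map f.op (X.map g.op σ) = X.map f'.op (X.map g'.op σ) := by
  have : f ≫ g = f' ≫ g' := by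
    ext j : 3
    exact Fin.ext (h j)
  have e : ∀ {a b c : ℕ} (f : ⦋a⦌ ⟶ ⦋b⦌) (g : ⦋b⦌ ⟶ ⦋c⦌) (σ : X _⦋c⦌),
      X.map f.op (X.map g.op σ) = X.map (f ≫ g).op σ := by
    intros; simp
  rw [e, e, this]

theorem map_op_map_op' {X : SSet.{u}} {a b c : ℕ} (f : ⦋a⦌ ⟶ ⦋b⦌) (g : ⦋b⦌ ⟶ ⦋c⦌)
    (f' : ⦋a⦌ ⟶ ⦋c⦌)
    (h : ∀ j : Fin (a + 1), ((g.toOrderHom (f.toOrderHom j) : Fin (c + 1)) : ℕ) =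
      ((f'.toOrderHom j : Fin (c + 1)) : ℕ)) (σ : X _⦋c⦌) :
    X.map f.op (X.map g.op σ) = X.map f'.op σ := by
  have := map_op_map_op (X := X) f g f' (𝟙 _) h σ
  simpa using this

theorem subinterval_val {n : ℕ} (p q : ℕ) (h : p + q ≤ n) (j : Fin (q + 1)) :
    (((SimplexCategory.subinterval p q h).toOrderHom j : Fin (n + 1)) : ℕ) = j + p := rfl

theorem face_val {n : ℕ} (i : Fin (n + 2)) (j : Fin (n + 1)) :
    (((SimplexCategory.δ i).toOrderHom j : Fin (n + 2)) : ℕ) =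
      if (j : ℕ) < i then (j : ℕ) else j + 1 := by
  change ((i.succAbove j : Fin (n + 2)) : ℕ) = _
  simp only [Fin.succAbove, Fin.lt_def, Fin.val_castSucc]
  split_ifs <;> rfl

theorem front_face_le {X : SSet.{u}} {n p : ℕ} (hp : p ≤ n) (i : ℕ) (hi : i ≤ p)
    (hi' : i < n + 2) (σ : X _⦋n + 1⦌) :
    front p hp (X.δ ⟨i, hi'⟩ σ) =
      X.δ (⟨i, by omega⟩ : Fin (p + 2)) (front (p + 1) (by omega) σ) := by
  apply map_op_map_op
  intro j
  have := j.2
  simp only [subinterval_val, face_val]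
  grind

theorem front_face_gt {X : SSet.{u}} {n p : ℕ} (hp : p ≤ n) (i : ℕ) (hi : p < i)
    (hi' : i < n + 2) (σ : X _⦋n + 1⦌) :
    front p hp (X.δ ⟨i, hi'⟩ σ) = front p (by omega) σ := by
  apply map_op_map_op'
  intro j
  have := j.2
  simp only [subinterval_val, face_val]
  grind

theorem back_face_le {X : SSet.{u}} {n p q : ℕ} (h : p + q ≤ n) (i : ℕ) (hi : i ≤ p)
    (hi' : i < n + 2) (σ : X _⦋n + 1⦌) :
    back p q h (X.δ ⟨i, hi'⟩ σ) = back (p + 1) q (by omega) σ := by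
  apply map_op_map_op'
  intro j
  have := j.2
  simp only [subinterval_val, face_val]
  grind

theorem back_face_ge {X : SSet.{u}} {n p q : ℕ} (h : p + q ≤ n) (i : ℕ) (hi : i < q + 2)
    (hi' : p + i < n + 2) (σ : X _⦋n + 1⦌) :
    back p q h (X.δ ⟨p + i, hi'⟩ σ) =
      X.δ (⟨i, hi⟩ : Fin (q + 2)) (back p (q + 1) (by omega) σ) := by
  apply map_op_map_op
  intro j
  have := j.2
  simp only [subinterval_val, face_val]
  grind

/-- The Leibniz rule for the cup product of cochains. -/
theorem coboundary_cup (k : Type v) [Field k] (X : SSet.{u}) {p q n : ℕ} (h : p + q = n)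
    (f : Cochain k X p) (g : Cochain k X q) :
    coboundary k X n (cup k X h f g) =
      cup k X (show (p + 1) + q = n + 1 by omega) (coboundary k X p f) g +
        (-1 : k) ^ p • cup k X (show p + (q + 1) = n + 1 by omega) f (coboundary k X q g) := by
  subst h
  funext σ
  simp only [coboundary, cup, LinearMap.coe_mk, AddHom.coe_mk, LinearMap.mk₂_apply, Pi.add_apply,
    Pi.smul_apply, smul_eq_mul]
  have e1 : ∑ i : Fin (p + q + 2), (-1 : k) ^ (i : ℕ) *
      (f (front p (by omega) (X.δ i σ)) * g (back p q (by omega) (X.δ i σ))) =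
      ∑ i : Fin (p + 1), (-1 : k) ^ (i : ℕ) *
        (f (X.δ i.castSucc (front (p + 1) (by omega) σ)) *
          g (back (p + 1) q (by omega) σ)) +
      ∑ j : Fin (q + 1), (-1 : k) ^ (p + 1 + (j : ℕ)) *
        (f (front p (by omega) σ) * g (X.δ j.succ (back p (q + 1) (by omega) σ))) := by
    rw [← Equiv.sum_comp (finCongr (show (p + 1) + (q + 1) = p + q + 2 by omega)),
      Fin.sum_univ_add]
    congr 1
    · refine Finset.sum_congr rfl fun i _ => ?_
      have h1 := front_face_le (X := X) (p := p) (n := p + q) (by omega) i (by omega) (by omega) σ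
      have h2 := back_face_le (X := X) (p := p) (q := q) (n := p + q) (by omega) i (by omega)
        (by omega) σ
      exact congrArg₂ (fun a b => (-1 : k) ^ (i : ℕ) * (f a * g b)) h1 h2
    · refine Finset.sum_congr rfl fun j _ => ?_
      have h1 := front_face_gt (X := X) (p := p) (n := p + q) (by omega) (p + 1 + j) (by omega)
        (by omega) σ
      have h2 := back_face_ge (X := X) (p := p) (q := q) (n := p + q) (by omega) (j + 1) (by omega)
        (by omega) σ
      have h3 : (⟨p + (j + 1), by omega⟩ : Fin (p + q + 2)) = ⟨p + 1 + j, by omega⟩ :=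
        Fin.ext (by simp; omega)
      rw [h3] at h2
      exact congrArg₂ (fun a b => (-1 : k) ^ (p + 1 + (j : ℕ)) * (f a * g b)) h1 h2
  have e2 : (front (p + 1) (by omega) σ : X _⦋p + 1⦌) = front (p + 1) (by omega) σ := rfl
  have h1 := front_face_gt (X := X) (p := p) (n := p) le_rfl (p + 1) (by omega) (by omega)
    (front (p + 1) (show p + 1 ≤ p + q + 1 by omega) σ)
  have h2 := back_face_le (X := X) (p := 0) (q := q) (n := q) (by omega) 0 (by omega) (by omega)
    (back p (q + 1) (show p + (q + 1) ≤ p + q + 1 by omega) σ)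
  have h1' : X.δ (Fin.last (p + 1)) (front (p + 1) (show p + 1 ≤ p + q + 1 by omega) σ) =
      front p (by omega) σ := by
    apply map_op_map_op'
    intro j
    have := j.2
    simp only [subinterval_val, face_val]
    grind
  have h2' : X.δ (0 : Fin (q + 2)) (back p (q + 1) (show p + (q + 1) ≤ p + q + 1 by omega) σ) =
      back (p + 1) q (by omega) σ := by
    apply map_op_map_op'
    intro j
    have := j.2
    simp only [subinterval_val, face_val]
    grind
  rw [e1, Fin.sum_univ_castSucc (n := p + 1), Fin.sum_univ_succ (n := q + 1), h1', h2']
  simp only [Fin.val_castSucc, Fin.val_last, Fin.val_zero, Fin.val_succ, add_mul, mul_add,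
    Finset.sum_mul, Finset.mul_sum, pow_add, pow_one, pow_zero]
  simp only [mul_assoc, mul_comm, mul_left_comm]
  ring

theorem cup_mem_cocycles (k : Type v) [Field k] (X : SSet.{u}) {p q n : ℕ} (h : p + q = n)
    {f : Cochain k X p} {g : Cochain k X q} (hf : f ∈ cocycles k X p) (hg : g ∈ cocycles k X q) :
    cup k X h f g ∈ cocycles k X n := by
  rw [LinearMap.mem_ker] at hf hg ⊢
  rw [coboundary_cup, hf, hg]
  simp

theorem cup_mem_coboundaries_left (k : Type v) [Field k] (X : SSet.{u}) {p q n : ℕ}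
    (h : p + q = n) {f : Cochain k X p} {g : Cochain k X q} (hf : f ∈ coboundaries k X p)
    (hg : g ∈ cocycles k X q) : cup k X h f g ∈ coboundaries k X n := by
  rw [LinearMap.mem_ker] at hg
  cases p with
  | zero =>
    have hf' : f = 0 := hf
    rw [hf', map_zero, LinearMap.zero_apply]
    exact Submodule.zero_mem _
  | succ p =>
    obtain ⟨f', rfl⟩ := hf
    obtain rfl : n = (p + q) + 1 := by omega
    refine ⟨cup k X rfl f' g, ?_⟩
    rw [coboundary_cup, hg]
    simp

theorem cup_mem_coboundaries_right (k : Type v) [Field k] (X : SSet.{u}) {p q n : ℕ}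
    (h : p + q = n) {f : Cochain k X p} {g : Cochain k X q} (hf : f ∈ cocycles k X p)
    (hg : g ∈ coboundaries k X q) : cup k X h f g ∈ coboundaries k X n := by
  rw [LinearMap.mem_ker] at hf
  cases q with
  | zero =>
    have hg' : g = 0 := hg
    rw [hg', map_zero]
    exact Submodule.zero_mem _
  | succ q =>
    obtain ⟨g', rfl⟩ := hg
    obtain rfl : n = (p + q) + 1 := by omega
    refine ⟨(-1 : k) ^ p • cup k X rfl f g', ?_⟩
    rw [map_smul, coboundary_cup, hf]
    simp [smul_smul, ← mul_pow]

/-- The class of a cocycle. -/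
def cohomologyClass (k : Type v) [Field k] (X : SSet.{u}) (p : ℕ) :
    cocycles k X p →ₗ[k] Cohomology k X p :=
  Submodule.mkQ _

/-- The class of the cup product of two cocycles. -/
def cupClass (k : Type v) [Field k] (X : SSet.{u}) (p q : ℕ) :
    cocycles k X p →ₗ[k] cocycles k X q →ₗ[k] Cohomology k X (p + q) :=
  LinearMap.mk₂ k
    (fun f g =>
      cohomologyClass k X (p + q) ⟨cup k X rfl f.1 g.1, cup_mem_cocycles k X rfl f.2 g.2⟩)
    (fun f f' g => by
      rw [← map_add]
      exact congrArg _ (Subtype.ext (LinearMap.map_add₂ (cup k X rfl) f.1 f'.1 g.1)))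
    (fun c f g => by
      rw [← map_smul]
      exact congrArg _ (Subtype.ext (LinearMap.map_smul₂ (cup k X rfl) c f.1 g.1)))
    (fun f g g' => by
      rw [← map_add]
      exact congrArg _ (Subtype.ext (map_add (cup k X rfl f.1) g.1 g'.1)))
    (fun c f g => by
      rw [← map_smul]
      exact congrArg _ (Subtype.ext (map_smul (cup k X rfl f.1) c g.1)))

theorem cupClass_eq_zero_left (k : Type v) [Field k] (X : SSet.{u}) (p q : ℕ)
    (f : cocycles k X p) (hf : f ∈ (coboundaries k X p).submoduleOf (cocycles k X p))
    (g : cocycles k X q) : cupClass k X p q f g = 0 :=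
  (Submodule.Quotient.mk_eq_zero _).2 (cup_mem_coboundaries_left k X rfl hf g.2)

theorem cupClass_eq_zero_right (k : Type v) [Field k] (X : SSet.{u}) (p q : ℕ)
    (f : cocycles k X p) (g : cocycles k X q)
    (hg : g ∈ (coboundaries k X q).submoduleOf (cocycles k X q)) : cupClass k X p q f g = 0 :=
  (Submodule.Quotient.mk_eq_zero _).2 (cup_mem_coboundaries_right k X rfl f.2 hg)

/-- The product of a cocycle with a cohomology class. -/
def cupProductAux (k : Type v) [Field k] (X : SSet.{u}) (p q : ℕ) :
    Cohomology k X q →ₗ[k] cocycles k X p →ₗ[k] Cohomology k X (p + q) :=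
  Submodule.liftQ _ (cupClass k X p q).flip fun g hg =>
    LinearMap.ext fun f => cupClass_eq_zero_right k X p q f g hg

/-- The cup product of cohomology classes: `[f] ∪ [g] = [f ∪ g]`. -/
def cupProduct (k : Type v) [Field k] (X : SSet.{u}) (p q : ℕ) :
    Cohomology k X p →ₗ[k] Cohomology k X q →ₗ[k] Cohomology k X (p + q) :=
  Submodule.liftQ _ (cupProductAux k X p q).flip fun f hf =>
    LinearMap.ext fun g => by
      obtain ⟨g, rfl⟩ := Submodule.mkQ_surjective _ g
      exact cupClass_eq_zero_left k X p q f hf g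

theorem cupProduct_cohomologyClass (k : Type v) [Field k] (X : SSet.{u}) (p q : ℕ)
    (f : cocycles k X p) (g : cocycles k X q) :
    cupProduct k X p q (cohomologyClass k X p f) (cohomologyClass k X q g) =
      cohomologyClass k X (p + q) ⟨cup k X rfl f.1 g.1, cup_mem_cocycles k X rfl f.2 g.2⟩ :=
  rfl

theorem one_mem_cocycles (k : Type v) [Field k] (X : SSet.{u}) :
    (fun _ => 1 : Cochain k X 0) ∈ cocycles k X 0 := by
  rw [LinearMap.mem_ker]
  funext σ
  simp [coboundary, Fin.sum_univ_succ]

instance (k : Type v) [Field k] (X : SSet.{u}) : GradedMonoid.GMul (Cohomology k X) where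
  mul {p q} a b := cupProduct k X p q a b

instance (k : Type v) [Field k] (X : SSet.{u}) : GradedMonoid.GOne (Cohomology k X) where
  one := cohomologyClass k X 0 ⟨fun _ => 1, one_mem_cocycles k X⟩

/-- The singular cohomology `H^p(M; k)`; with its cup product it is a graded algebra `H`. -/
abbrev H (k : Type v) [Field k] (M : Type u) [TopologicalSpace M] : ℕ → Type (max u v) :=
  Cohomology k (TopCat.toSSet.obj (TopCat.of M))

end SingularCohomology

/-! ### The algebra `E₁`

In the rest of the file `A` is a graded `k`-module with a graded product and a unit in degree `0`;
`GradedMonoid A` is the type of homogeneous elements `a = ⟨|a|, a⟩`, with the product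
`a * b` of degree `|a| + |b|`. The case of interest is `A = H^*(M; k)`. -/

/-- The sign `(-1)^m` in `k`. -/
def sgn (k : Type v) [Field k] (m : ℤ) : k := ((m.negOnePow : ℤ) : k)

/-- A homogeneous element, in the total space `⨁ p, A p`. -/
def homog {A : ℕ → Type u} [∀ p, AddCommGroup (A p)] (a : GradedMonoid A) : DirectSum ℕ A :=
  DirectSum.of A a.1 a.2

/-- Generators of `E₁`: the classes `p_i^*(a)` and the symbols `e_{ij}` with `i ≠ j`. -/
inductive Gen (A : ℕ → Type u) (n : ℕ) : Type u
  | pull (i : Fin n) (a : GradedMonoid A)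
  | edge (i j : Fin n) (h : i ≠ j)

/-- The degree: `|p_i^*(a)| = |a|` and `|e_{ij}| = N - 1`. -/
def Gen.deg {A : ℕ → Type u} {n : ℕ} (N : ℕ) : Gen A n → ℤ
  | .pull _ a => a.1
  | .edge _ _ _ => (N : ℤ) - 1

/-- `p_i^*(a)` has bidegree `(|a|, 0)` and `e_{ij}` has bidegree `(0, N - 1)`. The second component
is recorded here as the number of factors `e_{ij}`: the pair `(t, r)` stands for the bidegree
`(t, r (N - 1))`. -/
def Gen.bideg {A : ℕ → Type u} {n : ℕ} : Gen A n → ℕ × ℕ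
  | .pull _ a => (a.1, 0)
  | .edge _ _ _ => (0, 1)

/-- A permutation acts by `p_i^*(a) ↦ p_{σ i}^*(a)` and `e_{ij} ↦ e_{σ i, σ j}`. -/
def Gen.perm {A : ℕ → Type u} {n : ℕ} (σ : Equiv.Perm (Fin n)) : Gen A n → Gen A n
  | .pull i a => .pull (σ i) a
  | .edge i j h => .edge (σ i) (σ j) (σ.injective.ne h)

/-- The relations of `E₁ = (A^{⊗ n} ⊗ Λ(e_{ij})) / I`. The first five present the graded
commutative algebra `A^{⊗ n} ⊗ Λ(e_{ij})`: each `p_i^*` is a morphism of graded algebras, and the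
generators commute up to the Koszul sign. The last four generate the ideal `I`. -/
inductive E1Rel (k : Type v) [Field k] (A : ℕ → Type u) [∀ p, AddCommGroup (A p)]
    [∀ p, Module k (A p)] [GradedMonoid.GMul A] [GradedMonoid.GOne A] (N n : ℕ) :
    FreeAlgebra k (Gen A n) → FreeAlgebra k (Gen A n) → Prop
  | add (i : Fin n) (p : ℕ) (a b : A p) :
      E1Rel k A N n (FreeAlgebra.ι k (.pull i ⟨p, a + b⟩))
        (FreeAlgebra.ι k (.pull i ⟨p, a⟩) + FreeAlgebra.ι k (.pull i ⟨p, b⟩))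
  | smul (i : Fin n) (p : ℕ) (c : k) (a : A p) :
      E1Rel k A N n (FreeAlgebra.ι k (.pull i ⟨p, c • a⟩))
        (c • FreeAlgebra.ι k (.pull i ⟨p, a⟩))
  | one (i : Fin n) : E1Rel k A N n (FreeAlgebra.ι k (.pull i 1)) 1
  | mul (i : Fin n) (a b : GradedMonoid A) :
      E1Rel k A N n (FreeAlgebra.ι k (.pull i (a * b)))
        (FreeAlgebra.ι k (.pull i a) * FreeAlgebra.ι k (.pull i b))
  | comm (x y : Gen A n) :
      E1Rel k A N n (FreeAlgebra.ι k x * FreeAlgebra.ι k y)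
        (sgn k (x.deg N * y.deg N) • (FreeAlgebra.ι k y * FreeAlgebra.ι k x))
  | arnold (i j l : Fin n) (hij : i ≠ j) (hjl : j ≠ l) (hli : l ≠ i) :
      E1Rel k A N n
        (FreeAlgebra.ι k (.edge i j hij) * FreeAlgebra.ι k (.edge j l hjl) +
          FreeAlgebra.ι k (.edge j l hjl) * FreeAlgebra.ι k (.edge l i hli) +
          FreeAlgebra.ι k (.edge l i hli) * FreeAlgebra.ι k (.edge i j hij)) 0
  | sq (i j : Fin n) (h : i ≠ j) :
      E1Rel k A N n (FreeAlgebra.ι k (.edge i j h) * FreeAlgebra.ι k (.edge i j h)) 0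
  | symm (i j : Fin n) (h : i ≠ j) :
      E1Rel k A N n (FreeAlgebra.ι k (.edge i j h))
        (sgn k N • FreeAlgebra.ι k (.edge j i h.symm))
  | slide (i j : Fin n) (h : i ≠ j) (a : GradedMonoid A) :
      E1Rel k A N n (FreeAlgebra.ι k (.pull i a) * FreeAlgebra.ι k (.edge i j h))
        (FreeAlgebra.ι k (.pull j a) * FreeAlgebra.ι k (.edge i j h))

/-- The first term `E₁` of the Cohen-Taylor spectral sequence. -/
abbrev E1 (k : Type v) [Field k] (A : ℕ → Type u) [∀ p, AddCommGroup (A p)]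
    [∀ p, Module k (A p)] [GradedMonoid.GMul A] [GradedMonoid.GOne A] (N n : ℕ) : Type (max u v) :=
  RingQuot (E1Rel k A N n)

section E1

variable (k : Type v) [Field k] (A : ℕ → Type u) [∀ p, AddCommGroup (A p)]
  [∀ p, Module k (A p)] [GradedMonoid.GMul A] [GradedMonoid.GOne A] (N n : ℕ)

/-- The generators as elements of `E₁`. -/
def E1.gen (x : Gen A n) : E1 k A N n :=
  RingQuot.mkAlgHom k (E1Rel k A N n) (FreeAlgebra.ι k x)

/-- The action of a permutation on `E₁`. -/
def E1.perm (σ : Equiv.Perm (Fin n)) : E1 k A N n →ₐ[k] E1 k A N n :=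
  RingQuot.liftAlgHom k ⟨FreeAlgebra.lift k fun x => E1.gen k A N n (x.perm σ), by
    have key : ∀ x y, E1Rel k A N n x y →
        RingQuot.mkAlgHom k (E1Rel k A N n) x = RingQuot.mkAlgHom k (E1Rel k A N n) y :=
      fun _ _ h => RingQuot.mkAlgHom_rel k h
    intro x y h
    cases h with
    | add i p a b => simpa [Gen.perm, E1.gen] using key _ _ (.add (σ i) p a b)
    | smul i p c a => simpa [Gen.perm, E1.gen] using key _ _ (.smul (σ i) p c a)
    | one i => simpa [Gen.perm, E1.gen] using key _ _ (.one (σ i))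
    | mul i a b => simpa [Gen.perm, E1.gen] using key _ _ (.mul (σ i) a b)
    | comm x y =>
      have hd : ∀ z : Gen A n, (z.perm σ).deg N = z.deg N := by
        intro z; cases z <;> rfl
      simpa [E1.gen, hd] using key _ _ (.comm (x.perm σ) (y.perm σ))
    | arnold i j l hij hjl hli =>
      simpa [Gen.perm, E1.gen] using key _ _ (.arnold (σ i) (σ j) (σ l) (σ.injective.ne hij)
        (σ.injective.ne hjl) (σ.injective.ne hli))
    | sq i j h => simpa [Gen.perm, E1.gen] using key _ _ (.sq (σ i) (σ j) (σ.injective.ne h))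
    | symm i j h => simpa [Gen.perm, E1.gen] using key _ _ (.symm (σ i) (σ j) (σ.injective.ne h))
    | slide i j h a =>
      simpa [Gen.perm, E1.gen] using key _ _ (.slide (σ i) (σ j) (σ.injective.ne h) a)⟩

/-- The subalgebra `E₁^{Σ_n}` of invariants. -/
def E1.invariants : Subalgebra k (E1 k A N n) where
  carrier := {x | ∀ σ : Equiv.Perm (Fin n), E1.perm k A N n σ x = x}
  mul_mem' hx hy σ := by rw [map_mul, hx σ, hy σ]
  add_mem' hx hy σ := by rw [map_add, hx σ, hy σ]
  algebraMap_mem' c σ := AlgHom.commutes _ c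

/-- The elements of `E₁` of bidegree `(t, r (N - 1))`. -/
def E1.bihomogeneous (t r : ℕ) : Submodule k (E1 k A N n) :=
  Submodule.span k {x | ∃ w : List (Gen A n),
    (w.map Gen.bideg).sum = (t, r) ∧ x = (w.map (E1.gen k A N n)).prod}

end E1

section DualBases

variable (k : Type v) [Field k] {A : ℕ → Type u} [∀ p, AddCommGroup (A p)]
  [∀ p, Module k (A p)] [GradedMonoid.GMul A] [GradedMonoid.GOne A]

/-- Homogeneous bases `b`, `b'` of `A` which are dual for the pairing given by the product and the
generator `Ω` of `A^N`: `b_i b'_j = δ_{ij} Ω` whenever `|b_i| + |b'_j| = N`. -/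
structure IsDualBases {N : ℕ} (Ω : A N) {m : ℕ} (b b' : Fin m → GradedMonoid A) : Prop where
  omega_ne_zero : Ω ≠ 0
  omega_span : ∀ w : A N, ∃ c : k, w = c • Ω
  linearIndependent : LinearIndependent k fun i => homog (b i)
  span_eq_top : Submodule.span k (Set.range fun i => homog (b i)) = ⊤
  deg_add : ∀ i, (b i).1 + (b' i).1 = N
  dual : ∀ i j, (b i).1 + (b' j).1 = N →
    homog (b i * b' j) = if i = j then homog (A := A) ⟨N, Ω⟩ else 0

/-- `d₁` is the differential of `E₁`: the graded derivation with `d₁(p_i^* a) = 0` and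
`d₁(e_{ij}) = p_{ij}^*(Δ)`, for the diagonal class `Δ = ∑_q (-1)^{|b'_q|} b_q ⊗ b'_q`. -/
structure IsE1Differential (N n : ℕ) {m : ℕ} (b b' : Fin m → GradedMonoid A)
    (d₁ : E1 k A N n →ₗ[k] E1 k A N n) : Prop where
  leibniz : ∀ (t r : ℕ), ∀ x ∈ E1.bihomogeneous k A N n t r, ∀ y : E1 k A N n,
    d₁ (x * y) = d₁ x * y + sgn k (t + r * ((N : ℤ) - 1)) • (x * d₁ y)
  pull : ∀ i a, d₁ (E1.gen k A N n (.pull i a)) = 0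
  edge : ∀ i j h, d₁ (E1.gen k A N n (.edge i j h)) =
    ∑ q, sgn k (b' q).1 • (E1.gen k A N n (.pull i (b q)) * E1.gen k A N n (.pull j (b' q)))

end DualBases

/-! ### The module `C_n` -/

/-- The relations of the graded symmetric power: exchanging two neighbours produces the Koszul
sign, where an element of `A p` is given the degree `p + c`. -/
def powerRelations (k : Type v) [Field k] (A : ℕ → Type u) [∀ p, AddCommGroup (A p)]
    [∀ p, Module k (A p)] (c : ℤ) (m : ℕ) :
    Submodule k (PiTensorProduct k fun _ : Fin m => DirectSum ℕ A) :=
  Submodule.span k {w | ∃ (x : Fin m → GradedMonoid A) (i j : Fin m), (i : ℕ) + 1 = j ∧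
    w = PiTensorProduct.tprod k (fun a => homog (x a)) -
      sgn k (((x i).1 + c) * ((x j).1 + c)) •
        PiTensorProduct.tprod k (fun a => homog (x (Equiv.swap i j a)))}

/-- `Λ^m(s^c A)`, the part of word length `m` of the free graded commutative algebra on the graded
module `s^c A` (the copy of `A` in which an element of `A p` has degree `p + c`). It is presented as
the quotient of the `m`-th tensor power by the Koszul sign rule; this is used only when `m ≤ 1` or
`2` is invertible in `k`, so that squares of elements of odd degree vanish. -/
abbrev Power (k : Type v) [Field k] (A : ℕ → Type u) [∀ p, AddCommGroup (A p)]
    [∀ p, Module k (A p)] (c : ℤ) (m : ℕ) : Type (max u v) :=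
  (PiTensorProduct k fun _ : Fin m => DirectSum ℕ A) ⧸ powerRelations k A c m

/-- The element `x_1 ∧ ⋯ ∧ x_m` of `Λ^m(s^c A)`. -/
def Power.wedge (k : Type v) [Field k] {A : ℕ → Type u} [∀ p, AddCommGroup (A p)]
    [∀ p, Module k (A p)] (c : ℤ) {m : ℕ} (x : Fin m → GradedMonoid A) : Power k A c m :=
  Submodule.Quotient.mk (PiTensorProduct.tprod k fun a => homog (x a))

/-- `C_n = ⨁_{m + 2 r = n} Λ^m(A) ⊗ Λ^r(s^{N-1} A)`, the sum being over `r = 0, …, ⌊n/2⌋` with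
`m = n - 2 r`. -/
abbrev Cn (k : Type v) [Field k] (A : ℕ → Type u) [∀ p, AddCommGroup (A p)]
    [∀ p, Module k (A p)] (N n : ℕ) : Type (max u v) :=
  DirectSum {q : ℕ × ℕ // q.1 + 2 * q.2 = n} fun q =>
    TensorProduct k (Power k A 0 q.1.1) (Power k A ((N : ℤ) - 1) q.1.2)

section Cn

variable (k : Type v) [Field k] {A : ℕ → Type u} [∀ p, AddCommGroup (A p)]
  [∀ p, Module k (A p)] (N : ℕ) {n : ℕ}

/-- The element `x_1 ∧ ⋯ ∧ x_m ⊗ s y_1 ∧ ⋯ ∧ s y_r` of `C_n`, where `s = s^{N-1}`. -/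
def Cn.word {m r : ℕ} (h : m + 2 * r = n) (x : Fin m → GradedMonoid A)
    (y : Fin r → GradedMonoid A) : Cn k A N n :=
  DirectSum.lof k {q : ℕ × ℕ // q.1 + 2 * q.2 = n}
    (fun q => TensorProduct k (Power k A 0 q.1.1) (Power k A ((N : ℤ) - 1) q.1.2))
    ⟨(m, r), h⟩ (Power.wedge k 0 x ⊗ₜ[k] Power.wedge k ((N : ℤ) - 1) y)

/-- The elements of `C_n` of bidegree `(t, r (N - 1))`, so of degree `t + r (N - 1)`: the part of
`Λ^{n-2r}(A) ⊗ Λ^r(s^{N-1} A)` in which the degrees in `A` of the letters add up to `t`. -/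
def Cn.bihomogeneous (n t r : ℕ) : Submodule k (Cn k A N n) :=
  Submodule.span k {w | ∃ (m : ℕ) (h : m + 2 * r = n) (x : Fin m → GradedMonoid A)
    (y : Fin r → GradedMonoid A),
    (∑ i, (x i).1) + ∑ i, (y i).1 = t ∧ w = Cn.word k N h x y}

end Cn

/-! ### The product of `C_n` -/

/-- The Koszul sign of the rearrangement `tgt` of the word `src`: a factor `(-1)^{|a| |b|}` for each
pair of letters `a`, `b` whose order is reversed. -/
def koszul {S : Type} [DecidableEq S] (deg : S → ℤ) : List S → List S → ℤˣ
  | [], _ => 1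
  | a :: src, tgt =>
    (deg a * ((tgt.takeWhile fun b => b ≠ a).map deg).sum).negOnePow * koszul deg src (tgt.erase a)

/-- The letters of the word
`x_1 ⋯ x_a  (s y_1) ⋯ (s y_r)  z_1 ⋯ z_b  (s t_1) ⋯ (s t_q)`; the symbols `s` are letters too. -/
inductive Letter (a r b q : ℕ) : Type
  | x (i : Fin a)
  | sy (i : Fin r)
  | y (i : Fin r)
  | z (i : Fin b)
  | st (i : Fin q)
  | t (i : Fin q)
  deriving DecidableEq

def Letter.deg {A : ℕ → Type u} {a r b q : ℕ} (N : ℕ) (x : Fin a → GradedMonoid A)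
    (y : Fin r → GradedMonoid A) (z : Fin b → GradedMonoid A) (t : Fin q → GradedMonoid A) :
    Letter a r b q → ℤ
  | .x i => (x i).1
  | .sy _ => (N : ℤ) - 1
  | .y i => (y i).1
  | .z i => (z i).1
  | .st _ => (N : ℤ) - 1
  | .t i => (t i).1

/-- The word `x_1 ⋯ x_a  s y_1 ⋯ s y_r  z_1 ⋯ z_b  s t_1 ⋯ s t_q`. -/
def sourceWord (a r b q : ℕ) : List (Letter a r b q) :=
  (List.finRange a).map .x ++ (List.finRange r).flatMap (fun j => [.sy j, .y j]) ++
    (List.finRange b).map .z ++ (List.finRange q).flatMap (fun j => [.st j, .t j])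

/-- The position `l + 2 j` (counted from `0`, for `j = 0, …, q - 1`). -/
def evenPos {l q : ℕ} (j : Fin q) : Fin (l + 2 * q) := ⟨l + 2 * j, by omega⟩

/-- The position `l + 2 j + 1` (counted from `0`, for `j = 0, …, q - 1`). -/
def oddPos {l q : ℕ} (j : Fin q) : Fin (l + 2 * q) := ⟨l + 2 * j + 1, by omega⟩

/-- The word
`x_{σ 1} z_{τ 1} ⋯ x_{σ l} z_{τ l}
 s x_{σ(l+1)} x_{σ(l+2)} t_1 ⋯ s x_{σ(l+2q-1)} x_{σ(l+2q)} t_q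
 s z_{τ(l+1)} z_{τ(l+2)} y_1 ⋯ s z_{τ(l+2r-1)} z_{τ(l+2r)} y_r`. -/
def targetWord {l r q : ℕ} (σ : Equiv.Perm (Fin (l + 2 * q))) (τ : Equiv.Perm (Fin (l + 2 * r))) :
    List (Letter (l + 2 * q) r (l + 2 * r) q) :=
  (List.finRange l).flatMap (fun i => [.x (σ (Fin.castAdd _ i)), .z (τ (Fin.castAdd _ i))]) ++
    (List.finRange q).flatMap (fun j => [.st j, .x (σ (evenPos j)), .x (σ (oddPos j)), .t j]) ++
    (List.finRange r).flatMap (fun j => [.sy j, .z (τ (evenPos j)), .z (τ (oddPos j)), .y j])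

section Product

variable (k : Type v) [Field k] {A : ℕ → Type u} [∀ p, AddCommGroup (A p)]
  [∀ p, Module k (A p)] [GradedMonoid.GMul A] [GradedMonoid.GOne A] (N : ℕ) {n : ℕ}

/-- `μ` is the product of `C_n`. With `l = n - 2 q - 2 r`,
`(x_1 ∧ ⋯ ∧ x_{n-2r} ⊗ s y_1 ∧ ⋯ ∧ s y_r) · (z_1 ∧ ⋯ ∧ z_{n-2q} ⊗ s t_1 ∧ ⋯ ∧ s t_q)` is
`(1 / l!) ∑_{σ, τ} ε_{σ, τ} α_{σ, τ} ⊗ β_{σ, τ} ∧ γ_{σ, τ}`, where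
* `α_{σ, τ} = (x_{σ 1} z_{τ 1}) ∧ ⋯ ∧ (x_{σ l} z_{τ l})`,
* `β_{σ, τ} = s(x_{σ(l+1)} x_{σ(l+2)} t_1) ∧ ⋯ ∧ s(x_{σ(l+2q-1)} x_{σ(l+2q)} t_q)`,
* `γ_{σ, τ} = s(z_{τ(l+1)} z_{τ(l+2)} y_1) ∧ ⋯ ∧ s(z_{τ(l+2r-1)} z_{τ(l+2r)} y_r)`,
* `ε_{σ, τ}` is the Koszul sign of the rearrangement of the letters;

the product is `0` if `2 q + 2 r > n`. -/
structure IsProduct (μ : Cn k A N n →ₗ[k] Cn k A N n →ₗ[k] Cn k A N n) : Prop where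
  formula : ∀ (l r q : ℕ) (h : l + 2 * (q + r) = n)
    (x : Fin (l + 2 * q) → GradedMonoid A) (y : Fin r → GradedMonoid A)
    (z : Fin (l + 2 * r) → GradedMonoid A) (t : Fin q → GradedMonoid A),
    μ (Cn.word k N (by omega) x y) (Cn.word k N (by omega) z t) =
      ((l.factorial : ℕ) : k)⁻¹ • ∑ σ : Equiv.Perm (Fin (l + 2 * q)),
        ∑ τ : Equiv.Perm (Fin (l + 2 * r)),
          (((koszul (Letter.deg N x y z t) (sourceWord _ _ _ _) (targetWord σ τ) : ℤˣ) : ℤ) : k) •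
            Cn.word k N h
              (fun i => x (σ (Fin.castAdd _ i)) * z (τ (Fin.castAdd _ i)))
              (Fin.append (fun j => x (σ (evenPos j)) * x (σ (oddPos j)) * t j)
                (fun j => z (τ (evenPos j)) * z (τ (oddPos j)) * y j))
  eq_zero : ∀ (m r m' q : ℕ) (h : m + 2 * r = n) (h' : m' + 2 * q = n)
    (x : Fin m → GradedMonoid A) (y : Fin r → GradedMonoid A)
    (z : Fin m' → GradedMonoid A) (t : Fin q → GradedMonoid A), n < 2 * q + 2 * r →
    μ (Cn.word k N h x y) (Cn.word k N h' z t) = 0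

/-- `d` is a graded derivation of `(C_n, μ)` which maps `Λ^{n-2r}(A) ⊗ Λ^r(s^{N-1} A)` to
`Λ^{n-2r+2}(A) ⊗ Λ^{r-1}(s^{N-1} A)` (to `0` if `r = 0`), raising the degree by `1`, and which
satisfies
`d(e_0 ∧ ⋯ ∧ e_0 ⊗ s a) = (1/2) ∑_q (-1)^{|b'_q|} e_0 ∧ ⋯ ∧ e_0 ∧ (a b_q) ∧ b'_q`, where `e_0 = 1`
is the unit of `A`. -/
structure IsDifferential {m₀ : ℕ} (b b' : Fin m₀ → GradedMonoid A)
    (μ : Cn k A N n →ₗ[k] Cn k A N n →ₗ[k] Cn k A N n) (d : Cn k A N n →ₗ[k] Cn k A N n) :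
    Prop where
  map_zero_part : ∀ (t : ℕ), ∀ w ∈ Cn.bihomogeneous k N n t 0, d w = 0
  map_succ_part : ∀ (t r : ℕ), ∀ w ∈ Cn.bihomogeneous k N n t (r + 1),
    d w ∈ Cn.bihomogeneous k N n (t + N) r
  leibniz : ∀ (t r : ℕ), ∀ u ∈ Cn.bihomogeneous k N n t r, ∀ w : Cn k A N n,
    d (μ u w) = μ (d u) w + sgn k (t + r * ((N : ℤ) - 1)) • μ u (d w)
  unit_formula : ∀ (m : ℕ) (h : m + 2 * 1 = n) (a : GradedMonoid A),
    d (Cn.word k N h (fun _ => 1) ![a]) =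
      (2 : k)⁻¹ • ∑ q, sgn k (b' q).1 •
        Cn.word k N (show (m + 2) + 2 * 0 = n by omega)
          (Fin.append (fun _ : Fin m => 1) ![a * b q, b' q]) ![]

/-- The formula for the differential of a general element:
`d(x_1 ∧ ⋯ ∧ x_m ⊗ s y_1 ∧ ⋯ ∧ s y_{r+1})` is
`(1/2) ∑_i ∑_q ± x_1 ∧ ⋯ ∧ x_m ∧ (y_i b_q) ∧ b'_q ⊗ s y_1 ∧ ⋯ (omit s y_i) ⋯ ∧ s y_{r+1}` with the
sign `(-1)^{|b'_q| + ∑_j |x_j| + (|y_i| + 1) ∑_{j < i} (|y_j| + 1)}`. -/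
def DifferentialFormula {m₀ : ℕ} (b b' : Fin m₀ → GradedMonoid A)
    (d : Cn k A N n →ₗ[k] Cn k A N n) : Prop :=
  ∀ (m r : ℕ) (h : m + 2 * (r + 1) = n) (x : Fin m → GradedMonoid A)
    (y : Fin (r + 1) → GradedMonoid A),
    d (Cn.word k N h x y) =
      (2 : k)⁻¹ • ∑ i : Fin (r + 1), ∑ q,
        sgn k ((b' q).1 + (∑ j, (x j).1) +
            ((y i).1 + 1) * ∑ j ∈ Finset.univ.filter (fun j => j < i), ((y j).1 + 1)) •
          Cn.word k N (show (m + 2) + 2 * r = n by omega)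
            (Fin.append x ![y i * b q, b' q]) (fun j => y (i.succAbove j))

end Product

end

end CohenTaylor

open CohenTaylor

namespace CohenTaylor

noncomputable section

universe u v w

/-! ### Graded commutativity of the cup product, by Steenrod's `∪₁`-product -/

section CupCommutativity

open CategoryTheory Simplicial

/-! The hypothesis on the characteristic makes `n!` invertible in `k`, so averages over `Σ_n` and
over its subgroups are available. Of the cohomology `H`, the isomorphism and the product need only
that the cup product is bilinear, associative, unital and graded commutative. The last property
comes from Steenrod's `∪₁`-homotopy; afterwards `A` is any such algebra. Since `N` is even, `e_{ij}`
depends only on the pair `{i, j}`, and the edges anticommute.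

Surjectivity of `Ψ`. The invariants are spanned by symmetrized monomials in the `p_i^*(a)` and
`e_{ij}`. Such a symmetrization vanishes unless the edges form a matching (`symSum_genProd`). The
combinatorial core is `symSum_edProd`. If the edges form a connected graph, the Arnold relation
writes their product as `e_{uv}` times an alternating sum of shorter products, for any two distinct
vertices `u`, `v` of the graph (`edProd_eq_of_reachable`). The same `e_{ij}` can therefore be
extracted from every translate, and what is left is a symmetrization of shorter products. The
induction ends at two edges with a common vertex, or at a matching with two or more edges; there a
permutation exchanges two edges and changes the sign. What survives are the sums `monoSum` of a
monomial `∏ p_i^*(x_i) ∏ e_j p_j^*(y_j)` over all layouts of its letters on `Fin n`, and `Ψ` sends a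
word to `2^{-r}` times this sum.

Product. In a product of two such sums, the pairs of layouts whose edges do not form a matching
contribute an invariant element with zero average, that is, zero. The other pairs arise from a
layout of the result together with two permutations `σ`, `τ`, each exactly `l!` times
(`sum_layout_layout`). This is the double sum divided by `l!`; reordering the letters gives the
Koszul sign (`koszul_eval`).

Injectivity of `Ψ`. As `E₁` is given by generators and relations, representations are needed to see
that elements are nonzero. A layout groups the points of `Fin n` into slots, one for each single
point and one for each pair. On the tensor product of copies of `A ⊕ εA`, one for each slot, an edge
inside a slot acts by `ε` and an edge between slots by `0` (`slotRep`). The resulting functional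
`layoutFun` kills the sums with more edges than the layout has, and on those with equally many edges
it returns the word times the order of a subgroup of `Σ_n`. So `Ψ` is injective by triangularity.

Differential. The derivation `d₁` is the corner entry of a representation by triangular matrices
(`diffRep`). The relations for it reduce to the symmetry of `Δ` and to `(a ⊗ 1) Δ = (1 ⊗ a) Δ`,
consequences of Poincaré duality. Since `d₁` commutes with `Σ_n`, it can be transported to `C_n`.
Breaking up a pair is a bijection between layouts, and this gives the explicit formula. Uniqueness
on `C_n` holds because words without `s`-letters and the words `e_0 ∧ ⋯ ∧ e_0 ⊗ s a` generate the
algebra (`monoSum_mem_of_generators`). -/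

/-- The simplex of `σ` with vertices `u 0, …, u a` (cut off at the last vertex of `σ`). -/
def vertexSimplex {X : SSet.{u}} {n : ℕ} (σ : X _⦋n⦌) (a : ℕ) (f : ℕ →o ℕ) : X _⦋a⦌ :=
  X.map (SimplexCategory.mkHom (n := a) (m := n)
    ⟨fun t : Fin (a + 1) => (⟨min (f t) n, by omega⟩ : Fin (n + 1)),
      fun s t h => by
        have : f s ≤ f t := f.monotone h
        simp only [Fin.mk_le_mk]; omega⟩).op σ

theorem map_op_congr {X : SSet.{u}} {a c : ℕ} {f g : ⦋a⦌ ⟶ ⦋c⦌}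
    (h : ∀ j : Fin (a + 1), ((f.toOrderHom j : Fin (c + 1)) : ℕ) =
      ((g.toOrderHom j : Fin (c + 1)) : ℕ)) (σ : X _⦋c⦌) :
    X.map f.op σ = X.map g.op σ := by
  have : f = g := by
    ext j : 3
    exact Fin.ext (h j)
  rw [this]

theorem vertexSimplex_congr {X : SSet.{u}} {n : ℕ} (σ : X _⦋n⦌) {a : ℕ} {f g : ℕ →o ℕ}
    (h : ∀ t ≤ a, f t = g t) : vertexSimplex σ a f = vertexSimplex σ a g := by
  apply map_op_congr
  intro t
  have := h t (by omega)
  change min (f t) n = min (g t) n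
  rw [this]

/-- The order embedding of `ℕ` omitting `k`. -/
def skip (k : ℕ) : ℕ →o ℕ := ⟨fun t => if t < k then t else t + 1, fun s t h => by
  dsimp only; split_ifs <;> omega⟩

theorem skip_apply (k t : ℕ) : skip k t = if t < k then t else t + 1 := rfl

theorem face_vertexSimplex {X : SSet.{u}} {n : ℕ} (σ : X _⦋n⦌) {a : ℕ} (f : ℕ →o ℕ)
    (i : Fin (a + 2)) :
    X.δ i (vertexSimplex σ (a + 1) f) = vertexSimplex σ a (f.comp (skip i)) := by
  apply map_op_map_op'
  intro j
  change min (f (((SimplexCategory.δ i).toOrderHom j : Fin (a + 2)) : ℕ)) n = min (f (skip i j)) n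
  rw [face_val]; rfl

theorem vertexSimplex_face {X : SSet.{u}} {n : ℕ} (σ : X _⦋n + 1⦌) {a : ℕ} (f : ℕ →o ℕ)
    (hf : ∀ t ≤ a, f t ≤ n) (i : Fin (n + 2)) :
    vertexSimplex (X.δ i σ) a f = vertexSimplex σ a ((skip i).comp f) := by
  apply map_op_map_op'
  intro j
  have := hf j (by omega)
  have h2 := i.2
  change (((SimplexCategory.δ i).toOrderHom (⟨min (f j) n, by omega⟩ : Fin (n + 1)) :
    Fin (n + 2)) : ℕ) = min (skip i (f j)) (n + 1)
  rw [face_val]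
  rw [skip_apply]
  change (if min (f j) n < (i : ℕ) then min (f j) n else min (f j) n + 1) = _
  rw [min_eq_left this]
  split_ifs
  · rw [min_eq_left (by omega)]
  · rw [min_eq_left (by omega)]

theorem front_eq_vertexSimplex {X : SSet.{u}} {n p : ℕ} (h : p ≤ n) (σ : X _⦋n⦌) :
    front p h σ = vertexSimplex σ p OrderHom.id := by
  apply map_op_congr
  intro t
  change (t : ℕ) + 0 = min (t : ℕ) n
  omega

/-- Translation of `ℕ` by `i`. -/
def shiftBy (i : ℕ) : ℕ →o ℕ := ⟨fun t => t + i, fun s t h => by dsimp only; omega⟩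

theorem shiftBy_apply (i t : ℕ) : shiftBy i t = t + i := rfl

theorem back_eq_vertexSimplex {X : SSet.{u}} {n p q : ℕ} (h : p + q ≤ n) (σ : X _⦋n⦌) :
    back p q h σ = vertexSimplex σ q (shiftBy p) := by
  apply map_op_congr
  intro t
  change (t : ℕ) + p = min ((t : ℕ) + p) n
  omega

theorem cocycle_vertexSimplex {k : Type v} [Field k] {X : SSet.{u}} {n p : ℕ} (σ : X _⦋n⦌)
    {f : Cochain k X p} (hf : f ∈ cocycles k X p) (g : ℕ →o ℕ) :
    ∑ i ∈ Finset.range (p + 2), (-1 : k) ^ i * f (vertexSimplex σ p (g.comp (skip i))) = 0 := by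
  have h := congrFun (LinearMap.mem_ker.1 hf) (vertexSimplex σ (p + 1) g)
  simp only [coboundary, LinearMap.coe_mk, AddHom.coe_mk, face_vertexSimplex] at h
  rw [Finset.sum_range]
  exact h

/-- `0, …, j, j + q, j + q + 1, …`. -/
def gap (q j : ℕ) : ℕ →o ℕ := ⟨fun t => if t ≤ j then t else t + q - 1, fun s t h => by
  dsimp only; split_ifs <;> omega⟩

theorem gap_apply (q j t : ℕ) : gap q j t = if t ≤ j then t else t + q - 1 := rfl

/-- Steenrod's `∪₁`-product, up to an overall sign. -/
def cupOne (k : Type v) [Field k] (X : SSet.{u}) {p q : ℕ} (f : Cochain k X (p + 1))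
    (g : Cochain k X q) : Cochain k X (p + q) := fun τ =>
  ∑ i ∈ Finset.range (p + 1), ((-1 : k) ^ (q + 1)) ^ i *
    (f (vertexSimplex τ (p + 1) (gap q i)) * g (vertexSimplex τ q (shiftBy i)))

/-- This is the coboundary formula for the `∪₁`-product, with the cochains replaced by functions of
the vertex map that satisfy the cocycle condition. A face of the `i`-th summand deletes a vertex
from the initial piece of `F`, from the interior of the block of `G`, or from the final piece of
`F`. The cocycle conditions turn the sum over these faces into a difference of consecutive terms,
and the two ends of the telescope are the two cup products. -/
theorem cupOne_identity {k : Type v} [Field k] (p q : ℕ) (F G : (ℕ →o ℕ) → k)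
    (hFc : ∀ u v : ℕ →o ℕ, (∀ t ≤ p + 1, u t = v t) → F u = F v)
    (hGc : ∀ u v : ℕ →o ℕ, (∀ t ≤ q, u t = v t) → G u = G v)
    (hF : ∀ u : ℕ →o ℕ, ∑ i ∈ Finset.range (p + 3), (-1 : k) ^ i * F (u.comp (skip i)) = 0)
    (hG : ∀ u : ℕ →o ℕ, ∑ i ∈ Finset.range (q + 2), (-1 : k) ^ i * G (u.comp (skip i)) = 0) :
    ∑ j ∈ Finset.range (p + q + 2), (-1 : k) ^ j * ∑ i ∈ Finset.range (p + 1),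
      ((-1 : k) ^ (q + 1)) ^ i * (F ((skip j).comp (gap q i)) * G ((skip j).comp (shiftBy i))) =
    (-1) ^ (q + 1) * ((-1) ^ ((p + 1) * q) * (F OrderHom.id * G (shiftBy (p + 1))) -
      G OrderHom.id * F (shiftBy q)) := by
  set ε : k := (-1) ^ (q + 1) with hε
  have hε2 : ε * ε = 1 := by rw [hε, ← mul_pow]; simp
  -- `Av j` is `F` on `0, …, j, j + q + 1, …` and `Gv j` is `G` on `j, …, j + q`. `Lo j` and `Hi j`
  -- are the parts of the cocycle relation of `F` along `gap q j` that omit a position before `j` or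
  -- after `j + 1`.
  let Av : ℕ → k := fun j => F ((gap q j).comp (skip (j + 1)))
  let Gv : ℕ → k := fun j => G (shiftBy j)
  let Lo : ℕ → k := fun j => ∑ t ∈ Finset.range j, (-1 : k) ^ t * F ((gap q j).comp (skip t))
  let Hi : ℕ → k := fun j => ∑ t ∈ Finset.range (p + 1 - j),
    (-1 : k) ^ (j + 2 + t) * F ((gap q j).comp (skip (j + 2 + t)))
  let W : ℕ → k := fun j => Hi j * Gv j - (-1) ^ j * Av j * Gv j
  have hU : ∀ j, F ((gap q (j + 1)).comp (skip (j + 1))) = Av j := fun j => hFc _ _ fun t _ => by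
    simp only [gap_apply, skip_apply, shiftBy_apply, OrderHom.comp_coe, Function.comp, OrderHom.id_coe, id]
    split_ifs <;> omega
  have hco : ∀ j ≤ p + 1, Lo j + (-1) ^ j * F ((gap q j).comp (skip j)) - (-1) ^ j * Av j + Hi j
      = 0 := by
    intro j hj
    have h := hF (gap q j)
    rw [show p + 3 = j + 2 + (p + 1 - j) by omega, Finset.sum_range_add,
      Finset.sum_range_succ, Finset.sum_range_succ] at h
    simp only [Lo, Hi, Av]
    rw [pow_succ] at h
    linear_combination h
  have hmid : ∀ i, ∑ t ∈ Finset.range q, (-1 : k) ^ (i + 1 + t) *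
      G ((skip (i + 1 + t)).comp (shiftBy i)) =
        -((-1) ^ i * Gv (i + 1) + (-1) ^ i * ε * Gv i) := by
    intro i
    have h := hG (shiftBy i)
    rw [Finset.sum_range_succ, Finset.sum_range_succ'] at h
    have e1 : G ((shiftBy i).comp (skip 0)) = Gv (i + 1) := hGc _ _ fun t _ => by
      simp only [gap_apply, skip_apply, shiftBy_apply, OrderHom.comp_coe, Function.comp, OrderHom.id_coe, id]
      split_ifs <;> omega
    have e2 : G ((shiftBy i).comp (skip (q + 1))) = Gv i := hGc _ _ fun t _ => by
      simp only [gap_apply, skip_apply, shiftBy_apply, OrderHom.comp_coe, Function.comp, OrderHom.id_coe, id]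
      split_ifs <;> omega
    have e3 : ∀ t ∈ Finset.range q, (-1 : k) ^ (i + 1 + t) *
        G ((skip (i + 1 + t)).comp (shiftBy i)) =
        (-1) ^ i * ((-1) ^ (t + 1) * G ((shiftBy i).comp (skip (t + 1)))) := by
      intro t _
      rw [hGc ((skip (i + 1 + t)).comp (shiftBy i)) ((shiftBy i).comp (skip (t + 1)))]
      · ring
      · intro s _
        simp only [gap_apply, skip_apply, shiftBy_apply, OrderHom.comp_coe, Function.comp, OrderHom.id_coe, id]
        split_ifs <;> omega
    rw [Finset.sum_congr rfl e3, ← Finset.mul_sum]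
    rw [e1, e2] at h
    linear_combination (-1) ^ i * h
  have hterm : ∀ i ∈ Finset.range (p + 1), ∑ j ∈ Finset.range (p + q + 2), (-1 : k) ^ j *
      (ε ^ i * (F ((skip j).comp (gap q i)) * G ((skip j).comp (shiftBy i)))) =
      ε * (ε ^ i * W i - ε ^ (i + 1) * W (i + 1)) := by
    intro i hi
    have hi' : i ≤ p := by simpa [Nat.lt_succ_iff] using hi
    -- The faces are split into `j ≤ i`, `i < j ≤ i + q` and `j > i + q`.
    rw [show p + q + 2 = (i + 1) + q + (p + 1 - i) by omega, Finset.sum_range_add,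
      Finset.sum_range_add]
    have s1 : ∑ j ∈ Finset.range (i + 1), (-1 : k) ^ j *
        (ε ^ i * (F ((skip j).comp (gap q i)) * G ((skip j).comp (shiftBy i)))) =
        ε ^ i * (Lo (i + 1) * Gv (i + 1)) := by
      simp only [Lo]
      rw [Finset.sum_mul, Finset.mul_sum]
      refine Finset.sum_congr rfl fun j hj => ?_
      have hj' : j < i + 1 := by simpa using hj
      rw [hFc ((skip j).comp (gap q i)) ((gap q (i + 1)).comp (skip j)),
        hGc ((skip j).comp (shiftBy i)) (shiftBy (i + 1))]
      · ring
      · intro s _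
        simp only [gap_apply, skip_apply, shiftBy_apply, OrderHom.comp_coe, Function.comp, OrderHom.id_coe, id]
        split_ifs <;> omega
      · intro s _
        simp only [gap_apply, skip_apply, shiftBy_apply, OrderHom.comp_coe, Function.comp, OrderHom.id_coe, id]
        split_ifs <;> omega
    have s2 : ∑ t ∈ Finset.range q, (-1 : k) ^ (i + 1 + t) *
        (ε ^ i * (F ((skip (i + 1 + t)).comp (gap q i)) *
          G ((skip (i + 1 + t)).comp (shiftBy i)))) =
        ε ^ i * Av i * -((-1) ^ i * Gv (i + 1) + (-1) ^ i * ε * Gv i) := by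
      rw [← hmid, Finset.mul_sum]
      refine Finset.sum_congr rfl fun t ht => ?_
      have ht' : t < q := by simpa using ht
      rw [hFc ((skip (i + 1 + t)).comp (gap q i)) ((gap q i).comp (skip (i + 1)))]
      · simp only [Av]; ring
      · intro s _
        simp only [gap_apply, skip_apply, shiftBy_apply, OrderHom.comp_coe, Function.comp, OrderHom.id_coe, id]
        split_ifs <;> omega
    have s3 : ∑ t ∈ Finset.range (p + 1 - i), (-1 : k) ^ (i + 1 + q + t) *
        (ε ^ i * (F ((skip (i + 1 + q + t)).comp (gap q i)) *
          G ((skip (i + 1 + q + t)).comp (shiftBy i)))) = ε ^ i * (ε * Hi i * Gv i) := by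
      simp only [Hi]
      rw [Finset.mul_sum, Finset.sum_mul, Finset.mul_sum]
      refine Finset.sum_congr rfl fun t ht => ?_
      rw [hFc ((skip (i + 1 + q + t)).comp (gap q i)) ((gap q i).comp (skip (i + 2 + t))),
        hGc ((skip (i + 1 + q + t)).comp (shiftBy i)) (shiftBy i)]
      · rw [hε]; simp only [Gv]; ring
      · intro s _
        simp only [gap_apply, skip_apply, shiftBy_apply, OrderHom.comp_coe, Function.comp, OrderHom.id_coe, id]
        split_ifs <;> omega
      · intro s _
        simp only [gap_apply, skip_apply, shiftBy_apply, OrderHom.comp_coe, Function.comp, OrderHom.id_coe, id]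
        split_ifs <;> omega
    rw [s1, s2, s3]
    have h := hco (i + 1) (by omega)
    rw [hU] at h
    simp only [W]
    rw [pow_succ] at h ⊢
    linear_combination ε ^ i * Gv (i + 1) * h - ε ^ i * (Hi (i + 1) * Gv (i + 1) -
      (-1) ^ i * (-1) * Av (i + 1) * Gv (i + 1)) * (1 - hε2)
  simp only [Finset.mul_sum]
  rw [Finset.sum_comm, Finset.sum_congr rfl hterm, ← Finset.mul_sum,
    Finset.sum_range_sub' (fun i => ε ^ i * W i)]
  -- The ends of the telescope: `W 0` is `-F(q, q + 1, …) G(0, …, q)`, by the cocycle relation at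
  -- `0`, and `W (p + 1)` is `F(0, …, p + 1) G(p + 1, …)` up to sign.
  have h0 := hco 0 (by omega)
  have e0 : F ((gap q 0).comp (skip 0)) = F (shiftBy q) := hFc _ _ fun t _ => by
    simp only [gap_apply, skip_apply, shiftBy_apply, OrderHom.comp_coe, Function.comp, OrderHom.id_coe, id]
    split_ifs <;> omega
  have e1 : Av (p + 1) = F OrderHom.id := hFc _ _ fun t ht => by
    simp only [gap_apply, skip_apply, shiftBy_apply, OrderHom.comp_coe, Function.comp, OrderHom.id_coe, id]
    split_ifs <;> omega
  have e2 : Gv 0 = G OrderHom.id := hGc _ _ fun t ht => by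
    simp [shiftBy]
  have e3 : Hi (p + 1) = 0 := by simp [Hi]
  have e4 : Lo 0 = 0 := by simp [Lo]
  simp only [W]
  rw [e0, e4] at h0
  rw [e1, e3, e2]
  have e5 : ε ^ (p + 1) * (-1 : k) ^ (p + 1) = (-1) ^ ((p + 1) * q) := by
    rw [hε, ← pow_mul, ← pow_add]
    rw [show (q + 1) * (p + 1) + (p + 1) = (p + 1) * q + 2 * (p + 1) by ring, pow_add, pow_mul _ 2]
    simp
  rw [← e5]
  simp only [pow_zero] at h0 ⊢
  linear_combination ε * G OrderHom.id * h0

theorem coboundary_cupOne (k : Type v) [Field k] (X : SSet.{u}) {p q : ℕ}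
    {f : Cochain k X (p + 1)} {g : Cochain k X q} (hf : f ∈ cocycles k X (p + 1))
    (hg : g ∈ cocycles k X q) :
    coboundary k X (p + q) (cupOne k X f g) = (-1 : k) ^ (q + 1) •
      ((-1 : k) ^ ((p + 1) * q) • cup k X (by omega : (p + 1) + q = p + q + 1) f g -
        cup k X (by omega) g f) := by
  funext σ
  have key := cupOne_identity p q (fun u => f (vertexSimplex σ (p + 1) u))
    (fun u => g (vertexSimplex σ q u)) (fun u v h => by rw [vertexSimplex_congr σ h])
    (fun u v h => by rw [vertexSimplex_congr σ h]) (cocycle_vertexSimplex σ hf)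
    (cocycle_vertexSimplex σ hg)
  simp only [coboundary, cup, cupOne, LinearMap.coe_mk, AddHom.coe_mk, LinearMap.mk₂_apply,
    Pi.sub_apply, Pi.smul_apply, smul_eq_mul, front_eq_vertexSimplex, back_eq_vertexSimplex]
  rw [← key, Finset.sum_range]
  refine Finset.sum_congr rfl fun j _ => ?_
  congr 1
  refine Finset.sum_congr rfl fun i hi => ?_
  have hi' : i < p + 1 := by simpa using hi
  rw [vertexSimplex_face, vertexSimplex_face]
  · intro t ht
    rw [shiftBy_apply]
    omega
  · intro t ht
    rw [gap_apply]
    split_ifs <;> omega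

theorem sgn_mul_nat (k : Type v) [Field k] (p q : ℕ) :
    sgn k ((p : ℤ) * q) = (-1 : k) ^ (p * q) := by
  unfold sgn
  rw [← Nat.cast_mul, Int.negOnePow_def, zpow_natCast]
  push_cast
  simp

/-- The `∪₁`-product is defined for a first factor of positive degree. Degrees `(0, q + 1)` follow
by exchanging the factors, and in degrees `(0, 0)` the cochains themselves commute. -/
theorem cup_sub_mem_coboundaries (k : Type v) [Field k] (X : SSet.{u}) {p q n : ℕ}
    (h : p + q = n) {f : Cochain k X p} {g : Cochain k X q} (hf : f ∈ cocycles k X p)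
    (hg : g ∈ cocycles k X q) :
    cup k X h f g - (-1 : k) ^ (p * q) • cup k X (by omega) g f ∈ coboundaries k X n := by
  have main : ∀ {p q n : ℕ} (h : (p + 1) + q = n) {f : Cochain k X (p + 1)} {g : Cochain k X q}
      (_ : f ∈ cocycles k X (p + 1)) (_ : g ∈ cocycles k X q),
      cup k X h f g - (-1 : k) ^ ((p + 1) * q) • cup k X (by omega) g f ∈ coboundaries k X n := by
    intro p q n h f g hf hg
    obtain rfl : n = p + q + 1 := by omega
    refine ⟨((-1 : k) ^ (q + 1) * (-1 : k) ^ ((p + 1) * q)) • cupOne k X f g, ?_⟩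
    rw [map_smul, coboundary_cupOne k X hf hg, smul_smul, smul_sub, smul_smul]
    have e1 : (-1 : k) ^ (q + 1) * (-1 : k) ^ (q + 1) = 1 := by rw [← mul_pow]; simp
    have e2 : (-1 : k) ^ ((p + 1) * q) * (-1 : k) ^ ((p + 1) * q) = 1 := by rw [← mul_pow]; simp
    congr 1
    · rw [show ∀ a b : k, a * b * a * b = (a * a) * (b * b) by intros; ring, e1, e2]
      simp
    · rw [show ∀ a b : k, a * b * a = (a * a) * b by intros; ring, e1, one_mul]
  match p, q, h, f, g, hf, hg with
  | p + 1, q, h, f, g, hf, hg => exact main h hf hg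
  | 0, q + 1, h, f, g, hf, hg =>
    have := Submodule.neg_mem _ (main (by omega : (q + 1) + 0 = n) hg hf)
    simpa using this
  | 0, 0, h, f, g, hf, hg =>
    obtain rfl : n = 0 := by omega
    have : cup k X h f g - (-1 : k) ^ (0 * 0) • cup k X (by omega : 0 + 0 = 0) g f = 0 := by
      funext σ
      simp only [cup, LinearMap.mk₂_apply, front_eq_vertexSimplex, back_eq_vertexSimplex,
        Pi.sub_apply, Pi.smul_apply, smul_eq_mul]
      rw [vertexSimplex_congr σ (f := shiftBy 0) (g := OrderHom.id) (by simp [shiftBy])]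
      simp [mul_comm]
    rw [this]
    exact Submodule.zero_mem _

end CupCommutativity

/-! ### Graded commutative algebras -/

/-- The product of the graded module `A` is associative and unital. -/
class GradedAssoc (A : ℕ → Type u) [GradedMonoid.GMul A] [GradedMonoid.GOne A] : Prop where
  assoc : ∀ a b c : GradedMonoid A, a * b * c = a * (b * c)
  one_mul : ∀ a : GradedMonoid A, 1 * a = a
  mul_one : ∀ a : GradedMonoid A, a * 1 = a

/-- The product of the graded module `A` is bilinear and graded commutative. -/
class GradedComm (k : Type v) [Field k] (A : ℕ → Type u) [∀ p, AddCommGroup (A p)]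
    [∀ p, Module k (A p)] [GradedMonoid.GMul A] : Prop where
  add_mul : ∀ {p q : ℕ} (a a' : A p) (b : A q),
    GradedMonoid.GMul.mul (a + a') b = GradedMonoid.GMul.mul a b + GradedMonoid.GMul.mul a' b
  mul_add : ∀ {p q : ℕ} (a : A p) (b b' : A q),
    GradedMonoid.GMul.mul a (b + b') = GradedMonoid.GMul.mul a b + GradedMonoid.GMul.mul a b'
  smul_mul : ∀ {p q : ℕ} (c : k) (a : A p) (b : A q),
    GradedMonoid.GMul.mul (c • a) b = c • GradedMonoid.GMul.mul a b
  mul_smul : ∀ {p q : ℕ} (c : k) (a : A p) (b : A q),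
    GradedMonoid.GMul.mul a (c • b) = c • GradedMonoid.GMul.mul a b
  comm : ∀ a b : GradedMonoid A, homog (a * b) = sgn k ((a.1 : ℤ) * b.1) • homog (b * a)

/-! ### Singular cohomology as an associative, graded commutative algebra -/

section SingularCohomology

open CategoryTheory Simplicial

variable (k : Type v) [Field k] (X : SSet.{u})

/-- The class of a cocycle, as a homogeneous element. -/
def homogClass {p : ℕ} (f : Cochain k X p) (hf : f ∈ cocycles k X p) :
    GradedMonoid (Cohomology k X) := ⟨p, cohomologyClass k X p ⟨f, hf⟩⟩

theorem exists_homogClass (a : GradedMonoid (Cohomology k X)) :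
    ∃ (p : ℕ) (f : Cochain k X p) (hf : f ∈ cocycles k X p), a = homogClass k X f hf := by
  obtain ⟨p, a⟩ := a
  obtain ⟨⟨f, hf⟩, rfl⟩ := Submodule.mkQ_surjective _ a
  exact ⟨p, f, hf, rfl⟩

/-- The degree `n` is left free so that classes in degrees such as `p + (q + r)` and `p + q + r` can
be compared without casts. -/
theorem homogClass_mul {p q n : ℕ} (h : p + q = n) {f : Cochain k X p} {g : Cochain k X q}
    (hf : f ∈ cocycles k X p) (hg : g ∈ cocycles k X q) :
    homogClass k X f hf * homogClass k X g hg =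
      homogClass k X (cup k X h f g) (cup_mem_cocycles k X h hf hg) := by
  subst h
  rfl

theorem cup_assoc {p q r m m' n : ℕ} (h₁ : p + q = m) (h₂ : m + r = n) (h₃ : q + r = m')
    (h₄ : p + m' = n) (f : Cochain k X p) (g : Cochain k X q) (h : Cochain k X r) :
    cup k X h₂ (cup k X h₁ f g) h = cup k X h₄ f (cup k X h₃ g h) := by
  funext σ
  simp only [cup, LinearMap.mk₂_apply]
  rw [mul_assoc]
  congr 1
  · congr 1
    apply map_op_map_op'
    intro j
    simp only [subinterval_val]
  congr 1
  · congr 1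
    apply map_op_map_op
    intro j
    simp only [subinterval_val]
    omega
  · congr 1
    symm
    apply map_op_map_op'
    intro j
    simp only [subinterval_val]
    omega

instance : GradedAssoc (Cohomology k X) where
  assoc a b c := by
    obtain ⟨p, f, hf, rfl⟩ := exists_homogClass k X a
    obtain ⟨q, g, hg, rfl⟩ := exists_homogClass k X b
    obtain ⟨r, h, hh, rfl⟩ := exists_homogClass k X c
    rw [homogClass_mul k X rfl, homogClass_mul k X rfl, homogClass_mul k X rfl,
      homogClass_mul k X (show p + (q + r) = p + q + r by omega)]
    congr 1
    exact cup_assoc k X _ _ _ _ f g h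
  one_mul a := by
    obtain ⟨p, f, hf, rfl⟩ := exists_homogClass k X a
    change homogClass k X _ (one_mem_cocycles k X) * _ = _
    rw [homogClass_mul k X (zero_add p)]
    congr 1
    funext σ
    simp only [cup, LinearMap.mk₂_apply, one_mul]
    congr 1
    rw [back_eq_vertexSimplex, vertexSimplex_congr σ (g := OrderHom.id) (by simp [shiftBy]),
      ← front_eq_vertexSimplex le_rfl]
    have := map_op_map_op' (X := X) (SimplexCategory.subinterval 0 p (show 0 + p ≤ p by omega)) (𝟙 _) (𝟙 _)
      (fun j => by simp [subinterval_val]) σ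
    simp only [op_id, CategoryTheory.Functor.map_id] at this
    exact this
  mul_one a := by
    obtain ⟨p, f, hf, rfl⟩ := exists_homogClass k X a
    change _ * homogClass k X _ (one_mem_cocycles k X) = _
    rw [homogClass_mul k X (add_zero p)]
    congr 1
    funext σ
    simp only [cup, LinearMap.mk₂_apply, mul_one]
    congr 1
    have := map_op_map_op' (X := X) (SimplexCategory.subinterval 0 p (show 0 + p ≤ p by omega)) (𝟙 _) (𝟙 _)
      (fun j => by simp [subinterval_val]) σ
    simp only [op_id, CategoryTheory.Functor.map_id] at this
    exact this

theorem homog_homogClass_comm {p q n : ℕ} (h : p + q = n) {f : Cochain k X p} {g : Cochain k X q}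
    (hf : f ∈ cocycles k X p) (hg : g ∈ cocycles k X q) :
    cohomologyClass k X n ⟨cup k X h f g, cup_mem_cocycles k X h hf hg⟩ =
      sgn k ((p : ℤ) * q) • cohomologyClass k X n
        ⟨cup k X (by omega) g f, cup_mem_cocycles k X (by omega) hg hf⟩ := by
  rw [← map_smul, ← sub_eq_zero, ← map_sub]
  apply (Submodule.Quotient.mk_eq_zero _).2
  rw [sgn_mul_nat]
  exact cup_sub_mem_coboundaries k X h hf hg

instance : GradedComm k (Cohomology k X) where
  add_mul {p q} a a' b := LinearMap.map_add₂ (cupProduct k X p q) a a' b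
  mul_add {p q} a b b' := map_add (cupProduct k X p q a) b b'
  smul_mul {p q} c a b := LinearMap.map_smul₂ (cupProduct k X p q) c a b
  mul_smul {p q} c a b := map_smul (cupProduct k X p q a) c b
  comm a b := by
    obtain ⟨p, f, hf, rfl⟩ := exists_homogClass k X a
    obtain ⟨q, g, hg, rfl⟩ := exists_homogClass k X b
    rw [homogClass_mul k X rfl, homogClass_mul k X (show q + p = p + q by omega)]
    change DirectSum.of _ _ _ = sgn k ((p : ℤ) * q) • DirectSum.lof k _ _ _ _
    rw [← map_smul]
    exact congrArg (DirectSum.of (Cohomology k X) (p + q)) (homog_homogClass_comm k X rfl hf hg)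

end SingularCohomology

/-! ### Signs -/

section Signs

variable (k : Type v) [Field k]

theorem sgn_add (a b : ℤ) : sgn k (a + b) = sgn k a * sgn k b := by
  simp [sgn, Int.negOnePow_add]

@[simp] theorem sgn_zero : sgn k 0 = 1 := by simp [sgn]

theorem sgn_congr {a b : ℤ} (h : Even (a - b)) : sgn k a = sgn k b := by
  rw [sgn, sgn, (Int.negOnePow_eq_iff a b).2 h]

theorem sgn_even {a : ℤ} (h : Even a) : sgn k a = 1 := by
  rw [sgn_congr k (b := 0) (by simpa using h), sgn_zero]

theorem sgn_odd {a : ℤ} (h : Odd a) : sgn k a = -1 := by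
  simp [sgn, Int.negOnePow_odd a h]

theorem sgn_mul_self (a : ℤ) : sgn k a * sgn k a = 1 := by
  rw [← sgn_add, sgn_even k (by simp)]

theorem sgn_ne_zero (a : ℤ) : sgn k a ≠ 0 := fun h => by simpa [h] using sgn_mul_self k a

theorem sgn_smul_smul {V : Type*} [AddCommMonoid V] [Module k V] (a : ℤ) (x : V) :
    sgn k a • sgn k a • x = x := by rw [smul_smul, sgn_mul_self, one_smul]

end Signs

/-! ### Evaluation of Koszul signs -/

section Koszul

variable {k : Type v} [Field k] {S : Type} [DecidableEq S] {V : Type*} [AddCommGroup V] [Module k V]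

theorem move_letter (deg : S → ℤ) (F : List S → V)
    (hF : ∀ u a b v, F (u ++ a :: b :: v) = sgn k (deg a * deg b) • F (u ++ b :: a :: v))
    (u pre post : List S) (a : S) :
    F (u ++ a :: (pre ++ post)) =
      sgn k (deg a * (pre.map deg).sum) • F (u ++ (pre ++ a :: post)) := by
  induction pre generalizing u with
  | nil => simp
  | cons b pre ih =>
    have := ih (u ++ [b])
    simp only [List.append_assoc, List.cons_append, List.nil_append] at this
    rw [List.cons_append, hF, this, smul_smul, List.cons_append, List.map_cons, List.sum_cons,
      mul_add, sgn_add]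

/-- A function on words which follows the Koszul sign rule for neighbours follows it for all
rearrangements. -/
theorem koszul_eval (deg : S → ℤ) (F : List S → V)
    (hF : ∀ u a b v, F (u ++ a :: b :: v) = sgn k (deg a * deg b) • F (u ++ b :: a :: v))
    {src tgt : List S} (hp : src.Perm tgt) (hn : src.Nodup) :
    F src = (((koszul deg src tgt : ℤˣ) : ℤ) : k) • F tgt := by
  induction src generalizing tgt F with
  | nil => simp [List.nil_perm.1 hp, koszul]
  | cons a src ih =>
    have ha : a ∈ tgt := hp.subset (by simp)
    -- The target word is cut at the first letter `a` of the source. Moving `a` across `pre`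
    -- produces the first factor in the definition of `koszul`; the remaining letters are rearranged
    -- behind a fixed `a`, by induction for `fun w => F (a :: w)`.
    have hs : tgt.takeWhile (fun b => b ≠ a) ++ a :: (tgt.dropWhile fun b => b ≠ a).tail = tgt := by
      conv_rhs => rw [← List.takeWhile_append_dropWhile (p := fun b => b ≠ a) (l := tgt)]
      congr 1
      have hne : (tgt.dropWhile fun b => decide (b ≠ a)) ≠ [] := by
        intro h
        rw [List.dropWhile_eq_nil_iff] at h
        simpa using h a ha
      have h1 := List.head_dropWhile_not (fun b => decide (b ≠ a)) (l := tgt) hne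
      have h2 : (tgt.dropWhile fun b => decide (b ≠ a)).head hne = a := by simpa using h1
      conv_rhs => rw [← List.cons_head_tail hne, h2]
    set pre := tgt.takeWhile (fun b => b ≠ a) with hpre
    set post := (tgt.dropWhile fun b => b ≠ a).tail with hpost
    have hnot : a ∉ pre := by
      intro h
      have := List.mem_takeWhile_imp h
      simp at this
    have herase : tgt.erase a = pre ++ post := by
      rw [← hs, List.erase_append_right _ hnot, List.erase_cons_head]
    have hp' : src.Perm (pre ++ post) := by
      rw [← herase]
      exact List.cons_perm_iff_perm_erase.1 hp |>.2
    rw [koszul, ← hpre, herase]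
    have h1 := ih (fun w => F (a :: w)) (fun u b c v => hF (a :: u) b c v) hp'
      (List.nodup_cons.1 hn).2
    have h2 := move_letter deg F hF [] pre post a
    simp only [List.nil_append] at h2
    rw [h1, h2, hs]
    rw [smul_smul, Units.val_mul, Int.cast_mul, mul_comm]
    rfl

end Koszul

/-- Subtraction on `C_n`, on top of its structure of a module. -/
local instance cnAddCommGroup (k : Type v) [Field k] (A : ℕ → Type w) [∀ p, AddCommGroup (A p)]
    [∀ p, Module k (A p)] (N n : ℕ) : AddCommGroup (Cn k A N n) :=
  Module.addCommMonoidToAddCommGroup k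

/-- The ring `E₁`, on top of its structure of a semiring. -/
local instance (priority := 2000) e1Ring (k : Type v) [Field k] (A : ℕ → Type w)
    [∀ p, AddCommGroup (A p)] [∀ p, Module k (A p)] [GradedMonoid.GMul A] [GradedMonoid.GOne A]
    (N n : ℕ) : Ring (E1 k A N n) :=
  { (inferInstance : Ring (E1 k A N n)) with
    toSemiring := (inferInstance : Semiring (E1 k A N n)) }

/-! ### Vectors with homogeneous entries -/

section Homogeneous

variable {k : Type v} [Field k] {A : ℕ → Type w} [∀ p, AddCommGroup (A p)] [∀ p, Module k (A p)]
  {V : Type*} [AddCommMonoid V] [Module k V]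

theorem MultilinearMap.ext_homog {ι : Type*} [Fintype ι] {g h : MultilinearMap k (fun _ : ι => DirectSum ℕ A) V}
    (H : ∀ x : ι → GradedMonoid A, g (fun i => homog (x i)) = h (fun i => homog (x i))) :
    g = h := by
  classical
  refine MultilinearMap.ext fun x => ?_
  have hx : x = fun i => ∑ p ∈ (x i).support, homog (⟨p, x i p⟩ : GradedMonoid A) := by
    funext i
    exact (DirectSum.sum_support_of (x i)).symm
  rw [hx, MultilinearMap.map_sum_finset, MultilinearMap.map_sum_finset]
  exact Finset.sum_congr rfl fun r _ => H fun i => ⟨r i, x i (r i)⟩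

theorem tensorPower_ext {m : ℕ} {g h : (PiTensorProduct k fun _ : Fin m => DirectSum ℕ A) →ₗ[k] V}
    (H : ∀ x : Fin m → GradedMonoid A, g (PiTensorProduct.tprod k fun i => homog (x i)) =
      h (PiTensorProduct.tprod k fun i => homog (x i))) : g = h := by
  apply PiTensorProduct.ext
  exact MultilinearMap.ext_homog H

theorem power_ext {c : ℤ} {m : ℕ} {g h : Power k A c m →ₗ[k] V}
    (H : ∀ x : Fin m → GradedMonoid A, g (Power.wedge k c x) = h (Power.wedge k c x)) : g = h := by
  refine LinearMap.ext fun u => ?_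
  obtain ⟨u, rfl⟩ := Submodule.mkQ_surjective _ u
  exact LinearMap.congr_fun (tensorPower_ext (g := g.comp (Submodule.mkQ _))
    (h := h.comp (Submodule.mkQ _)) H) u

theorem cn_ext {N n : ℕ} {g h : Cn k A N n →ₗ[k] V}
    (H : ∀ (m r : ℕ) (hmr : m + 2 * r = n) (x : Fin m → GradedMonoid A) (y : Fin r → GradedMonoid A),
      g (Cn.word k N hmr x y) = h (Cn.word k N hmr x y)) : g = h := by
  apply DirectSum.linearMap_ext
  rintro ⟨⟨m, r⟩, hmr⟩
  apply TensorProduct.ext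
  apply power_ext
  intro x
  apply power_ext
  intro y
  exact H m r hmr x y

end Homogeneous

/-! ### Calculations in `E₁` for even `N` -/

section E1

variable (k : Type v) [Field k] {A : ℕ → Type w} [∀ p, AddCommGroup (A p)]
  [∀ p, Module k (A p)] [GradedMonoid.GMul A] [GradedMonoid.GOne A] (N : ℕ) {n : ℕ}

theorem gen_rel {x y : FreeAlgebra k (Gen A n)} (h : E1Rel k A N n x y) :
    RingQuot.mkAlgHom k (E1Rel k A N n) x = RingQuot.mkAlgHom k (E1Rel k A N n) y :=
  RingQuot.mkAlgHom_rel k h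

theorem gen_comm (x y : Gen A n) : E1.gen k A N n x * E1.gen k A N n y =
    sgn k (x.deg N * y.deg N) • (E1.gen k A N n y * E1.gen k A N n x) := by
  simpa [E1.gen] using gen_rel k N (.comm x y)

/-- The class `p_i^*(a)`. -/
def pl (i : Fin n) (a : GradedMonoid A) : E1 k A N n := E1.gen k A N n (.pull i a)

theorem pl_comm (i j : Fin n) (a b : GradedMonoid A) :
    pl k N i a * pl k N j b = sgn k ((a.1 : ℤ) * b.1) • (pl k N j b * pl k N i a) :=
  gen_comm k N _ _

theorem pl_mul (i : Fin n) (a b : GradedMonoid A) :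
    pl k N i (a * b) = pl k N i a * pl k N i b := by
  simpa [E1.gen, pl] using gen_rel k N (.mul i a b)

@[simp] theorem pl_one (i : Fin n) : pl k N i (1 : GradedMonoid A) = 1 := by
  simpa [E1.gen, pl] using gen_rel k N (.one (A := A) i)

theorem pl_add (i : Fin n) {p : ℕ} (a b : A p) :
    pl k N i (⟨p, a + b⟩ : GradedMonoid A) = pl k N i ⟨p, a⟩ + pl k N i ⟨p, b⟩ := by
  simpa [E1.gen, pl] using gen_rel k N (.add i p a b)

theorem pl_smul (i : Fin n) {p : ℕ} (c : k) (a : A p) :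
    pl k N i (⟨p, c • a⟩ : GradedMonoid A) = c • pl k N i ⟨p, a⟩ := by
  simpa [E1.gen, pl] using gen_rel k N (.smul i p c a)

/-- The linear map `p_i^*` on the total space. -/
def plLin (i : Fin n) : DirectSum ℕ A →ₗ[k] E1 k A N n :=
  DirectSum.toModule k ℕ _ fun p =>
    { toFun := fun a => pl k N i (⟨p, a⟩ : GradedMonoid A)
      map_add' := fun a b => pl_add k N i a b
      map_smul' := fun c a => pl_smul k N i c a }

@[simp] theorem plLin_homog (i : Fin n) (a : GradedMonoid A) :
    plLin k N i (homog a) = pl k N i a := by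
  unfold plLin homog
  exact DirectSum.toModule_lof k a.1 a.2

theorem sgn_N [hN : Fact (Even N)] : sgn k N = 1 := sgn_even k (by exact_mod_cast hN.out)

variable (A) in
/-- The class `e_{ij}`, as a function of the unordered pair; it is `0` on the diagonal. -/
def ed [Fact (Even N)] (s : Sym2 (Fin n)) : E1 k A N n :=
  Sym2.lift ⟨fun i j => if h : i ≠ j then E1.gen k A N n (.edge i j h) else 0, fun i j => by
    by_cases h : i = j
    · simp [h]
    · have h' : j ≠ i := fun e => h e.symm
      have := gen_rel (A := A) k N (.symm i j h)
      rw [sgn_N, one_smul] at this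
      beta_reduce
      rw [dif_pos h, dif_pos h']
      exact this⟩ s

variable [hN : Fact (Even N)]

theorem odd_pred : Odd ((N : ℤ) - 1) := by
  have h : Even (N : ℤ) := by exact_mod_cast hN.out
  exact h.sub_odd odd_one

theorem ed_mk {i j : Fin n} (h : i ≠ j) : ed k A N s(i, j) = E1.gen k A N n (.edge i j h) := by
  simp [ed, h]

@[simp] theorem ed_self (i : Fin n) : ed k A N s(i, i) = 0 := by simp [ed]

theorem ed_sq (s : Sym2 (Fin n)) : ed k A N s * ed k A N s = 0 := by
  induction s with | _ i j
  by_cases h : i = j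
  · simp [h]
  · rw [ed_mk k N h]
    simpa [E1.gen] using gen_rel (A := A) k N (.sq i j h)

theorem ed_comm (s t : Sym2 (Fin n)) : ed k A N s * ed k A N t = -(ed k A N t * ed k A N s) := by
  induction s with | _ i j
  induction t with | _ i' j'
  by_cases h : i = j
  · simp [h]
  by_cases h' : i' = j'
  · simp [h']
  rw [ed_mk k N h, ed_mk k N h', gen_comm, sgn_odd]
  · simp
  · exact (odd_pred N).mul (odd_pred N)

theorem pl_ed (i : Fin n) (a : GradedMonoid A) (s : Sym2 (Fin n)) :
    pl k N i a * ed k A N s = sgn k a.1 • (ed k A N s * pl k N i a) := by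
  induction s with | _ i' j'
  by_cases h' : i' = j'
  · simp [h']
  rw [ed_mk k N h', pl, gen_comm]
  congr 1
  apply sgn_congr
  change Even ((a.1 : ℤ) * ((N : ℤ) - 1) - a.1)
  have h : Even (N : ℤ) := by exact_mod_cast hN.out
  rw [show (a.1 : ℤ) * ((N : ℤ) - 1) - a.1 = a.1 * N - 2 * a.1 by ring]
  exact (h.mul_left _).sub (even_two_mul _)

theorem ed_pl (i : Fin n) (a : GradedMonoid A) (s : Sym2 (Fin n)) :
    ed k A N s * pl k N i a = sgn k a.1 • (pl k N i a * ed k A N s) := by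
  rw [pl_ed, sgn_smul_smul]

theorem pl_ed_slide (i j : Fin n) (a : GradedMonoid A) :
    pl k N i a * ed k A N s(i, j) = pl k N j a * ed k A N s(i, j) := by
  by_cases h : i = j
  · simp [h]
  rw [ed_mk k N h]
  simpa [E1.gen, pl] using gen_rel k N (.slide i j h a)

theorem ed_pl_slide (i j : Fin n) (a : GradedMonoid A) :
    ed k A N s(i, j) * pl k N i a = ed k A N s(i, j) * pl k N j a := by
  rw [ed_pl, ed_pl, pl_ed_slide]

/-- With the convention `e_{ii} = 0` the relation persists for repeated indices, where it reduces to
`e_{ij}^2 = 0`. The inductions on graphs can therefore use it without case distinctions. -/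
theorem arnold (i j l : Fin n) : ed k A N s(i, j) * ed k A N s(j, l) +
    ed k A N s(j, l) * ed k A N s(l, i) + ed k A N s(l, i) * ed k A N s(i, j) = 0 := by
  by_cases h : i = j
  · subst h
    rw [ed_self, Sym2.eq_swap (a := l), ed_sq]; simp
  by_cases h' : j = l
  · subst h'
    rw [ed_self, Sym2.eq_swap (a := j), ed_sq]; simp
  by_cases h'' : l = i
  · subst h''
    rw [ed_self, Sym2.eq_swap (a := l), ed_sq]; simp
  rw [ed_mk k N h, ed_mk k N h', ed_mk k N h'']
  simpa [E1.gen] using gen_rel (A := A) k N (.arnold i j l h h' h'')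

omit hN in
theorem perm_gen (σ : Equiv.Perm (Fin n)) (x : Gen A n) :
    E1.perm k A N n σ (E1.gen k A N n x) = E1.gen k A N n (x.perm σ) := by
  simp [E1.perm, E1.gen]

omit hN in
@[simp] theorem perm_pl (σ : Equiv.Perm (Fin n)) (i : Fin n) (a : GradedMonoid A) :
    E1.perm k A N n σ (pl k N i a) = pl k N (σ i) a := perm_gen k N σ _

@[simp] theorem perm_ed (σ : Equiv.Perm (Fin n)) (s : Sym2 (Fin n)) :
    E1.perm k A N n σ (ed k A N s) = ed k A N (s.map σ) := by
  induction s with | _ i j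
  rw [Sym2.map_mk]
  by_cases h : i = j
  · simp [h]
  · rw [ed_mk k N h, ed_mk k N (σ.injective.ne h)]
    exact perm_gen k N σ _

omit hN

variable (A) in
/-- The product of the generators in a word. -/
def genProd (w : List (Gen A n)) : E1 k A N n := (w.map (E1.gen k A N n)).prod

theorem genProd_append (w w' : List (Gen A n)) :
    genProd k A N (w ++ w') = genProd k A N w * genProd k A N w' := by simp [genProd]

theorem genProd_cons (x : Gen A n) (w : List (Gen A n)) :
    genProd k A N (x :: w) = E1.gen k A N n x * genProd k A N w := by simp [genProd]

theorem genProd_mem (w : List (Gen A n)) {t r : ℕ} (h : (w.map Gen.bideg).sum = (t, r)) :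
    genProd k A N w ∈ E1.bihomogeneous k A N n t r :=
  Submodule.subset_span ⟨w, h, rfl⟩

theorem perm_genProd (σ : Equiv.Perm (Fin n)) (w : List (Gen A n)) :
    E1.perm k A N n σ (genProd k A N w) = genProd k A N (w.map (Gen.perm σ)) := by
  simp only [genProd, map_list_prod, List.map_map]
  congr 2
  funext x
  exact perm_gen k N σ x

theorem span_genProd : Submodule.span k (Set.range (genProd k A N (n := n))) = ⊤ := by
  have h1 : Algebra.adjoin k (Set.range (E1.gen k A N n)) = ⊤ := by
    have := congrArg (Subalgebra.map (RingQuot.mkAlgHom k (E1Rel k A N n)))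
      (FreeAlgebra.adjoin_range_ι (R := k) (X := Gen A n))
    rw [AlgHom.map_adjoin, ← Set.range_comp, Algebra.map_top,
      (AlgHom.range_eq_top _).2 (RingQuot.mkAlgHom_surjective k _)] at this
    exact this
  have h2 := congrArg Subalgebra.toSubmodule h1
  rw [Algebra.adjoin_eq_span, Algebra.top_toSubmodule] at h2
  rw [eq_top_iff, ← h2]
  apply Submodule.span_mono
  intro x hx
  obtain ⟨l, hl, rfl⟩ := Submonoid.exists_list_of_mem_closure hx
  obtain ⟨w, rfl⟩ : l ∈ Set.range (List.map (E1.gen k A N n)) := by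
    rw [Set.range_list_map]
    exact hl
  exact ⟨w, rfl⟩

theorem e1_ext {V : Type*} [AddCommGroup V] [Module k V] {g h : E1 k A N n →ₗ[k] V}
    (H : ∀ w, g (genProd k A N w) = h (genProd k A N w)) : g = h :=
  LinearMap.ext_on_range (span_genProd k N) H

theorem perm_perm (σ τ : Equiv.Perm (Fin n)) (x : E1 k A N n) :
    E1.perm k A N n σ (E1.perm k A N n τ x) = E1.perm k A N n (σ * τ) x := by
  have : (E1.perm k A N n σ).toLinearMap ∘ₗ (E1.perm k A N n τ).toLinearMap =
      (E1.perm k A N n (σ * τ)).toLinearMap := by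
    apply e1_ext
    intro w
    simp only [LinearMap.comp_apply, AlgHom.toLinearMap_apply, perm_genProd, List.map_map]
    congr 2
    funext x
    cases x <;> rfl
  exact LinearMap.congr_fun this x

theorem mul_mem_bihomogeneous {t r t' r' : ℕ} {x y : E1 k A N n}
    (hx : x ∈ E1.bihomogeneous k A N n t r) (hy : y ∈ E1.bihomogeneous k A N n t' r') :
    x * y ∈ E1.bihomogeneous k A N n (t + t') (r + r') := by
  have := Submodule.mul_mem_mul hx hy
  unfold E1.bihomogeneous at this
  rw [Submodule.span_mul_span] at this
  refine Submodule.span_mono ?_ this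
  rintro _ ⟨_, ⟨w, hw, rfl⟩, _, ⟨w', hw', rfl⟩, rfl⟩
  exact ⟨w ++ w', by simp [hw, hw'], by simp⟩

theorem one_mem_bihomogeneous : (1 : E1 k A N n) ∈ E1.bihomogeneous k A N n 0 0 :=
  genProd_mem k N [] rfl

theorem pl_mem_bihomogeneous (i : Fin n) (a : GradedMonoid A) :
    pl k N i a ∈ E1.bihomogeneous k A N n a.1 0 := by
  have := genProd_mem k N [Gen.pull i a] (t := a.1) (r := 0) (by simp [Gen.bideg])
  simpa [genProd, pl] using this

theorem ed_mem_bihomogeneous [Fact (Even N)] (s : Sym2 (Fin n)) :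
    ed k A N s ∈ E1.bihomogeneous k A N n 0 1 := by
  induction s with | _ i j
  by_cases h : i = j
  · rw [h, ed_self]; exact Submodule.zero_mem _
  rw [ed_mk k N h]
  have := genProd_mem (A := A) k N [Gen.edge i j h] (t := 0) (r := 1) (by simp [Gen.bideg])
  simpa [genProd] using this

end E1

/-! ### Vanishing of symmetrized monomials -/

section Vanishing

variable (k : Type v) [Field k] (A : ℕ → Type w) [∀ p, AddCommGroup (A p)]
  [∀ p, Module k (A p)] [GradedMonoid.GMul A] [GradedMonoid.GOne A] (N : ℕ) {n : ℕ}

open Classical in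
/-- The sum of the translates of an element of `E₁` under a group of permutations. -/
def symSum (H : Subgroup (Equiv.Perm (Fin n))) : E1 k A N n →ₗ[k] E1 k A N n :=
  ∑ σ ∈ Finset.univ.filter (· ∈ H), (E1.perm k A N n σ).toLinearMap

open Classical in
theorem symSum_apply (H : Subgroup (Equiv.Perm (Fin n))) (x : E1 k A N n) :
    symSum k A N H x = ∑ σ ∈ Finset.univ.filter (· ∈ H), E1.perm k A N n σ x := by
  simp [symSum]

theorem symSum_perm {H : Subgroup (Equiv.Perm (Fin n))} {τ : Equiv.Perm (Fin n)} (hτ : τ ∈ H)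
    (x : E1 k A N n) : symSum k A N H (E1.perm k A N n τ x) = symSum k A N H x := by
  classical
  simp only [symSum_apply, perm_perm]
  refine Finset.sum_nbij' (· * τ) (· * τ⁻¹) ?_ ?_ ?_ ?_ ?_
  · intro σ hσ
    simp only [Finset.mem_filter, Finset.mem_univ, true_and] at hσ ⊢
    exact H.mul_mem hσ hτ
  · intro σ hσ
    simp only [Finset.mem_filter, Finset.mem_univ, true_and] at hσ ⊢
    exact H.mul_mem hσ (H.inv_mem hτ)
  · simp
  · simp
  · simp

variable {k A N}

theorem card_subgroup_ne_zero (hk : (n.factorial : k) ≠ 0) (H : Subgroup (Equiv.Perm (Fin n))) :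
    (Nat.card H : k) ≠ 0 := by
  obtain ⟨c, hc⟩ := H.card_subgroup_dvd_card
  rw [Nat.card_perm, Nat.card_fin] at hc
  intro h
  apply hk
  rw [hc]
  push_cast
  rw [h, zero_mul]

/-- Symmetrizing over `H'` and then over `H` multiplies the sum over `H` by `|H'|`, which is
invertible by Lagrange. It is thus enough to find cancellation under the permutations of one
component of a graph. -/
theorem symSum_eq_zero_of_le (hk : (n.factorial : k) ≠ 0) {H H' : Subgroup (Equiv.Perm (Fin n))}
    (hH : H' ≤ H) {x : E1 k A N n} (hx : symSum k A N H' x = 0) : symSum k A N H x = 0 := by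
  classical
  have h : symSum k A N H (symSum k A N H' x) = (Nat.card H' : k) • symSum k A N H x := by
    rw [symSum_apply k A N H' x, map_sum, Finset.sum_congr rfl (fun σ hσ =>
      symSum_perm k A N (hH (Finset.mem_filter.1 hσ).2) x), Finset.sum_const, Nat.cast_smul_eq_nsmul]
    congr 1
    rw [Nat.card_eq_fintype_card, Fintype.card_subtype]
  rw [hx, map_zero] at h
  exact (smul_eq_zero.1 h.symm).resolve_left (card_subgroup_ne_zero hk H')

theorem natCast_ne_zero_of_le (hk : (n.factorial : k) ≠ 0) {j : ℕ} (h0 : 0 < j) (h : j ≤ n) :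
    (j : k) ≠ 0 := by
  obtain ⟨c, hc⟩ := Nat.dvd_factorial h0 h
  intro h
  apply hk
  rw [hc]
  push_cast
  rw [h, zero_mul]

theorem symSum_eq_zero_of_neg (h2 : (2 : k) ≠ 0) {H : Subgroup (Equiv.Perm (Fin n))}
    {τ : Equiv.Perm (Fin n)} (hτ : τ ∈ H) {x : E1 k A N n} (hx : E1.perm k A N n τ x = -x) :
    symSum k A N H x = 0 := by
  have h := symSum_perm k A N hτ x
  rw [hx, map_neg] at h
  have h' : (2 : k) • symSum k A N H x = 0 := by
    rw [two_smul]
    nth_rewrite 1 [← h]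
    exact neg_add_cancel _
  exact (smul_eq_zero.1 h').resolve_left h2

/-- The permutations which fix all elements outside `K`. -/
def permsOf (K : Set (Fin n)) : Subgroup (Equiv.Perm (Fin n)) where
  carrier := {σ | ∀ i ∉ K, σ i = i}
  mul_mem' ha hb i hi := by rw [Equiv.Perm.mul_apply, hb i hi, ha i hi]
  one_mem' i _ := rfl
  inv_mem' {σ} h i hi := by rw [Equiv.Perm.inv_eq_iff_eq, h i hi]

theorem permsOf_mono {K K' : Set (Fin n)} (h : K' ⊆ K) : permsOf K' ≤ permsOf K :=
  fun _ hσ i hi => hσ i fun hi' => hi (h hi')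

theorem mem_of_mem_permsOf {K : Set (Fin n)} {σ : Equiv.Perm (Fin n)} (hσ : σ ∈ permsOf K)
    {i : Fin n} (hi : i ∈ K) : σ i ∈ K := by
  by_contra h
  have h1 := hσ _ h
  rw [σ.injective h1] at h
  exact h hi

theorem swap_mem_permsOf {K : Set (Fin n)} {i j : Fin n} (hi : i ∈ K) (hj : j ∈ K) :
    Equiv.swap i j ∈ permsOf K := fun l hl =>
  Equiv.swap_apply_of_ne_of_ne (fun h => hl (h ▸ hi)) (fun h => hl (h ▸ hj))

variable [hN : Fact (Even N)]

variable (k A N) in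
/-- The product of the edges in a list. -/
def edProd (L : List (Sym2 (Fin n))) : E1 k A N n := (L.map (ed k A N)).prod

variable (k A N) in
/-- The alternating sum of the products which omit one edge of a list. -/
def edBd : List (Sym2 (Fin n)) → E1 k A N n
  | [] => 0
  | s :: L => edProd k A N L - ed k A N s * edBd L

@[simp] theorem edProd_cons (s : Sym2 (Fin n)) (L : List (Sym2 (Fin n))) :
    edProd k A N (s :: L) = ed k A N s * edProd k A N L := by simp [edProd]

@[simp] theorem edProd_nil : edProd k A N ([] : List (Sym2 (Fin n))) = 1 := by simp [edProd]

theorem edProd_append (L L' : List (Sym2 (Fin n))) :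
    edProd k A N (L ++ L') = edProd k A N L * edProd k A N L' := by simp [edProd]

theorem perm_edProd (σ : Equiv.Perm (Fin n)) (L : List (Sym2 (Fin n))) :
    E1.perm k A N n σ (edProd k A N L) = edProd k A N (L.map (Sym2.map σ)) := by
  induction L with
  | nil => simp
  | cons s L ih => simp [ih]

/-- Edges anticommute, so reordering costs a sign. The same scalar must serve for `edProd` and
`edBd`: the relation between the two is then independent of the order of the list. -/
theorem edProd_perm_sign {L L' : List (Sym2 (Fin n))} (h : L.Perm L') :
    ∃ ε : k, edProd k A N L = ε • edProd k A N L' ∧ edBd k A N L = ε • edBd k A N L' := by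
  induction h with
  | nil => exact ⟨1, by simp, by simp⟩
  | cons s _ ih =>
    obtain ⟨ε, h1, h2⟩ := ih
    refine ⟨ε, ?_, ?_⟩
    · rw [edProd_cons, edProd_cons, h1, mul_smul_comm]
    · rw [edBd, edBd, h1, h2, mul_smul_comm, smul_sub]
  | swap s t L =>
    refine ⟨-1, ?_, ?_⟩
    · simp only [edProd_cons, ← mul_assoc]
      rw [ed_comm, neg_smul, one_smul, neg_mul]
    · simp only [edBd, edProd_cons, mul_sub, ← mul_assoc]
      rw [ed_comm k N t s, neg_smul, one_smul]
      noncomm_ring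
  | trans _ _ ih1 ih2 =>
    obtain ⟨ε, h1, h2⟩ := ih1
    obtain ⟨ε', h1', h2'⟩ := ih2
    exact ⟨ε * ε', by rw [h1, h1', smul_smul], by rw [h2, h2', smul_smul]⟩

/-- Induction along the trail, with the Arnold relation in the form `e_{uw} e_{wv} = e_{uv} (e_{wv}
- e_{uw})`. A trail is needed rather than a walk, because each edge is removed from `L` when it is
used. -/
theorem edProd_eq_of_trail {G : SimpleGraph (Fin n)} {u v : Fin n} (p : G.Walk u v)
    (hp : p.IsTrail) (L : List (Sym2 (Fin n))) (hL : ∀ e ∈ p.edges, e ∈ L) (huv : u ≠ v) :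
    edProd k A N L = ed k A N s(u, v) * edBd k A N L := by
  induction p generalizing L with
  | nil => exact absurd rfl huv
  | @cons u w v h p ih =>
    rw [SimpleGraph.Walk.isTrail_cons] at hp
    have hmem : s(u, w) ∈ L := hL _ (by simp)
    obtain ⟨ε, h1, h2⟩ := edProd_perm_sign (k := k) (A := A) (N := N) (List.perm_cons_erase hmem)
    rw [h1, h2, mul_smul_comm, edProd_cons, edBd]
    congr 1
    by_cases hw : w = v
    · subst hw
      rw [mul_sub, ← mul_assoc, ed_sq, zero_mul, sub_zero]
    · have := ih hp.1 (L.erase s(u, w)) (fun e he => by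
        have hne : e ≠ s(u, w) := fun h' => hp.2 (h' ▸ he)
        exact (List.mem_erase_of_ne hne).2 (hL e (by simp [he]))) hw
      rw [this]
      have ha := arnold k (A := A) N u w v
      rw [ed_comm k N s(w, v), Sym2.eq_swap (a := v)] at ha
      have ha' : ed k A N s(u, w) * ed k A N s(w, v) =
          ed k A N s(u, v) * ed k A N s(w, v) - ed k A N s(u, v) * ed k A N s(u, w) := by
        rw [← sub_eq_zero, ← ha]; abel
      rw [← mul_assoc, ha']
      noncomm_ring

/-- The graph with the edges in the list `L`. -/
def edgeGraph (L : List (Sym2 (Fin n))) : SimpleGraph (Fin n) :=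
  SimpleGraph.fromEdgeSet {e | e ∈ L}

theorem edProd_eq_of_reachable {L : List (Sym2 (Fin n))} {u v : Fin n}
    (h : (edgeGraph L).Reachable u v) (huv : u ≠ v) :
    edProd k A N L = ed k A N s(u, v) * edBd k A N L := by
  obtain ⟨p, hp⟩ := h.exists_isPath
  refine edProd_eq_of_trail p hp.isTrail L (fun e he => ?_) huv
  have := p.edges_subset_edgeSet he
  rw [edgeGraph, SimpleGraph.edgeSet_fromEdgeSet] at this
  exact this.1

/-- `K` is the component of the common vertex `j`, and no edge joins it to its complement. The last
clause is minimality: permutations of `K` are permutations of any set that contains all the edges.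
-/
theorem exists_component (s₁ s₂ : Sym2 (Fin n)) (L' : List (Sym2 (Fin n))) {j : Fin n}
    (h₁ : j ∈ s₁) (h₂ : j ∈ s₂) : ∃ (K : Set (Fin n)) (L₁ L₂ : List (Sym2 (Fin n))),
      (s₁ :: s₂ :: L').Perm (L₁ ++ L₂) ∧ (∀ e ∈ L₁, ∀ v ∈ e, v ∈ K) ∧
      (∀ e ∈ L₂, ∀ v ∈ e, v ∉ K) ∧
      (∀ u ∈ K, ∀ v ∈ K, (edgeGraph (s₁ :: s₂ :: L')).Reachable u v) ∧ 2 ≤ L₁.length ∧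
      ∀ K' : Set (Fin n), (∀ e ∈ s₁ :: s₂ :: L', ∀ v ∈ e, v ∈ K') → K ⊆ K' := by
  classical
  set L := s₁ :: s₂ :: L' with hL
  obtain ⟨K, hK⟩ : ∃ K : Set (Fin n), ∀ v, v ∈ K ↔ (edgeGraph L).Reachable j v := ⟨_, fun _ => Iff.rfl⟩
  have hstep : ∀ e ∈ L, ∀ x ∈ e, x ∈ K → ∀ y ∈ e, y ∈ K := by
    intro e he x hx hxK y hy
    by_cases hxy : x = y
    · rwa [← hxy]
    have hexy : e = s(x, y) := (Sym2.mem_and_mem_iff hxy).1 ⟨hx, hy⟩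
    rw [hK] at hxK ⊢
    refine SimpleGraph.Reachable.trans hxK (SimpleGraph.Adj.reachable ?_)
    rw [edgeGraph, SimpleGraph.fromEdgeSet_adj]
    exact ⟨hexy ▸ he, hxy⟩
  have hjK : j ∈ K := (hK j).2 <| SimpleGraph.Reachable.refl _
  refine ⟨K, L.filter (fun e => ∀ v ∈ e, v ∈ K), L.filter (fun e => !decide (∀ v ∈ e, v ∈ K)),
    (List.filter_append_perm _ _).symm, ?_, ?_, ?_, ?_, ?_⟩
  · intro e he
    simpa using (List.mem_filter.1 he).2
  · intro e he v hv hvK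
    have h := List.mem_filter.1 he
    simp only [Bool.not_eq_eq_eq_not, Bool.not_true, decide_eq_false_iff_not] at h
    exact h.2 (hstep e h.1 v hv hvK)
  · intro u hu v hv
    exact SimpleGraph.Reachable.trans (SimpleGraph.Reachable.symm ((hK u).1 hu)) ((hK v).1 hv)
  · rw [hL, List.filter_cons_of_pos, List.filter_cons_of_pos]
    · simp
    · simpa using hstep s₂ (by simp [hL]) j h₂ hjK
    · simpa using hstep s₁ (by simp [hL]) j h₁ hjK
  · intro K' hK' v hv
    have hwalk : ∀ a b, (edgeGraph L).Walk a b → a ∈ K' → b ∈ K' := by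
      intro a b p
      induction p with
      | nil => exact id
      | @cons a b c h p ih =>
        rw [edgeGraph, SimpleGraph.fromEdgeSet_adj] at h
        exact fun _ => ih (hK' _ h.1 b (by simp))
    obtain ⟨p⟩ := (hK v).1 hv
    exact hwalk j v p (hK' s₁ (by simp [hL]) j h₁)

theorem map_sym2_eq_self {K : Set (Fin n)} {σ : Equiv.Perm (Fin n)} (hσ : σ ∈ permsOf K)
    {L : List (Sym2 (Fin n))} (hL : ∀ e ∈ L, ∀ v ∈ e, v ∉ K) : L.map (Sym2.map σ) = L := by
  conv_rhs => rw [← List.map_id L]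
  refine List.map_congr_left fun e he => ?_
  have h := hL e he
  induction e with | _ a b
  rw [Sym2.map_mk, hσ a (h a (by simp)), hσ b (h b (by simp))]
  rfl

theorem exists_perm_of_not_pairwise {α : Type*} {R : α → α → Prop} (hR : ∀ a b, R a b → R b a)
    {L : List α} (h : ¬ L.Pairwise R) : ∃ a b L', L.Perm (a :: b :: L') ∧ ¬ R a b := by
  induction L with
  | nil => simp at h
  | cons c L ih =>
    rw [List.pairwise_cons] at h
    by_cases hL : L.Pairwise R
    · have : ∃ b ∈ L, ¬ R c b := by
        by_contra hcon
        push Not at hcon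
        exact h ⟨hcon, hL⟩
      obtain ⟨b, hb, hcb⟩ := this
      classical
      exact ⟨c, b, L.erase b, (List.perm_cons_erase hb).cons c, hcb⟩
    · obtain ⟨a, b, L', hp, hab⟩ := ih hL
      refine ⟨a, b, c :: L', ?_, hab⟩
      exact (hp.cons c).trans ((List.Perm.swap a c _).trans ((List.Perm.swap b c _).cons a))

/-- Two edges without a common vertex. -/
def EdgeDisjoint (s t : Sym2 (Fin n)) : Prop := ∀ v, v ∈ s → v ∉ t

theorem EdgeDisjoint.symm {s t : Sym2 (Fin n)} (h : EdgeDisjoint s t) : EdgeDisjoint t s :=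
  fun v hv hv' => h v hv' hv

theorem edProd_eq_zero_or (s t : Sym2 (Fin n)) (L' : List (Sym2 (Fin n)))
    (h : ¬ EdgeDisjoint s t) : edProd k A N (s :: t :: L') = 0 ∨
      ∃ i j l, i ≠ j ∧ j ≠ l ∧ i ≠ l ∧ s = s(i, j) ∧ t = s(j, l) := by
  unfold EdgeDisjoint at h
  push Not at h
  obtain ⟨j, hs, ht⟩ := h
  obtain ⟨i, rfl⟩ := Sym2.mem_iff_exists.1 hs
  obtain ⟨l, rfl⟩ := Sym2.mem_iff_exists.1 ht
  by_cases hij : i = j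
  · left; simp [hij]
  by_cases hjl : j = l
  · left; simp [hjl]
  by_cases hil : i = l
  · left
    rw [hil, edProd_cons, edProd_cons, ← mul_assoc, ed_sq, zero_mul]
  exact Or.inr ⟨i, j, l, hij, hjl, hil, Sym2.eq_swap, rfl⟩

/-- `edBd L` is a signed sum of products with one edge less than `L`. The prefix `P` collects the
edges which the recursion for `edBd` has already split off, so every summand has exactly `c` edges.
-/
theorem symSum_mul_edBd {H : Subgroup (Equiv.Perm (Fin n))} {K : Set (Fin n)} {c : ℕ}
    (h : ∀ L : List (Sym2 (Fin n)), L.length = c → (∀ e ∈ L, ∀ v ∈ e, v ∈ K) →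
      symSum k A N H (edProd k A N L) = 0) (P L : List (Sym2 (Fin n)))
    (hc : P.length + L.length = c + 1) (hP : ∀ e ∈ P, ∀ v ∈ e, v ∈ K)
    (hL : ∀ e ∈ L, ∀ v ∈ e, v ∈ K) : symSum k A N H (edProd k A N P * edBd k A N L) = 0 := by
  induction L generalizing P with
  | nil => simp [edBd]
  | cons s L ih =>
    have h1 := h (P ++ L) (by simp at hc ⊢; omega) (by
      intro e he
      rcases List.mem_append.1 he with he | he
      · exact hP e he
      · exact hL e (by simp [he]))
    have h2 := ih (P ++ [s]) (by simp at hc ⊢; omega) (by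
      intro e he
      rcases List.mem_append.1 he with he | he
      · exact hP e he
      · exact hL e (by simp at he; simp [he])) (fun e he => hL e (by simp [he]))
    rw [edBd, mul_sub, map_sub, ← mul_assoc, ← edProd_append, h1, zero_sub, neg_eq_zero]
    rw [edProd_append, edProd_cons, edProd_nil, mul_one] at h2
    exact h2

/-- The symmetrization of a product of at least two edges vanishes. -/
theorem symSum_edProd (hk : (n.factorial : k) ≠ 0) (L : List (Sym2 (Fin n))) (hL : 2 ≤ L.length)
    (K : Set (Fin n)) (hK : ∀ e ∈ L, ∀ v ∈ e, v ∈ K) :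
    symSum k A N (permsOf K) (edProd k A N L) = 0 := by
  induction hc : L.length using Nat.strong_induction_on generalizing L K with
  | _ c IH =>
  subst hc
  -- In a matching, the permutation `(a x)(b y)` exchanges the first two edges and fixes the others,
  -- so it acts by `-1`.
  by_cases hM : L.Pairwise EdgeDisjoint
  · match L, hL, hK, hM with
    | s :: t :: L', _, hK, hM =>
      induction s with | _ a b
      induction t with | _ x y
      by_cases hab : a = b
      · simp [hab]
      by_cases hxy : x = y
      · simp [hxy]
      simp only [List.pairwise_cons, List.mem_cons, forall_eq_or_imp] at hM
      obtain ⟨⟨h1, h2⟩, h3, -⟩ := hM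
      have hax : a ≠ x := fun h => h1 a (by simp) (by simp [h])
      have hay : a ≠ y := fun h => h1 a (by simp) (by simp [h])
      have hbx : b ≠ x := fun h => h1 b (by simp) (by simp [h])
      have hby : b ≠ y := fun h => h1 b (by simp) (by simp [h])
      have h2k : ((2 : ℕ) : k) ≠ 0 := natCast_ne_zero_of_le hk two_pos (by
        have := Fin.val_injective.ne hab
        have := a.2
        have := b.2
        omega)
      have mK : ∀ v ∈ ({a, b, x, y} : Set (Fin n)), v ∈ K := by
        intro v hv
        simp only [Set.mem_insert_iff, Set.mem_singleton_iff] at hv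
        rcases hv with rfl | rfl | rfl | rfl
        · exact hK s(v, b) (by simp) _ (by simp)
        · exact hK s(a, v) (by simp) _ (by simp)
        · exact hK s(v, y) (by simp) _ (by simp)
        · exact hK s(x, v) (by simp) _ (by simp)
      have hτ : Equiv.swap a x * Equiv.swap b y ∈ permsOf ({a, b, x, y} : Set (Fin n)) :=
        Subgroup.mul_mem _ (swap_mem_permsOf (by simp) (by simp))
          (swap_mem_permsOf (by simp) (by simp))
      refine symSum_eq_zero_of_neg (by exact_mod_cast h2k) (permsOf_mono mK hτ) ?_
      rw [perm_edProd, List.map_cons, List.map_cons, map_sym2_eq_self hτ]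
      · have e1 : (Equiv.swap a x * Equiv.swap b y) a = x := by
          rw [Equiv.Perm.mul_apply, Equiv.swap_apply_of_ne_of_ne hab hay, Equiv.swap_apply_left]
        have e2 : (Equiv.swap a x * Equiv.swap b y) b = y := by
          rw [Equiv.Perm.mul_apply, Equiv.swap_apply_left,
            Equiv.swap_apply_of_ne_of_ne hay.symm (Ne.symm hxy)]
        have e3 : (Equiv.swap a x * Equiv.swap b y) x = a := by
          rw [Equiv.Perm.mul_apply, Equiv.swap_apply_of_ne_of_ne hbx.symm hxy,
            Equiv.swap_apply_right]
        have e4 : (Equiv.swap a x * Equiv.swap b y) y = b := by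
          rw [Equiv.Perm.mul_apply, Equiv.swap_apply_right,
            Equiv.swap_apply_of_ne_of_ne (Ne.symm hab) hbx]
        rw [Sym2.map_mk, Sym2.map_mk, e1, e2, e3, e4]
        simp only [edProd_cons, ← mul_assoc]
        rw [ed_comm, neg_mul]
      · intro e he v hv hv'
        simp only [Set.mem_insert_iff, Set.mem_singleton_iff] at hv'
        rcases hv' with rfl | rfl | rfl | rfl
        · exact h2 e he v (by simp) hv
        · exact h2 e he v (by simp) hv
        · exact h3 e he v (by simp) hv
        · exact h3 e he v (by simp) hv
  · obtain ⟨s, t, L', hp, hst⟩ := exists_perm_of_not_pairwise (fun _ _ h => h.symm) hM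
    obtain ⟨ε, hε, -⟩ := edProd_perm_sign (k := k) (A := A) (N := N) hp
    rw [hε, map_smul]
    suffices h : symSum k A N (permsOf K) (edProd k A N (s :: t :: L')) = 0 by rw [h, smul_zero]
    have hK' : ∀ e ∈ s :: t :: L', ∀ v ∈ e, v ∈ K := fun e he => hK e (hp.symm.subset he)
    have hlen := hp.length_eq
    rcases edProd_eq_zero_or (k := k) (A := A) (N := N) s t L' hst with h0 |
      ⟨i, j, l, hij, hjl, hil, rfl, rfl⟩
    · rw [h0, map_zero]
    obtain ⟨K₁, L₁, L₂, hp', h₁, h₂, hreach, hlen₁, hmin⟩ :=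
      exists_component s(i, j) s(j, l) L' (j := j) (by simp) (by simp)
    refine symSum_eq_zero_of_le hk (permsOf_mono (hmin K hK')) ?_
    have h2k : ((2 : ℕ) : k) ≠ 0 := natCast_ne_zero_of_le hk two_pos (by
      have := Fin.val_injective.ne hij
      have := i.2
      have := j.2
      omega)
    have hlen' := hp'.length_eq
    rw [List.length_append] at hlen'
    -- Either all edges lie in the component of `j`, or the edges of that component form a shorter
    -- product, to which induction applies.
    by_cases hL₂ : L₂ = []
    · subst hL₂
      rw [List.append_nil] at hp'
      have h₁' : ∀ e ∈ s(i, j) :: s(j, l) :: L', ∀ v ∈ e, v ∈ K₁ :=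
        fun e he => h₁ e (hp'.subset he)
      have hi : i ∈ K₁ := h₁' s(i, j) (by simp) i (by simp)
      have hj : j ∈ K₁ := h₁' s(i, j) (by simp) j (by simp)
      have hl : l ∈ K₁ := h₁' s(j, l) (by simp) l (by simp)
      -- With exactly two edges, the transposition of `i` and `l` exchanges them and changes the
      -- sign.
      by_cases hL' : L' = []
      · subst hL'
        refine symSum_eq_zero_of_neg (by exact_mod_cast h2k) (swap_mem_permsOf hi hl) ?_
        rw [perm_edProd]
        simp only [List.map_cons, List.map_nil, Sym2.map_mk, Equiv.swap_apply_left,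
          Equiv.swap_apply_right, Equiv.swap_apply_of_ne_of_ne (Ne.symm hij) hjl, edProd_cons,
          edProd_nil, mul_one]
        rw [Sym2.eq_swap (a := l), Sym2.eq_swap (b := i), ed_comm]
      · have hL'' : 0 < L'.length := List.length_pos_iff.2 hL'
        -- `σ⁻¹ i` and `σ⁻¹ j` lie in the same component, so `e_{σ⁻¹ i, σ⁻¹ j}` splits off from the
        -- product, and applying `σ` turns it into `e_{ij}` for every `σ`. The sum of the other
        -- factors symmetrizes products of `L'.length + 1 ≥ 2` edges and vanishes by induction.
        have hfac : ∀ σ ∈ permsOf K₁, E1.perm k A N n σ (edProd k A N (s(i, j) :: s(j, l) :: L')) =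
            ed k A N s(i, j) * E1.perm k A N n σ (edBd k A N (s(i, j) :: s(j, l) :: L')) := by
          intro σ hσ
          have hσ' := Subgroup.inv_mem _ hσ
          rw [edProd_eq_of_reachable (hreach _ (mem_of_mem_permsOf hσ' hi) _
            (mem_of_mem_permsOf hσ' hj)) ((Equiv.injective _).ne hij), map_mul, perm_ed]
          simp
        classical
        rw [symSum_apply, Finset.sum_congr rfl (fun σ hσ => hfac σ (Finset.mem_filter.1 hσ).2),
          ← Finset.mul_sum, ← symSum_apply]
        have := symSum_mul_edBd (k := k) (A := A) (N := N) (H := permsOf K₁) (K := K₁)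
          (c := L'.length + 1) (fun L'' hlen'' hK'' =>
            IH L''.length (by rw [hlen'', hlen]; simp) L'' (by omega) K₁ hK'' rfl) []
          (s(i, j) :: s(j, l) :: L') (by simp) (by simp) h₁'
        rw [edProd_nil, one_mul] at this
        rw [this, mul_zero]
    · have hpos : 0 < L₂.length := List.length_pos_iff.2 hL₂
      -- The permutations of `K₁` fix the edges in `L₂`, which therefore factor out of the
      -- symmetrization.
      obtain ⟨ε', hε', -⟩ := edProd_perm_sign (k := k) (A := A) (N := N) hp'
      have h0 := IH L₁.length (by omega) L₁ hlen₁ K₁ h₁ rfl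
      classical
      rw [symSum_apply] at h0
      rw [hε', map_smul, edProd_append, symSum_apply, Finset.sum_congr rfl (fun σ hσ => by
        rw [map_mul, perm_edProd σ L₂, map_sym2_eq_self (Finset.mem_filter.1 hσ).2 h₂]),
        ← Finset.sum_mul, h0, zero_mul, smul_zero]

variable (k A N) in
/-- The product of the classes `p_i^*(a)` in a list of pairs `(i, a)`. -/
def plProd (P : List (Fin n × GradedMonoid A)) : E1 k A N n :=
  (P.map fun x => pl k N x.1 x.2).prod

/-- The edges in a word. -/
def edgesOf (w : List (Gen A n)) : List (Sym2 (Fin n)) := w.filterMap fun x =>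
  match x with
  | .pull _ _ => none
  | .edge i j _ => some s(i, j)

/-- The classes `p_i^*(a)` in a word. -/
def pullsOf (w : List (Gen A n)) : List (Fin n × GradedMonoid A) := w.filterMap fun x =>
  match x with
  | .pull i a => some (i, a)
  | .edge _ _ _ => none

theorem pl_mul_edProd (i : Fin n) (a : GradedMonoid A) (L : List (Sym2 (Fin n))) :
    ∃ ε : k, pl k N i a * edProd k A N L = ε • (edProd k A N L * pl k N i a) := by
  induction L with
  | nil => exact ⟨1, by simp⟩
  | cons s L ih =>
    obtain ⟨ε, h⟩ := ih
    refine ⟨sgn k a.1 * ε, ?_⟩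
    rw [edProd_cons, ← mul_assoc, pl_ed, smul_mul_assoc, mul_assoc, h, mul_smul_comm, smul_smul,
      mul_assoc]

theorem edProd_mul_pl (i : Fin n) (a : GradedMonoid A) (L : List (Sym2 (Fin n))) :
    ∃ ε : k, edProd k A N L * pl k N i a = ε • (pl k N i a * edProd k A N L) := by
  induction L with
  | nil => exact ⟨1, by simp⟩
  | cons s L ih =>
    obtain ⟨ε, h⟩ := ih
    refine ⟨ε * sgn k a.1, ?_⟩
    rw [edProd_cons, mul_assoc, h, mul_smul_comm, ← mul_assoc, ed_pl, smul_mul_assoc, smul_smul,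
      mul_assoc]

theorem genProd_eq (w : List (Gen A n)) : ∃ ε : k,
    genProd k A N w = ε • (edProd k A N (edgesOf w) * plProd k A N (pullsOf w)) := by
  induction w with
  | nil => exact ⟨1, by simp [genProd, edgesOf, pullsOf, plProd, edProd]⟩
  | cons x w ih =>
    obtain ⟨ε, h⟩ := ih
    cases x with
    | pull i a =>
      obtain ⟨ε', h'⟩ := pl_mul_edProd (k := k) (N := N) i a (edgesOf w)
      refine ⟨ε * ε', ?_⟩
      rw [genProd_cons, h, mul_smul_comm, ← mul_assoc]
      change ε • (pl k N i a * edProd k A N (edgesOf w) * plProd k A N (pullsOf w)) =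
        (ε * ε') • (edProd k A N (edgesOf w) * plProd k A N ((i, a) :: pullsOf w))
      rw [h', smul_mul_assoc, smul_smul, mul_assoc]
      simp [plProd]
    | edge i j hij =>
      refine ⟨ε, ?_⟩
      rw [genProd_cons, h, mul_smul_comm, ← mul_assoc, ← ed_mk k N hij]
      rfl

/-- Each edge of a walk from `u` to `v` can be brought to the end of the product, where the class
slides along it. -/
theorem edProd_slide {L : List (Sym2 (Fin n))} {u v : Fin n} (h : (edgeGraph L).Reachable u v)
    (a : GradedMonoid A) : edProd k A N L * pl k N u a = edProd k A N L * pl k N v a := by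
  obtain ⟨p⟩ := h
  induction p with
  | nil => rfl
  | @cons x y z h p ih =>
    rw [← ih]
    rw [edgeGraph, SimpleGraph.fromEdgeSet_adj] at h
    have hp := (List.perm_cons_erase h.1).trans (List.perm_append_singleton _ _).symm
    obtain ⟨ε, h1, -⟩ := edProd_perm_sign (k := k) (A := A) (N := N) hp
    rw [h1, edProd_append, edProd_cons, edProd_nil, mul_one, smul_mul_assoc, smul_mul_assoc,
      mul_assoc, ed_pl_slide, mul_assoc]

/-- A permutation that moves every point within its component moves the classes `p_i^*(a)` only to
points of the same component, and there the edges do not see the difference. -/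
theorem edProd_mul_plProd_perm {L : List (Sym2 (Fin n))} {σ : Equiv.Perm (Fin n)}
    (h : ∀ i, (edgeGraph L).Reachable i (σ⁻¹ i)) (P : List (Fin n × GradedMonoid A)) :
    edProd k A N (L.map (Sym2.map σ)) * E1.perm k A N n σ (plProd k A N P) =
      edProd k A N (L.map (Sym2.map σ)) * plProd k A N P := by
  induction P with
  | nil => simp [plProd]
  | cons x P ih =>
    obtain ⟨i, a⟩ := x
    have e : plProd k A N ((i, a) :: P) = pl k N i a * plProd k A N P := by simp [plProd]
    rw [e, map_mul, perm_pl, ← mul_assoc, ← mul_assoc]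
    have h1 : edProd k A N (L.map (Sym2.map σ)) * pl k N (σ i) a =
        edProd k A N (L.map (Sym2.map σ)) * pl k N i a := by
      have := congrArg (E1.perm k A N n σ) (edProd_slide (k := k) (N := N) (h i) a)
      rw [map_mul, map_mul, perm_edProd, perm_pl, perm_pl] at this
      simpa using this
    obtain ⟨ε, h2⟩ := edProd_mul_pl (k := k) (N := N) i a (L.map (Sym2.map σ))
    rw [h1, h2, smul_mul_assoc, smul_mul_assoc, mul_assoc, ih, mul_assoc]

/-- The symmetrization of a monomial vanishes unless its edges form a matching. -/
theorem symSum_genProd (hk : (n.factorial : k) ≠ 0) (w : List (Gen A n))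
    (hw : ¬ (edgesOf w).Pairwise EdgeDisjoint) : symSum k A N ⊤ (genProd k A N w) = 0 := by
  obtain ⟨ε, h⟩ := genProd_eq (k := k) (N := N) w
  obtain ⟨s, t, L', hp, hst⟩ := exists_perm_of_not_pairwise (fun _ _ h => h.symm) hw
  obtain ⟨ε', hε', -⟩ := edProd_perm_sign (k := k) (A := A) (N := N) hp
  rw [h, hε', smul_mul_assoc, map_smul, map_smul]
  suffices h : symSum k A N ⊤ (edProd k A N (s :: t :: L') * plProd k A N (pullsOf w)) = 0 by
    rw [h, smul_zero, smul_zero]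
  rcases edProd_eq_zero_or (k := k) (A := A) (N := N) s t L' hst with h0 |
    ⟨i, j, l, hij, hjl, hil, rfl, rfl⟩
  · rw [h0, zero_mul, map_zero]
  obtain ⟨K, L₁, L₂, hp', h₁, h₂, hreach, hlen₁, -⟩ :=
    exists_component s(i, j) s(j, l) L' (j := j) (by simp) (by simp)
  obtain ⟨ε'', hε'', -⟩ := edProd_perm_sign (k := k) (A := A) (N := N) hp'
  refine symSum_eq_zero_of_le hk (le_top : permsOf K ≤ ⊤) ?_
  have h0 := symSum_edProd (k := k) (A := A) (N := N) hk L₁ hlen₁ K h₁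
  classical
  -- A permutation of the component `K` changes neither `L₂` nor, next to the edges, the classes
  -- `p_i^*(a)`. Only the edges in `L₁` are moved, and `symSum_edProd` applies to them.
  have key : ∀ σ ∈ Finset.univ.filter (· ∈ permsOf K), E1.perm k A N n σ
      (edProd k A N (s(i, j) :: s(j, l) :: L') * plProd k A N (pullsOf w)) =
      E1.perm k A N n σ (edProd k A N L₁) *
        (ε'' • (edProd k A N L₂ * plProd k A N (pullsOf w))) := by
    intro σ hσ
    have hσ' := (Finset.mem_filter.1 hσ).2
    rw [map_mul, perm_edProd, edProd_mul_plProd_perm, ← perm_edProd, hε'', map_smul,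
      edProd_append, map_mul, perm_edProd σ L₂, map_sym2_eq_self hσ' h₂, mul_smul_comm,
      smul_mul_assoc, mul_assoc]
    intro v
    by_cases hv : v ∈ K
    · exact hreach _ hv _ (mem_of_mem_permsOf (Subgroup.inv_mem _ hσ') hv)
    · rw [Subgroup.inv_mem (permsOf K) hσ' v hv]
  rw [symSum_apply, Finset.sum_congr rfl key, ← Finset.sum_mul, ← symSum_apply, h0, zero_mul]

end Vanishing

/-! ### Splitting `List.finRange` at a position -/

section FinRange

theorem exists_finRange_eq_append {m : ℕ} (i : Fin m) : ∃ u v : List (Fin m),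
    List.finRange m = u ++ i :: v ∧ (∀ a ∈ u, a < i) ∧ (∀ a ∈ v, i < a) := by
  refine ⟨(List.finRange m).take i, (List.finRange m).drop (i + 1), ?_, ?_, ?_⟩
  · have h : (i : ℕ) < (List.finRange m).length := by simp
    have := List.drop_eq_getElem_cons h
    conv_lhs => rw [← List.take_append_drop (i : ℕ) (List.finRange m), this]
    simp
  · intro a ha
    obtain ⟨j, hj, rfl⟩ := List.mem_iff_getElem.1 ha
    simp only [List.length_take, List.length_finRange] at hj
    rw [Fin.lt_def]
    simp
    omega
  · intro a ha
    obtain ⟨j, hj, rfl⟩ := List.mem_iff_getElem.1 ha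
    rw [Fin.lt_def]
    simp
    omega

theorem exists_finRange_eq_append₂ {m : ℕ} {i j : Fin m} (h : (i : ℕ) + 1 = j) :
    ∃ u v : List (Fin m), List.finRange m = u ++ i :: j :: v ∧ (∀ a ∈ u, a ≠ i ∧ a ≠ j) ∧
      (∀ a ∈ v, a ≠ i ∧ a ≠ j) := by
  obtain ⟨u, v, h1, h2, h3⟩ := exists_finRange_eq_append i
  have hj : j ∈ v := by
    have : j ∈ u ++ i :: v := by rw [← h1]; exact List.mem_finRange j
    rcases List.mem_append.1 this with h' | h'
    · have := h2 j h'; rw [Fin.lt_def] at this; omega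
    rcases List.mem_cons.1 h' with h' | h'
    · rw [h'] at h; omega
    · exact h'
  cases v with
  | nil => simp at hj
  | cons b v =>
    have hs : (List.finRange m).Pairwise (· < ·) := List.pairwise_lt_finRange m
    rw [h1, List.pairwise_append] at hs
    have hbv := (List.pairwise_cons.1 (List.pairwise_cons.1 hs.2.1).2).1
    have hb : b = j := by
      rcases List.mem_cons.1 hj with h' | h'
      · exact h'.symm
      · have h4 := hbv j h'
        have h5 := h3 b (by simp)
        rw [Fin.lt_def] at h4 h5
        omega
    subst hb
    refine ⟨u, v, h1, fun a ha => ?_, fun a ha => ?_⟩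
    · have := h2 a ha
      rw [Fin.lt_def] at this
      constructor <;> (rintro rfl; omega)
    · have h4 := h3 a (by simp [ha])
      have h5 := hbv a ha
      rw [Fin.lt_def] at h4 h5
      constructor <;> (rintro rfl; omega)

theorem sum_filter_lt_eq {m : ℕ} {M : Type*} [AddCommMonoid M] (d : Fin m → M) {i : Fin m}
    {u v : List (Fin m)} (h : List.finRange m = u ++ i :: v) (hu : ∀ a ∈ u, a < i)
    (hv : ∀ a ∈ v, i < a) : ∑ j ∈ Finset.univ.filter (fun j => j < i), d j = (u.map d).sum := by
  have hn : u.Nodup := by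
    have := List.nodup_finRange m
    rw [h] at this
    exact (List.nodup_append.1 this).1
  rw [← List.sum_toFinset d hn]
  congr 1
  ext a
  simp only [Finset.mem_filter, Finset.mem_univ, true_and, List.mem_toFinset]
  constructor
  · intro ha
    have : a ∈ u ++ i :: v := by rw [← h]; exact List.mem_finRange a
    rcases List.mem_append.1 this with h' | h'
    · exact h'
    rcases List.mem_cons.1 h' with h' | h'
    · exact absurd ha (by rw [h']; exact lt_irrefl _)
    · exact absurd ha (not_lt_of_gt (hv a h'))
  · exact hu a

theorem map_update_of_ne {α β : Type*} [DecidableEq α] (g : α → β) {i : α} (z : β) {u : List α}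
    (hu : ∀ a ∈ u, a ≠ i) : u.map (Function.update g i z) = u.map g :=
  List.map_congr_left fun a ha => Function.update_of_ne (hu a ha) _ _

end FinRange

/-! ### Monomials placed on `Fin n`, and their sums over all placements -/

section Monomials

variable (k : Type v) [Field k] {A : ℕ → Type w} [∀ p, AddCommGroup (A p)]
  [∀ p, Module k (A p)] [GradedMonoid.GMul A] [GradedMonoid.GOne A] (N : ℕ) {n : ℕ}

theorem prod_swap {m : ℕ} {i j : Fin m} (h : (i : ℕ) + 1 = j) (g : Fin m → E1 k A N n) {c : k}
    (hg : g i * g j = c • (g j * g i)) : ((List.finRange m).map g).prod =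
      c • ((List.finRange m).map (fun a => g (Equiv.swap i j a))).prod := by
  obtain ⟨u, v, h1, h2, h3⟩ := exists_finRange_eq_append₂ h
  have e : ∀ l : List (Fin m), (∀ a ∈ l, a ≠ i ∧ a ≠ j) →
      l.map (fun a => g (Equiv.swap i j a)) = l.map g := fun l hl =>
    List.map_congr_left fun a ha => by
      rw [Equiv.swap_apply_of_ne_of_ne (hl a ha).1 (hl a ha).2]
  rw [h1]
  simp only [List.map_append, List.map_cons, List.prod_append, List.prod_cons, e u h2, e v h3,
    Equiv.swap_apply_left, Equiv.swap_apply_right]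
  rw [← mul_assoc (g i), hg, smul_mul_assoc, mul_smul_comm, mul_assoc (g j)]

theorem mul_list_prod_comm {ι : Type*} (g : ι → E1 k A N n) (d : ι → ℤ) {z : E1 k A N n} {p : ℤ}
    (hz : ∀ i, z * g i = sgn k (p * d i) • (g i * z)) (u : List ι) :
    z * (u.map g).prod = sgn k (p * (u.map d).sum) • ((u.map g).prod * z) := by
  induction u with
  | nil => simp
  | cons a u ih =>
    simp only [List.map_cons, List.prod_cons, List.sum_cons]
    rw [← mul_assoc, hz, smul_mul_assoc, mul_assoc, ih, mul_smul_comm, smul_smul, mul_add, sgn_add,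
      mul_assoc]

/-- The factor `z` is carried past the factors before position `i` and absorbed there, hence the sum
over `j < i` in the sign. -/
theorem mul_prod_update {m : ℕ} (g : Fin m → E1 k A N n) (d : Fin m → ℤ) {z : E1 k A N n} {p : ℤ}
    (hz : ∀ i, z * g i = sgn k (p * d i) • (g i * z)) (i : Fin m) :
    z * ((List.finRange m).map g).prod =
      sgn k (p * ∑ j ∈ Finset.univ.filter (fun j => j < i), d j) •
        ((List.finRange m).map (Function.update g i (z * g i))).prod := by
  obtain ⟨u, v, h1, h2, h3⟩ := exists_finRange_eq_append i
  rw [sum_filter_lt_eq d h1 h2 h3, h1]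
  simp only [List.map_append, List.map_cons, List.prod_append, List.prod_cons,
    map_update_of_ne g _ (fun a ha => (h2 a ha).ne), map_update_of_ne g _ (fun a ha => (h3 a ha).ne'),
    Function.update_self]
  rw [← mul_assoc, mul_list_prod_comm k N g d hz, smul_mul_assoc, mul_assoc, mul_assoc]

/-- The degree of a bihomogeneous element. -/
theorem bihomogeneous_comm {t r t' r' : ℕ} {x y : E1 k A N n}
    (hx : x ∈ E1.bihomogeneous k A N n t r) (hy : y ∈ E1.bihomogeneous k A N n t' r') :
    x * y = sgn k ((t + r * ((N : ℤ) - 1)) * (t' + r' * ((N : ℤ) - 1))) • (y * x) := by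
  have hdeg : ∀ g : Gen A n, g.deg N = (g.bideg.1 : ℤ) + g.bideg.2 * ((N : ℤ) - 1) := by
    intro g; cases g <;> simp [Gen.deg, Gen.bideg]
  have hone : ∀ (g : Gen A n) (w : List (Gen A n)), E1.gen k A N n g * genProd k A N w =
      sgn k (g.deg N * (((w.map Gen.bideg).sum.1 : ℤ) + (w.map Gen.bideg).sum.2 * ((N : ℤ) - 1))) •
        (genProd k A N w * E1.gen k A N n g) := by
    intro g w
    induction w with
    | nil => simp [genProd]
    | cons h w ih =>
      rw [genProd_cons, ← mul_assoc, gen_comm, smul_mul_assoc, mul_assoc, ih, mul_smul_comm,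
        smul_smul, ← sgn_add, mul_assoc, hdeg h]
      congr 2
      simp only [List.map_cons, List.sum_cons, Prod.fst_add, Prod.snd_add]
      push_cast
      ring
  have htwo : ∀ w w' : List (Gen A n), genProd k A N w * genProd k A N w' =
      sgn k ((((w.map Gen.bideg).sum.1 : ℤ) + (w.map Gen.bideg).sum.2 * ((N : ℤ) - 1)) *
        (((w'.map Gen.bideg).sum.1 : ℤ) + (w'.map Gen.bideg).sum.2 * ((N : ℤ) - 1))) •
        (genProd k A N w' * genProd k A N w) := by
    intro w w'
    induction w with
    | nil => simp [genProd]
    | cons g w ih =>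
      rw [genProd_cons, mul_assoc, ih, mul_smul_comm, ← mul_assoc, hone, smul_mul_assoc,
        smul_smul, ← sgn_add, mul_assoc, hdeg g]
      congr 2
      simp only [List.map_cons, List.sum_cons, Prod.fst_add, Prod.snd_add]
      push_cast
      ring
  induction hx, hy using Submodule.span_induction₂ with
  | mem_mem x y hx hy =>
    obtain ⟨w, hw, rfl⟩ := hx
    obtain ⟨w', hw', rfl⟩ := hy
    change genProd k A N w * genProd k A N w' = _ • (genProd k A N w' * genProd k A N w)
    rw [htwo, hw, hw']
  | zero_left y hy => simp
  | zero_right x hx => simp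
  | add_left x y z _ _ _ h1 h2 => rw [add_mul x y z, mul_add z x y, h1, h2, smul_add]
  | add_right x y z _ _ _ h1 h2 => rw [add_mul y z x, mul_add x y z, h1, h2, smul_add]
  | smul_left c x y _ _ h => rw [smul_mul_assoc, mul_smul_comm, h, smul_comm]
  | smul_right c x y _ _ h => rw [smul_mul_assoc, mul_smul_comm, h, smul_comm]

/-- The bijections which place `m` letters on single points and `r` letters on pairs of points of
`Fin n`. -/
abbrev Layout (m r n : ℕ) : Type := Fin m ⊕ (Fin r ⊕ Fin r) ≃ Fin n

/-- The points outside the range of `f` become the single points, in an arbitrary order. -/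
theorem exists_layout {r : ℕ} (f : Fin r ⊕ Fin r → Fin n) (hf : Function.Injective f) :
    ∃ m, m + 2 * r = n ∧ ∃ φ : Layout m r n, ∀ x, φ (.inr x) = f x := by
  classical
  have e₁ : (Fin r ⊕ Fin r) ≃ Set.range f := Equiv.ofInjective f hf
  let m := Fintype.card ((Set.range f)ᶜ : Set (Fin n))
  let e₂ : Fin m ≃ ((Set.range f)ᶜ : Set (Fin n)) := (Fintype.equivFin _).symm
  let φ : Layout m r n := (Equiv.sumComm _ _).trans
    ((Equiv.sumCongr (Equiv.ofInjective f hf) e₂).trans (Equiv.Set.sumCompl (Set.range f)))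
  refine ⟨m, ?_, φ, fun x => rfl⟩
  have := Fintype.card_congr φ
  simp only [Fintype.card_sum, Fintype.card_fin] at this
  omega

variable [hN : Fact (Even N)] {m r : ℕ}

/-- The monomial `∏ p_i^*(x_i) ∏ e_j p_j^*(y_j)` placed on `Fin n` by a layout. -/
def mono (φ : Layout m r n) (x : Fin m → GradedMonoid A) (y : Fin r → GradedMonoid A) :
    E1 k A N n :=
  ((List.finRange m).map fun i => pl k N (φ (.inl i)) (x i)).prod *
    ((List.finRange r).map fun j =>
      ed k A N s(φ (.inr (.inl j)), φ (.inr (.inr j))) * pl k N (φ (.inr (.inl j))) (y j)).prod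

omit hN in
theorem layout_ne (φ : Layout m r n) (j : Fin r) : φ (.inr (.inl j)) ≠ φ (.inr (.inr j)) :=
  φ.injective.ne (by simp)

/-- The generators in a monomial. -/
def monoWord (φ : Layout m r n) (x : Fin m → GradedMonoid A) (y : Fin r → GradedMonoid A) :
    List (Gen A n) :=
  (List.finRange m).map (fun i => .pull (φ (.inl i)) (x i)) ++
    (List.finRange r).flatMap fun j =>
      [.edge (φ (.inr (.inl j))) (φ (.inr (.inr j))) (layout_ne φ j), .pull (φ (.inr (.inl j))) (y j)]

theorem prod_flatMap {ι M : Type*} [Monoid M] (f : ι → List M) (l : List ι) :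
    (l.flatMap f).prod = (l.map fun i => (f i).prod).prod := by
  induction l with
  | nil => simp
  | cons a l ih => simp [ih]

theorem mono_eq_genProd (φ : Layout m r n) (x : Fin m → GradedMonoid A)
    (y : Fin r → GradedMonoid A) : mono k N φ x y = genProd k A N (monoWord φ x y) := by
  unfold mono monoWord
  rw [genProd_append]
  congr 1
  · simp [genProd, Function.comp_def, pl]
  · rw [genProd, List.map_flatMap, prod_flatMap]
    congr 2
    funext j
    simp [ed_mk k N (layout_ne φ j), pl]

theorem perm_mono (σ : Equiv.Perm (Fin n)) (φ : Layout m r n) (x : Fin m → GradedMonoid A)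
    (y : Fin r → GradedMonoid A) :
    E1.perm k A N n σ (mono k N φ x y) = mono k N (φ.trans σ) x y := by
  simp [mono, map_mul, map_list_prod, List.map_map, Function.comp_def]

/-- The sum of a monomial over all layouts. -/
def monoSum (n : ℕ) (x : Fin m → GradedMonoid A) (y : Fin r → GradedMonoid A) : E1 k A N n :=
  ∑ φ : Layout m r n, mono k N φ x y

theorem symSum_mono (φ : Layout m r n) (x : Fin m → GradedMonoid A) (y : Fin r → GradedMonoid A) :
    symSum k A N ⊤ (mono k N φ x y) = monoSum k N n x y := by
  classical
  rw [symSum_apply, monoSum]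
  simp only [Subgroup.mem_top, Finset.filter_true, perm_mono]
  exact Fintype.sum_equiv ⟨fun σ => φ.trans σ, fun φ' => φ.symm.trans φ', fun σ => by ext; simp,
    fun φ' => by ext; simp⟩ _ _ fun _ => rfl

theorem perm_monoSum (σ : Equiv.Perm (Fin n)) (x : Fin m → GradedMonoid A)
    (y : Fin r → GradedMonoid A) :
    E1.perm k A N n σ (monoSum k N n x y) = monoSum k N n x y := by
  rw [monoSum, map_sum]
  simp only [perm_mono]
  exact Fintype.sum_equiv ⟨fun φ => φ.trans σ, fun φ' => φ'.trans σ⁻¹, fun φ => by ext; simp,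
    fun φ' => by ext; simp⟩ _ _ fun _ => rfl

theorem block_mem (u v w : Fin n) (a : GradedMonoid A) :
    ed k A N s(u, v) * pl k N w a ∈ E1.bihomogeneous k A N n a.1 1 := by
  simpa using mul_mem_bihomogeneous k N (ed_mem_bihomogeneous (A := A) k N s(u, v))
    (pl_mem_bihomogeneous k N w a)

theorem mono_swap_left {i j : Fin m} (h : (i : ℕ) + 1 = j) (φ : Layout m r n)
    (x : Fin m → GradedMonoid A) (y : Fin r → GradedMonoid A) : mono k N φ x y =
      sgn k (((x i).1 : ℤ) * (x j).1) •
        mono k N ((Equiv.sumCongr (Equiv.swap i j) (Equiv.refl _)).trans φ)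
          (fun a => x (Equiv.swap i j a)) y := by
  unfold mono
  rw [prod_swap k N h (fun a => pl k N (φ (.inl a)) (x a)) (pl_comm k N _ _ _ _), smul_mul_assoc]
  rfl

theorem mono_swap_right {i j : Fin r} (h : (i : ℕ) + 1 = j) (φ : Layout m r n)
    (x : Fin m → GradedMonoid A) (y : Fin r → GradedMonoid A) : mono k N φ x y =
      sgn k (((y i).1 + ((N : ℤ) - 1)) * ((y j).1 + ((N : ℤ) - 1))) •
        mono k N ((Equiv.sumCongr (Equiv.refl _) (Equiv.sumCongr (Equiv.swap i j)
          (Equiv.swap i j))).trans φ) x (fun a => y (Equiv.swap i j a)) := by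
  unfold mono
  rw [prod_swap k N h (fun a => ed k A N s(φ (.inr (.inl a)), φ (.inr (.inr a))) *
    pl k N (φ (.inr (.inl a))) (y a))
    (bihomogeneous_comm k N (block_mem k N _ _ _ _) (block_mem k N _ _ _ _)), mul_smul_comm]
  simp only [Nat.cast_one, one_mul]
  rfl

/-- Exchanging two neighbouring letters also exchanges their points, and the sum over all layouts
absorbs this second change. What remains is the defining relation of `Λ^m(A)`, so the sum descends
to the quotient. -/
theorem monoSum_swap_left {i j : Fin m} (h : (i : ℕ) + 1 = j) (x : Fin m → GradedMonoid A)
    (y : Fin r → GradedMonoid A) : monoSum k N n x y =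
      sgn k (((x i).1 : ℤ) * (x j).1) • monoSum k N n (fun a => x (Equiv.swap i j a)) y := by
  have e : monoSum k N n (fun a => x (Equiv.swap i j a)) y = ∑ φ : Layout m r n,
      mono k N ((Equiv.sumCongr (Equiv.swap i j) (Equiv.refl _)).trans φ)
        (fun a => x (Equiv.swap i j a)) y :=
    (Fintype.sum_equiv ⟨fun φ => (Equiv.sumCongr (Equiv.swap i j) (Equiv.refl _)).trans φ,
      fun φ => (Equiv.sumCongr (Equiv.swap i j) (Equiv.refl _)).trans φ,
      fun φ => by ext a; rcases a with a | a | a <;> simp,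
      fun φ => by ext a; rcases a with a | a | a <;> simp⟩ _ _ fun _ => rfl).symm
  rw [e, monoSum, Finset.smul_sum]
  exact Finset.sum_congr rfl fun φ _ => mono_swap_left k N h φ x y

theorem monoSum_swap_right {i j : Fin r} (h : (i : ℕ) + 1 = j) (x : Fin m → GradedMonoid A)
    (y : Fin r → GradedMonoid A) : monoSum k N n x y =
      sgn k (((y i).1 + ((N : ℤ) - 1)) * ((y j).1 + ((N : ℤ) - 1))) •
        monoSum k N n x (fun a => y (Equiv.swap i j a)) := by
  let s : Fin m ⊕ (Fin r ⊕ Fin r) ≃ Fin m ⊕ (Fin r ⊕ Fin r) :=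
    Equiv.sumCongr (Equiv.refl _) (Equiv.sumCongr (Equiv.swap i j) (Equiv.swap i j))
  have e : monoSum k N n x (fun a => y (Equiv.swap i j a)) = ∑ φ : Layout m r n,
      mono k N (s.trans φ) x (fun a => y (Equiv.swap i j a)) :=
    (Fintype.sum_equiv ⟨fun φ => s.trans φ, fun φ => s.trans φ,
      fun φ => by ext a; rcases a with a | a | a <;> simp [s],
      fun φ => by ext a; rcases a with a | a | a <;> simp [s]⟩ _ _ fun _ => rfl).symm
  rw [e, monoSum, Finset.smul_sum]
  exact Finset.sum_congr rfl fun φ _ => mono_swap_right k N h φ x y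

end Monomials

/-! ### The map `Ψ` -/

section Psi

variable (k : Type v) [Field k] (A : ℕ → Type w) [∀ p, AddCommGroup (A p)]
  [∀ p, Module k (A p)] [GradedMonoid.GMul A] [GradedMonoid.GOne A] (N : ℕ) {n : ℕ}
  [hN : Fact (Even N)] {m r : ℕ}

/-- The left part of a monomial, as a linear function of its letters. -/
def leftLin (φ : Layout m r n) : (PiTensorProduct k fun _ : Fin m => DirectSum ℕ A) →ₗ[k] E1 k A N n :=
  PiTensorProduct.lift ((MultilinearMap.mkPiAlgebraFin k m (E1 k A N n)).compLinearMap
    fun i => plLin k N (φ (.inl i)))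

/-- The right part of a monomial, as a linear function of its letters. -/
def rightLin (φ : Layout m r n) :
    (PiTensorProduct k fun _ : Fin r => DirectSum ℕ A) →ₗ[k] E1 k A N n :=
  PiTensorProduct.lift ((MultilinearMap.mkPiAlgebraFin k r (E1 k A N n)).compLinearMap
    fun j => (LinearMap.mulLeft k (ed k A N s(φ (.inr (.inl j)), φ (.inr (.inr j))))).comp
      (plLin k N (φ (.inr (.inl j)))))

variable (m r n) in
/-- The sum of a monomial over all layouts, as a bilinear function. -/
def monoSumLin : (PiTensorProduct k fun _ : Fin m => DirectSum ℕ A) →ₗ[k]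
    (PiTensorProduct k fun _ : Fin r => DirectSum ℕ A) →ₗ[k] E1 k A N n :=
  ∑ φ : Layout m r n, (LinearMap.mul k (E1 k A N n)).compl₁₂ (leftLin k A N φ) (rightLin k A N φ)

theorem monoSumLin_tprod (x : Fin m → GradedMonoid A) (y : Fin r → GradedMonoid A) :
    monoSumLin k A N n m r (PiTensorProduct.tprod k fun i => homog (x i))
      (PiTensorProduct.tprod k fun i => homog (y i)) = monoSum k N n x y := by
  simp [monoSumLin, monoSum, leftLin, rightLin, mono, List.ofFn_eq_map]

theorem monoSumLin_left (w : PiTensorProduct k fun _ : Fin m => DirectSum ℕ A)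
    (hw : w ∈ powerRelations k A 0 m) : monoSumLin k A N n m r w = 0 := by
  induction hw using Submodule.span_induction with
  | mem w hw =>
    obtain ⟨x, i, j, hij, rfl⟩ := hw
    apply tensorPower_ext
    intro y
    rw [map_sub, map_smul, LinearMap.sub_apply, LinearMap.smul_apply, monoSumLin_tprod,
      monoSumLin_tprod k A N (fun a => x (Equiv.swap i j a)), monoSum_swap_left k N hij]
    simp
  | zero => simp
  | add x y _ _ hx hy => rw [map_add, hx, hy, add_zero]
  | smul c x _ hx => rw [map_smul, hx, smul_zero]

theorem monoSumLin_right (w : PiTensorProduct k fun _ : Fin r => DirectSum ℕ A)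
    (hw : w ∈ powerRelations k A ((N : ℤ) - 1) r) : (monoSumLin k A N n m r).flip w = 0 := by
  induction hw using Submodule.span_induction with
  | mem w hw =>
    obtain ⟨y, i, j, hij, rfl⟩ := hw
    apply tensorPower_ext
    intro x
    rw [map_sub, map_smul, LinearMap.sub_apply, LinearMap.smul_apply, LinearMap.flip_apply,
      LinearMap.flip_apply, monoSumLin_tprod,
      monoSumLin_tprod k A N _ (fun a => y (Equiv.swap i j a)), monoSum_swap_right k N hij]
    simp
  | zero => simp
  | add x y _ _ hx hy => rw [map_add, hx, hy, add_zero]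
  | smul c x _ hx => rw [map_smul, hx, smul_zero]

variable (m r n) in
/-- The sum of a monomial over all layouts, as a function on `Λ^m(A) ⊗ Λ^r(s^{N-1} A)`. -/
def powerMonoSum : TensorProduct k (Power k A 0 m) (Power k A ((N : ℤ) - 1) r) →ₗ[k] E1 k A N n :=
  TensorProduct.lift (Submodule.liftQ _
    (Submodule.liftQ _ (monoSumLin k A N n m r).flip (monoSumLin_right k A N)).flip
    fun w hw => by
      rw [LinearMap.mem_ker]
      apply power_ext
      intro y
      change monoSumLin k A N n m r w _ = 0
      rw [monoSumLin_left k A N w hw, LinearMap.zero_apply])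

theorem powerMonoSum_wedge (x : Fin m → GradedMonoid A) (y : Fin r → GradedMonoid A) :
    powerMonoSum k A N n m r (Power.wedge k 0 x ⊗ₜ[k] Power.wedge k ((N : ℤ) - 1) y) =
      monoSum k N n x y :=
  monoSumLin_tprod k A N x y

variable (n) in
/-- The map `Ψ`, with values in `E₁`. -/
def psiLin : Cn k A N n →ₗ[k] E1 k A N n :=
  DirectSum.toModule k _ _ fun q => ((2 : k)⁻¹ ^ q.1.2) • powerMonoSum k A N n q.1.1 q.1.2

/-- The factor `2⁻¹ ^ r` compensates for the two orientations of each pair, which give the same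
monomial. A factor `c ^ r` is compatible with products for every `c`; this choice produces the `1/2`
in the formula for the differential. -/
theorem psiLin_word (h : m + 2 * r = n) (x : Fin m → GradedMonoid A) (y : Fin r → GradedMonoid A) :
    psiLin k A N n (Cn.word k N h x y) = (2 : k)⁻¹ ^ r • monoSum k N n x y := by
  rw [psiLin, Cn.word, DirectSum.toModule_lof, LinearMap.smul_apply, powerMonoSum_wedge]

theorem psiLin_mem (u : Cn k A N n) : psiLin k A N n u ∈ E1.invariants k A N n := by
  intro σ
  have : (E1.perm k A N n σ).toLinearMap.comp (psiLin k A N n) = psiLin k A N n := by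
    apply cn_ext
    intro m r h x y
    rw [LinearMap.comp_apply, psiLin_word, map_smul, AlgHom.toLinearMap_apply, perm_monoSum]
  exact LinearMap.congr_fun this u

variable {A}

theorem monoWord_bideg (φ : Layout m r n) (x : Fin m → GradedMonoid A) (y : Fin r → GradedMonoid A) :
    ((monoWord φ x y).map Gen.bideg).sum = ((∑ i, (x i).1) + ∑ i, (y i).1, r) := by
  have h1 : ∀ l : List (Fin m), ((l.map fun i => (Gen.pull (φ (.inl i)) (x i) : Gen A n)).map
      Gen.bideg).sum = ((l.map fun i => (x i).1).sum, 0) := by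
    intro l
    induction l with
    | nil => rfl
    | cons a l ih => simp only [List.map_cons, List.sum_cons, ih]; simp [Gen.bideg]
  have h2 : ∀ l : List (Fin r), ((l.flatMap fun j => ([.edge (φ (.inr (.inl j)))
      (φ (.inr (.inr j))) (layout_ne φ j), .pull (φ (.inr (.inl j))) (y j)] : List (Gen A n))).map
      Gen.bideg).sum = ((l.map fun i => (y i).1).sum, l.length) := by
    intro l
    induction l with
    | nil => rfl
    | cons a l ih =>
      rw [List.flatMap_cons, List.map_append, List.sum_append, ih]
      simp [Gen.bideg, add_comm]
  rw [monoWord, List.map_append, List.sum_append, h1, h2]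
  simp [← List.ofFn_eq_map, List.sum_ofFn]

theorem mono_mem (φ : Layout m r n) (x : Fin m → GradedMonoid A) (y : Fin r → GradedMonoid A) :
    mono k N φ x y ∈ E1.bihomogeneous k A N n ((∑ i, (x i).1) + ∑ i, (y i).1) r := by
  rw [mono_eq_genProd]
  exact genProd_mem k N _ (monoWord_bideg φ x y)

theorem monoSum_mem (x : Fin m → GradedMonoid A) (y : Fin r → GradedMonoid A) :
    monoSum k N n x y ∈ E1.bihomogeneous k A N n ((∑ i, (x i).1) + ∑ i, (y i).1) r :=
  Submodule.sum_mem _ fun φ _ => mono_mem k N φ x y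

theorem psiLin_mem_bihomogeneous {t r : ℕ} {u : Cn k A N n} (hu : u ∈ Cn.bihomogeneous k N n t r) :
    psiLin k A N n u ∈ E1.bihomogeneous k A N n t r := by
  induction hu using Submodule.span_induction with
  | mem u hu =>
    obtain ⟨m, h, x, y, rfl, rfl⟩ := hu
    rw [psiLin_word]
    exact Submodule.smul_mem _ _ (monoSum_mem k N x y)
  | zero => simp
  | add x y _ _ hx hy => rw [map_add]; exact Submodule.add_mem _ hx hy
  | smul c x _ hx => rw [map_smul]; exact Submodule.smul_mem _ _ hx

/-- Multiplying a monomial by `p_v^*(a)`, for a point `v` on which a single letter is placed. -/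
theorem pl_mul_mono_left (φ : Layout m r n) (x : Fin m → GradedMonoid A)
    (y : Fin r → GradedMonoid A) (i : Fin m) (a : GradedMonoid A) :
    pl k N (φ (.inl i)) a * mono k N φ x y =
      sgn k ((a.1 : ℤ) * ∑ j ∈ Finset.univ.filter (fun j => j < i), ((x j).1 : ℤ)) •
        mono k N φ (Function.update x i (a * x i)) y := by
  unfold mono
  rw [← mul_assoc, mul_prod_update k N (fun i => pl k N (φ (.inl i)) (x i))
    (fun j => ((x j).1 : ℤ)) (fun j => pl_comm k N _ _ _ _) i, smul_mul_assoc]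
  congr 3
  congr 1
  funext j
  by_cases h : j = i
  · subst h; simp [pl_mul]
  · simp [h]

/-- Multiplying a monomial by `p_v^*(a)`, for a point `v` on one of its edges: the sign does not
depend on the layout. -/
theorem pl_mul_mono_right (x : Fin m → GradedMonoid A)
    (y : Fin r → GradedMonoid A) (j : Fin r) (a : GradedMonoid A) :
    ∃ c : k, c ≠ 0 ∧ (∀ φ' : Layout m r n, ∀ v',
        v' = φ' (.inr (.inl j)) ∨ v' = φ' (.inr (.inr j)) →
      pl k N v' a * mono k N φ' x y = c • mono k N φ' x (Function.update y j (a * y j))) := by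
  refine ⟨sgn k ((a.1 : ℤ) * ((List.finRange m).map fun i => ((x i).1 : ℤ)).sum) *
    (sgn k ((a.1 : ℤ) * ∑ i ∈ Finset.univ.filter (fun i => i < j), ((y i).1 + ((N : ℤ) - 1))) *
    sgn k a.1), mul_ne_zero (sgn_ne_zero k _) (mul_ne_zero (sgn_ne_zero k _) (sgn_ne_zero k _)),
    fun φ' v' hv' => ?_⟩
  unfold mono
  rw [← mul_assoc, mul_list_prod_comm k N (fun i => pl k N (φ' (.inl i)) (x i))
    (fun j => ((x j).1 : ℤ)) (fun j => pl_comm k N _ _ _ _), smul_mul_assoc, mul_assoc,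
    mul_prod_update k N (fun j => ed k A N s(φ' (.inr (.inl j)), φ' (.inr (.inr j))) *
      pl k N (φ' (.inr (.inl j))) (y j)) (fun j => ((y j).1 + ((N : ℤ) - 1)))
      (p := (a.1 : ℤ)) (fun j => by
        have := bihomogeneous_comm k N (pl_mem_bihomogeneous k N v' a)
          (block_mem k N (φ' (.inr (.inl j))) (φ' (.inr (.inr j))) (φ' (.inr (.inl j))) (y j))
        simpa using this) j]
  have hblock : pl k N v' a * (ed k A N s(φ' (.inr (.inl j)), φ' (.inr (.inr j))) *
      pl k N (φ' (.inr (.inl j))) (y j)) = sgn k a.1 •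
      (ed k A N s(φ' (.inr (.inl j)), φ' (.inr (.inr j))) *
      pl k N (φ' (.inr (.inl j))) (a * y j)) := by
    rw [← mul_assoc, pl_ed, pl_mul, smul_mul_assoc]
    rcases hv' with rfl | rfl
    · rw [mul_assoc]
    · rw [← ed_pl_slide k N (φ' (.inr (.inl j))) (φ' (.inr (.inr j))), mul_assoc]
  have hupd : ∀ (c : k), ((List.finRange r).map (Function.update (fun j =>
      ed k A N s(φ' (.inr (.inl j)), φ' (.inr (.inr j))) * pl k N (φ' (.inr (.inl j))) (y j)) j
      (c • (ed k A N s(φ' (.inr (.inl j)), φ' (.inr (.inr j))) *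
      pl k N (φ' (.inr (.inl j))) (a * y j))))).prod = c • ((List.finRange r).map (fun i =>
      ed k A N s(φ' (.inr (.inl i)), φ' (.inr (.inr i))) *
        pl k N (φ' (.inr (.inl i))) (Function.update y j (a * y j) i))).prod := by
    intro c
    obtain ⟨u, v, h1, h2, h3⟩ := exists_finRange_eq_append j
    rw [h1]
    simp only [List.map_append, List.map_cons, List.prod_append, List.prod_cons,
      map_update_of_ne _ _ (fun a ha => (h2 a ha).ne), map_update_of_ne _ _ (fun a ha => (h3 a ha).ne'),
      Function.update_self]
    have e : ∀ l : List (Fin r), (∀ a ∈ l, a ≠ j) → l.map (fun i =>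
        ed k A N s(φ' (.inr (.inl i)), φ' (.inr (.inr i))) *
        pl k N (φ' (.inr (.inl i))) (Function.update y j (a * y j) i)) = l.map (fun i =>
        ed k A N s(φ' (.inr (.inl i)), φ' (.inr (.inr i))) *
        pl k N (φ' (.inr (.inl i))) (y i)) := fun l hl => List.map_congr_left fun a ha => by
      rw [Function.update_of_ne (hl a ha)]
    rw [e u (fun a ha => (h2 a ha).ne), e v (fun a ha => (h3 a ha).ne'), smul_mul_assoc, mul_smul_comm]
  rw [hblock, hupd, mul_smul_comm, mul_smul_comm, smul_smul, smul_smul, mul_assoc]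

/-- Each class is absorbed by the letter on its point, whether that is a single point or either end
of a pair. The statement on degrees is what makes `Ψ` reflect bidegrees. -/
theorem plProd_mul_mono (φ : Layout m r n) (P : List (Fin n × GradedMonoid A)) :
    ∃ (c : k) (x : Fin m → GradedMonoid A) (y : Fin r → GradedMonoid A),
      (∑ i, (x i).1) + ∑ i, (y i).1 = (P.map fun p => p.2.1).sum ∧
      plProd k A N P * mono k N φ (fun _ => 1) (fun _ => 1) = c • mono k N φ x y := by
  have hupd : ∀ {s : ℕ} (x : Fin s → GradedMonoid A) (i : Fin s) (a : GradedMonoid A),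
      ∑ j, (Function.update x i (a * x i) j).1 = a.1 + ∑ j, (x j).1 := by
    intro s x i a
    rw [← Finset.add_sum_erase _ _ (Finset.mem_univ i),
      ← Finset.add_sum_erase _ (fun j => (x j).1) (Finset.mem_univ i), Function.update_self,
      ← add_assoc]
    congr 1
    exact Finset.sum_congr rfl fun j hj => by rw [Function.update_of_ne (Finset.ne_of_mem_erase hj)]
  induction P with
  | nil =>
    refine ⟨1, fun _ => 1, fun _ => 1, ?_, by simp [plProd]⟩
    have h : (1 : GradedMonoid A).1 = 0 := rfl
    simp [h]
  | cons p P ih =>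
    obtain ⟨v, a⟩ := p
    obtain ⟨c, x, y, hd, h⟩ := ih
    have e : plProd k A N ((v, a) :: P) = pl k N v a * plProd k A N P := by simp [plProd]
    rw [e, mul_assoc, h, mul_smul_comm]
    obtain ⟨z, rfl⟩ := φ.surjective v
    rcases z with i | j | j
    · exact ⟨_, Function.update x i (a * x i), y, by rw [hupd, List.map_cons, List.sum_cons, ← hd, add_assoc],
        by rw [pl_mul_mono_left, smul_smul]⟩
    · obtain ⟨c', -, h'⟩ := pl_mul_mono_right (n := n) k N x y j a
      exact ⟨_, x, Function.update y j (a * y j),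
        by rw [hupd, List.map_cons, List.sum_cons, ← hd, add_left_comm],
        by rw [h' φ _ (Or.inl rfl), smul_smul]⟩
    · obtain ⟨c', -, h'⟩ := pl_mul_mono_right (n := n) k N x y j a
      exact ⟨_, x, Function.update y j (a * y j),
        by rw [hupd, List.map_cons, List.sum_cons, ← hd, add_left_comm],
        by rw [h' φ _ (Or.inr rfl), smul_smul]⟩

theorem edProd_mul_plProd (L : List (Sym2 (Fin n))) (P : List (Fin n × GradedMonoid A)) :
    ∃ c : k, edProd k A N L * plProd k A N P = c • (plProd k A N P * edProd k A N L) := by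
  induction P with
  | nil => exact ⟨1, by simp [plProd]⟩
  | cons p P ih =>
    obtain ⟨v, a⟩ := p
    obtain ⟨c, h⟩ := ih
    have e : plProd k A N ((v, a) :: P) = pl k N v a * plProd k A N P := by simp [plProd]
    obtain ⟨c', h'⟩ := edProd_mul_pl (k := k) (N := N) v a L
    exact ⟨c' * c, by
      rw [e, ← mul_assoc, h', smul_mul_assoc, mul_assoc, h, mul_smul_comm, smul_smul, mul_assoc]⟩

/-- Either some edge is a loop and the product is zero, or the end points of the disjoint edges are
all distinct and extend to a layout. -/
theorem edProd_eq_mono (L : List (Sym2 (Fin n))) (hL : L.Pairwise EdgeDisjoint) :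
    edProd k A N L = 0 ∨ ∃ (m : ℕ) (_ : m + 2 * L.length = n) (φ : Layout m L.length n),
      edProd k A N L = mono k N φ (fun _ => (1 : GradedMonoid A)) (fun _ => 1) := by
  by_cases hd : ∃ e ∈ L, e.IsDiag
  · left
    obtain ⟨e, he, hd⟩ := hd
    obtain ⟨ε, h, -⟩ := edProd_perm_sign (k := k) (A := A) (N := N) (List.perm_cons_erase he)
    rw [h, edProd_cons]
    induction e with | _ a b
    rw [Sym2.mk_isDiag_iff] at hd
    simp [hd]
  right
  push Not at hd
  have hex : ∀ j : Fin L.length, ∃ p : Fin n × Fin n, L[j] = s(p.1, p.2) := fun j => by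
    induction L[j] with | _ a b
    exact ⟨(a, b), rfl⟩
  choose p hp using hex
  have hne : ∀ j, (p j).1 ≠ (p j).2 := fun j h => hd L[j] (List.getElem_mem _) (by
    rw [hp, Sym2.mk_isDiag_iff]; exact h)
  have hdis : ∀ i j : Fin L.length, i ≠ j → EdgeDisjoint L[i] L[j] := by
    intro i j hij
    rcases lt_or_gt_of_ne hij with h | h
    · exact List.pairwise_iff_getElem.1 hL i j i.2 j.2 h
    · exact (List.pairwise_iff_getElem.1 hL j i j.2 i.2 h).symm
  obtain ⟨m, hm, φ, hφ⟩ := exists_layout (Sum.elim (fun j => (p j).1) (fun j => (p j).2)) (by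
    have key : ∀ i j : Fin L.length, ∀ v, v ∈ L[i] → v ∈ L[j] → i = j := by
      intro i j v h1 h2
      by_contra hij
      exact hdis i j hij v h1 h2
    rintro (i | i) (j | j) h
    · simp only [Sum.elim_inl] at h
      rw [key i j (p i).1 (by rw [hp]; simp) (by rw [hp, h]; simp)]
    · simp only [Sum.elim_inl, Sum.elim_inr] at h
      have := key i j (p i).1 (by rw [hp]; simp) (by rw [hp, h]; simp)
      subst this
      exact absurd h (hne _)
    · simp only [Sum.elim_inl, Sum.elim_inr] at h
      have := key i j (p i).2 (by rw [hp]; simp) (by rw [hp, h]; simp)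
      subst this
      exact absurd h.symm (hne _)
    · simp only [Sum.elim_inr] at h
      rw [key i j (p i).2 (by rw [hp]; simp) (by rw [hp, h]; simp)])
  refine ⟨m, hm, φ, ?_⟩
  unfold mono
  simp only [pl_one, mul_one, hφ, Sum.elim_inl, Sum.elim_inr, ← hp]
  rw [List.prod_eq_one (by simp), one_mul, edProd]
  congr 1
  apply List.ext_getElem <;> simp

omit hN in
theorem sum_bideg (w : List (Gen A n)) :
    (w.map Gen.bideg).sum = (((pullsOf w).map fun p => p.2.1).sum, (edgesOf w).length) := by
  induction w with
  | nil => rfl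
  | cons x w ih =>
    rw [List.map_cons, List.sum_cons, ih]
    cases x <;> simp [pullsOf, edgesOf, Gen.bideg, add_comm]

/-- Only monomials whose edges form a matching survive. Such a monomial is a multiple of some
`mono`, and its symmetrization is the sum over all layouts, hence a multiple of the image of a word.
-/
theorem symSum_mem_map_psiLin (hk : (n.factorial : k) ≠ 0) {t r : ℕ} {z : E1 k A N n}
    (hz : z ∈ E1.bihomogeneous k A N n t r) :
    symSum k A N ⊤ z ∈ (Cn.bihomogeneous k N n t r).map (psiLin k A N n) := by
  induction hz using Submodule.span_induction with
  | mem z hz =>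
    obtain ⟨w, hw', rfl⟩ := hz
    change symSum k A N ⊤ (genProd k A N w) ∈ _
    rw [sum_bideg, Prod.mk.injEq] at hw'
    obtain ⟨ht, rfl⟩ := hw'
    by_cases hw : (edgesOf w).Pairwise EdgeDisjoint
    · obtain ⟨c, h⟩ := genProd_eq (k := k) (N := N) w
      obtain ⟨c', h'⟩ := edProd_mul_plProd k N (edgesOf w) (pullsOf w)
      rw [h, h', map_smul, map_smul]
      refine Submodule.smul_mem _ _ (Submodule.smul_mem _ _ ?_)
      rcases edProd_eq_mono k N (A := A) (edgesOf w) hw with h0 | ⟨m, hmr, φ, h0⟩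
      · rw [h0, mul_zero, map_zero]; exact Submodule.zero_mem _
      · obtain ⟨c'', x, y, hd, h''⟩ := plProd_mul_mono k N φ (pullsOf w)
        rw [h0, h'', map_smul, symSum_mono]
        refine Submodule.smul_mem _ _ ⟨(2 : k) ^ (edgesOf w).length • Cn.word k N hmr x y,
          Submodule.smul_mem _ _ (Submodule.subset_span ⟨m, hmr, x, y, hd.trans ht, rfl⟩), ?_⟩
        rw [map_smul, psiLin_word, smul_smul, ← mul_pow]
        -- In characteristic `2` the hypothesis on `n!` forces `n ≤ 1`, hence `r = 0`; then `2⁻¹ ^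
        -- r` is `1` although `2⁻¹` is `0`.
        by_cases hr : (edgesOf w).length = 0
        · have h2 : ((2 : k) * 2⁻¹) ^ (edgesOf w).length = 1 := by rw [hr, pow_zero]
          rw [h2, one_smul]
        have h2 : ((2 : ℕ) : k) ≠ 0 := natCast_ne_zero_of_le hk two_pos (by omega)
        rw [mul_inv_cancel₀ (by exact_mod_cast h2), one_pow, one_smul]
    · rw [symSum_genProd hk w hw]; exact Submodule.zero_mem _
  | zero => simp
  | add x y _ _ hx hy => rw [map_add]; exact Submodule.add_mem _ hx hy
  | smul c x _ hx => rw [map_smul]; exact Submodule.smul_mem _ _ hx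

theorem symSum_of_mem_invariants {z : E1 k A N n} (hz : z ∈ E1.invariants k A N n) :
    symSum k A N ⊤ z = (n.factorial : k) • z := by
  rw [symSum_apply, Finset.sum_congr rfl (fun σ _ => hz σ)]
  simp only [Subgroup.mem_top, Finset.filter_true, Finset.sum_const, Finset.card_univ,
    Fintype.card_perm, Fintype.card_fin]
  rw [← Nat.cast_smul_eq_nsmul k]

theorem mem_map_psiLin (hk : (n.factorial : k) ≠ 0) {t r : ℕ} {z : E1 k A N n}
    (hz : z ∈ E1.invariants k A N n) (hz' : z ∈ E1.bihomogeneous k A N n t r) :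
    z ∈ (Cn.bihomogeneous k N n t r).map (psiLin k A N n) := by
  have := symSum_mem_map_psiLin k N hk hz'
  rw [symSum_of_mem_invariants k N hz] at this
  simpa [smul_smul, inv_mul_cancel₀ hk] using Submodule.smul_mem _ (n.factorial : k)⁻¹ this

/-- An invariant is `1 / n!` times its own symmetrization. -/
theorem range_psiLin (hk : (n.factorial : k) ≠ 0) {z : E1 k A N n}
    (hz : z ∈ E1.invariants k A N n) : ∃ u, psiLin k A N n u = z := by
  have key : ∀ z, symSum k A N ⊤ z ∈ LinearMap.range (psiLin k A N n) := by
    intro z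
    have hz : z ∈ Submodule.span k (Set.range (genProd k A N (n := n))) := by
      rw [span_genProd]; trivial
    induction hz using Submodule.span_induction with
    | mem z hz =>
      obtain ⟨w, rfl⟩ := hz
      exact LinearMap.map_le_range (symSum_mem_map_psiLin k N hk (genProd_mem k N w rfl))
    | zero => simp
    | add x y _ _ hx hy => rw [map_add]; exact Submodule.add_mem _ hx hy
    | smul c x _ hx => rw [map_smul]; exact Submodule.smul_mem _ _ hx
  obtain ⟨u, hu⟩ := key z
  refine ⟨(n.factorial : k)⁻¹ • u, ?_⟩
  rw [map_smul, hu, symSum_of_mem_invariants k N hz, smul_smul, inv_mul_cancel₀ hk, one_smul]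

end Psi

/-! ### The product -/

section Counting

/-- Two bijections that agree on `β` differ by a permutation of `α ⊕ β` which is the identity on
`β`, so by a permutation of `α`. -/
theorem sum_filter_inr_eq {α β γ V : Type*} [Fintype α] [Fintype β] [Fintype γ] [DecidableEq α]
    [DecidableEq β] [DecidableEq γ] [AddCommMonoid V] (φ₀ : α ⊕ β ≃ γ) (F : (α ⊕ β ≃ γ) → V) :
    ∑ φ ∈ Finset.univ.filter (fun φ : α ⊕ β ≃ γ => ∀ x, φ (.inr x) = φ₀ (.inr x)), F φ =
      ∑ σ : Equiv.Perm α, F ((Equiv.sumCongr σ (Equiv.refl β)).trans φ₀) := by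
  symm
  refine Finset.sum_bij (fun σ _ => (Equiv.sumCongr σ (Equiv.refl β)).trans φ₀) ?_ ?_ ?_ ?_
  · intro σ _
    simp
  · intro σ _ τ _ h
    ext a
    have := Equiv.congr_fun h (.inl a)
    simpa using this
  · intro φ hφ
    simp only [Finset.mem_filter, Finset.mem_univ, true_and] at hφ
    have hr : ∀ x, (φ.trans φ₀.symm) (.inr x) = .inr x := fun x => by simp [hφ]
    have h : (φ.trans φ₀.symm) ∈ (Equiv.Perm.sumCongrHom α β).range := by
      apply Equiv.Perm.mem_sumCongrHom_range_of_perm_mapsTo_inl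
      rintro _ ⟨a, rfl⟩
      rcases h : (φ.trans φ₀.symm) (.inl a) with b | b
      · exact ⟨b, rfl⟩
      · rw [← hr b] at h
        simpa using (φ.trans φ₀.symm).injective h
    obtain ⟨⟨σ, τ⟩, h⟩ := h
    refine ⟨σ, Finset.mem_univ _, ?_⟩
    ext x
    have h' := Equiv.congr_fun h x
    rcases x with x | x
    · simp only [Equiv.Perm.sumCongrHom_apply, Equiv.Perm.sumCongr_apply, Sum.map_inl,
        Equiv.trans_apply] at h'
      simp [h']
    · simp [hφ]
  · intro σ _
    rfl

theorem card_filter_inr_eq {α β γ : Type*} [Fintype α] [Fintype β] [Fintype γ] [DecidableEq α]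
    [DecidableEq β] [DecidableEq γ] (φ₀ : α ⊕ β ≃ γ) :
    (Finset.univ.filter (fun φ : α ⊕ β ≃ γ => ∀ x, φ (.inr x) = φ₀ (.inr x))).card =
      (Fintype.card α).factorial := by
  rw [Finset.card_eq_sum_ones, sum_filter_inr_eq φ₀ (fun _ => 1)]
  simp [Fintype.card_perm]

/-- The positions of a word of length `l + 2 q`: the first `l`, and the pairs of neighbours among the
others. -/
def splitEquiv (l q : ℕ) : Fin l ⊕ (Fin q ⊕ Fin q) ≃ Fin (l + 2 * q) :=
  Equiv.ofBijective (Sum.elim (Fin.castAdd _) (Sum.elim evenPos oddPos)) <| by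
    rw [Fintype.bijective_iff_injective_and_card]
    refine ⟨?_, by simp; omega⟩
    rintro (i | i | i) (j | j | j) h <;>
      simp only [Sum.elim_inl, Sum.elim_inr, Fin.ext_iff, Fin.val_castAdd, evenPos, oddPos] at h <;>
      first
        | (exfalso; omega)
        | (congr 2; apply Fin.ext; omega)
        | (congr 1; apply Fin.ext; omega)

@[simp] theorem splitEquiv_symm_castAdd {l q : ℕ} (i : Fin l) :
    (splitEquiv l q).symm (Fin.castAdd _ i) = .inl i := by
  rw [Equiv.symm_apply_eq]; rfl

@[simp] theorem splitEquiv_symm_evenPos {l q : ℕ} (j : Fin q) :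
    (splitEquiv l q).symm (evenPos j) = .inr (.inl j) := by
  rw [Equiv.symm_apply_eq]; rfl

@[simp] theorem splitEquiv_symm_oddPos {l q : ℕ} (j : Fin q) :
    (splitEquiv l q).symm (oddPos j) = .inr (.inr j) := by
  rw [Equiv.symm_apply_eq]; rfl

variable {l q r n : ℕ}

/-- The layout which breaks up the first `q` pairs of a layout. -/
def breakFirst (ψ : Layout l (q + r) n) : Layout (l + 2 * q) r n :=
  (Equiv.sumCongr (splitEquiv l q).symm (Equiv.refl _)).trans <| (Equiv.sumAssoc _ _ _).trans <|
    (Equiv.sumCongr (Equiv.refl _) ((Equiv.sumSumSumComm _ _ _ _).trans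
      (Equiv.sumCongr finSumFinEquiv finSumFinEquiv))).trans ψ

/-- The layout which breaks up the last `r` pairs of a layout. -/
def breakLast (ψ : Layout l (q + r) n) : Layout (l + 2 * r) q n :=
  (Equiv.sumCongr (splitEquiv l r).symm (Equiv.refl _)).trans <| (Equiv.sumAssoc _ _ _).trans <|
    (Equiv.sumCongr (Equiv.refl _) ((Equiv.sumComm _ _).trans ((Equiv.sumSumSumComm _ _ _ _).trans
      (Equiv.sumCongr finSumFinEquiv finSumFinEquiv)))).trans ψ

section
variable (ψ : Layout l (q + r) n)

@[simp] theorem breakFirst_castAdd (i : Fin l) :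
    breakFirst ψ (.inl (Fin.castAdd _ i)) = ψ (.inl i) := by simp [breakFirst]

@[simp] theorem breakFirst_evenPos (j : Fin q) :
    breakFirst ψ (.inl (evenPos j)) = ψ (.inr (.inl (Fin.castAdd r j))) := by simp [breakFirst]

@[simp] theorem breakFirst_oddPos (j : Fin q) :
    breakFirst ψ (.inl (oddPos j)) = ψ (.inr (.inr (Fin.castAdd r j))) := by simp [breakFirst]

@[simp] theorem breakFirst_inr_inl (j : Fin r) :
    breakFirst ψ (.inr (.inl j)) = ψ (.inr (.inl (Fin.natAdd q j))) := by simp [breakFirst]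

@[simp] theorem breakFirst_inr_inr (j : Fin r) :
    breakFirst ψ (.inr (.inr j)) = ψ (.inr (.inr (Fin.natAdd q j))) := by simp [breakFirst]

@[simp] theorem breakLast_castAdd (i : Fin l) :
    breakLast ψ (.inl (Fin.castAdd _ i)) = ψ (.inl i) := by simp [breakLast]

@[simp] theorem breakLast_evenPos (j : Fin r) :
    breakLast ψ (.inl (evenPos j)) = ψ (.inr (.inl (Fin.natAdd q j))) := by simp [breakLast]

@[simp] theorem breakLast_oddPos (j : Fin r) :
    breakLast ψ (.inl (oddPos j)) = ψ (.inr (.inr (Fin.natAdd q j))) := by simp [breakLast]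

@[simp] theorem breakLast_inr_inl (j : Fin q) :
    breakLast ψ (.inr (.inl j)) = ψ (.inr (.inl (Fin.castAdd r j))) := by simp [breakLast]

@[simp] theorem breakLast_inr_inr (j : Fin q) :
    breakLast ψ (.inr (.inr j)) = ψ (.inr (.inr (Fin.castAdd r j))) := by simp [breakLast]

end

/-- The end points of the pairs of two layouts, those of the second layout first. -/
def pairEnds {m m' : ℕ} (φ : Layout m r n) (φ' : Layout m' q n) : Fin (q + r) ⊕ Fin (q + r) → Fin n :=
  Sum.elim (Fin.append (fun j => φ' (.inr (.inl j))) (fun j => φ (.inr (.inl j))))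
    (Fin.append (fun j => φ' (.inr (.inr j))) (fun j => φ (.inr (.inr j))))

/-- The layout `ψ` of the product carries the pairs of both factors, those of the second factor
first, in agreement with the order `β ∧ γ` in the product formula. Each factor regards the pairs of
the other as single points. -/
theorem inr_eq_pairEnds_iff (ψ : Layout l (q + r) n) {φ : Layout (l + 2 * q) r n}
    {φ' : Layout (l + 2 * r) q n} : (∀ x, ψ (.inr x) = pairEnds φ φ' x) ↔
      (∀ x, φ (.inr x) = breakFirst ψ (.inr x)) ∧ ∀ x, φ' (.inr x) = breakLast ψ (.inr x) := by
  simp only [Sum.forall, Fin.forall_fin_add, pairEnds, Sum.elim_inl, Sum.elim_inr, Fin.append_left,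
    Fin.append_right, breakFirst_inr_inl, breakFirst_inr_inr, breakLast_inr_inl, breakLast_inr_inr,
    eq_comm]
  tauto

/-- Two layouts with disjoint pairs arise from a layout and two permutations, in `l!` ways. -/
theorem sum_layout_layout {V : Type*} [AddCommGroup V] (h : l + 2 * (q + r) = n)
    (F : Layout (l + 2 * q) r n → Layout (l + 2 * r) q n → V) :
    ∑ ψ : Layout l (q + r) n, ∑ σ : Equiv.Perm (Fin (l + 2 * q)), ∑ τ : Equiv.Perm (Fin (l + 2 * r)),
      F ((Equiv.sumCongr σ (Equiv.refl _)).trans (breakFirst ψ))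
        ((Equiv.sumCongr τ (Equiv.refl _)).trans (breakLast ψ)) =
    l.factorial • ∑ p : Layout (l + 2 * q) r n × Layout (l + 2 * r) q n with
      Function.Injective (pairEnds p.1 p.2), F p.1 p.2 := by
  classical
  have h1 : ∀ ψ : Layout l (q + r) n, ∑ σ : Equiv.Perm (Fin (l + 2 * q)),
      ∑ τ : Equiv.Perm (Fin (l + 2 * r)),
      F ((Equiv.sumCongr σ (Equiv.refl _)).trans (breakFirst ψ))
        ((Equiv.sumCongr τ (Equiv.refl _)).trans (breakLast ψ)) =
      ∑ p : Layout (l + 2 * q) r n × Layout (l + 2 * r) q n,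
        if (∀ x, ψ (.inr x) = pairEnds p.1 p.2 x) then F p.1 p.2 else 0 := by
    intro ψ
    simp only [← sum_filter_inr_eq (breakLast ψ) (F _)]
    rw [← sum_filter_inr_eq (breakFirst ψ) (fun φ => ∑ φ' ∈ Finset.univ.filter
      (fun φ' : Layout (l + 2 * r) q n => ∀ x, φ' (.inr x) = breakLast ψ (.inr x)), F φ φ')]
    rw [← Finset.sum_product', Finset.sum_ite, Finset.sum_const_zero, add_zero]
    refine Finset.sum_congr ?_ fun _ _ => rfl
    ext p
    simp only [Finset.mem_product, Finset.mem_filter, Finset.mem_univ, true_and, inr_eq_pairEnds_iff]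
  -- For fixed `ψ`, the permutations `σ`, `τ` enumerate the layouts of the two factors with the
  -- pairs prescribed by `ψ`. After exchanging the sums, a pair of layouts is counted once for every
  -- `ψ` with the given pairs: `l!` times if their end points are distinct, and never otherwise.
  rw [Finset.sum_congr rfl fun ψ _ => h1 ψ, Finset.sum_comm, Finset.sum_filter, Finset.smul_sum]
  refine Finset.sum_congr rfl fun p _ => ?_
  rw [Finset.sum_ite, Finset.sum_const_zero, add_zero, Finset.sum_const]
  by_cases hp : Function.Injective (pairEnds p.1 p.2)
  · rw [if_pos hp]
    obtain ⟨m, hm, ψ₀, hψ⟩ := exists_layout _ hp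
    obtain rfl : m = l := by omega
    congr 1
    simp only [← hψ]
    rw [card_filter_inr_eq, Fintype.card_fin]
  · rw [if_neg hp, smul_zero, Finset.card_eq_zero.2, zero_smul]
    rw [Finset.filter_eq_empty_iff]
    intro ψ _ hψ
    apply hp
    rw [← funext hψ]
    exact ψ.injective.comp Sum.inr_injective

end Counting

/-! ### The product of two sums of monomials -/

section Product

variable (k : Type v) [Field k] {A : ℕ → Type w} [∀ p, AddCommGroup (A p)]
  [∀ p, Module k (A p)] [GradedMonoid.GMul A] [GradedMonoid.GOne A] (N : ℕ) {n : ℕ}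

theorem pairEnds_injective {m m' r q : ℕ} {φ : Layout m r n} {φ' : Layout m' q n}
    (h : ∀ x y, φ (.inr x) ≠ φ' (.inr y)) : Function.Injective (pairEnds φ φ') := by
  rw [← Equiv.injective_comp ((Equiv.sumSumSumComm _ _ _ _).trans
      (Equiv.sumCongr finSumFinEquiv finSumFinEquiv))]
  have e : pairEnds φ φ' ∘ ((Equiv.sumSumSumComm _ _ _ _).trans
      (Equiv.sumCongr finSumFinEquiv finSumFinEquiv)) =
      Sum.elim (fun x => φ' (.inr x)) (fun x => φ (.inr x)) := by
    funext x
    rcases x with (x | x) | (x | x) <;> simp [pairEnds]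
  rw [e]
  exact (φ'.injective.comp Sum.inr_injective).sumElim (φ.injective.comp Sum.inr_injective)
    fun a b => (h b a).symm

theorem edgesOf_append (w w' : List (Gen A n)) : edgesOf (w ++ w') = edgesOf w ++ edgesOf w' := by
  simp [edgesOf]

theorem edgesOf_monoWord {m r : ℕ} (φ : Layout m r n) (x : Fin m → GradedMonoid A)
    (y : Fin r → GradedMonoid A) : edgesOf (monoWord φ x y) =
      (List.finRange r).map fun j => s(φ (.inr (.inl j)), φ (.inr (.inr j))) := by
  have h1 : ∀ l : List (Fin m),
      edgesOf (l.map fun i => (Gen.pull (φ (.inl i)) (x i) : Gen A n)) = [] := by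
    intro l
    induction l with
    | nil => rfl
    | cons a l ih => simpa [edgesOf] using ih
  have h2 : ∀ l : List (Fin r), edgesOf (l.flatMap fun j => ([.edge (φ (.inr (.inl j)))
      (φ (.inr (.inr j))) (layout_ne φ j), .pull (φ (.inr (.inl j))) (y j)] : List (Gen A n))) =
      l.map fun j => s(φ (.inr (.inl j)), φ (.inr (.inr j))) := by
    intro l
    induction l with
    | nil => rfl
    | cons a l ih =>
      rw [List.flatMap_cons, edgesOf_append, ih]
      simp [edgesOf]
  rw [monoWord, edgesOf_append, h1, h2, List.nil_append]

theorem pairEnds_injective_of_pairwise {m m' r q : ℕ} {φ : Layout m r n} {φ' : Layout m' q n}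
    {x : Fin m → GradedMonoid A} {y : Fin r → GradedMonoid A} {z : Fin m' → GradedMonoid A}
    {t : Fin q → GradedMonoid A}
    (h : (edgesOf (monoWord φ x y ++ monoWord φ' z t)).Pairwise EdgeDisjoint) :
    Function.Injective (pairEnds φ φ') := by
  rw [edgesOf_append, List.pairwise_append, edgesOf_monoWord, edgesOf_monoWord] at h
  have h' := h.2.2
  apply pairEnds_injective
  have key : ∀ (i : Fin r) (j : Fin q) (v), v ∈ s(φ (.inr (.inl i)), φ (.inr (.inr i))) →
      v ∉ s(φ' (.inr (.inl j)), φ' (.inr (.inr j))) := fun i j =>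
    h' _ (List.mem_map.2 ⟨i, List.mem_finRange i, rfl⟩) _ (List.mem_map.2 ⟨j, List.mem_finRange j, rfl⟩)
  rintro (i | i) (j | j) e
  · exact key i j _ (Sym2.mem_mk_left _ _) (by rw [e]; exact Sym2.mem_mk_left _ _)
  · exact key i j _ (Sym2.mem_mk_left _ _) (by rw [e]; exact Sym2.mem_mk_right _ _)
  · exact key i j _ (Sym2.mem_mk_right _ _) (by rw [e]; exact Sym2.mem_mk_left _ _)
  · exact key i j _ (Sym2.mem_mk_right _ _) (by rw [e]; exact Sym2.mem_mk_right _ _)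

variable [hN : Fact (Even N)]

-- The condition on the pairs is invariant under `Σ_n`, so the sum is invariant, and `n!` times it
-- is its symmetrization. That vanishes term by term by `symSum_genProd`, as the edges do not form a
-- matching.
open Classical in
theorem sum_mono_mul_mono_eq_zero (hk : (n.factorial : k) ≠ 0) {m m' r q : ℕ}
    (x : Fin m → GradedMonoid A) (y : Fin r → GradedMonoid A) (z : Fin m' → GradedMonoid A)
    (t : Fin q → GradedMonoid A) :
    ∑ p : Layout m r n × Layout m' q n with ¬ Function.Injective (pairEnds p.1 p.2),
      mono k N p.1 x y * mono k N p.2 z t = 0 := by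
  set s : E1 k A N n := ∑ p : Layout m r n × Layout m' q n with
    ¬ Function.Injective (pairEnds p.1 p.2), mono k N p.1 x y * mono k N p.2 z t with hs
  have hinv : ∀ σ, E1.perm k A N n σ s = s := by
    intro σ
    rw [hs, map_sum]
    simp only [map_mul, perm_mono]
    have e : ∀ (σ : Equiv.Perm (Fin n)) (φ : Layout m r n) (φ' : Layout m' q n),
        pairEnds (φ.trans σ) (φ'.trans σ) = σ ∘ pairEnds φ φ' := by
      intro σ φ φ'
      funext a
      rcases a with a | a <;> induction a using Fin.addCases <;> simp [pairEnds]
    refine Finset.sum_bij' (fun p _ => (p.1.trans σ, p.2.trans σ))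
      (fun p _ => (p.1.trans σ⁻¹, p.2.trans σ⁻¹)) ?_ ?_ ?_ ?_ ?_
    · intro p hp
      simpa [e, Equiv.comp_injective] using hp
    · intro p hp
      simpa [e, Equiv.comp_injective] using hp
    · intro p _
      ext <;> simp
    · intro p _
      ext <;> simp
    · intro p _
      rfl
  have h0 : symSum k A N ⊤ s = 0 := by
    rw [hs, map_sum]
    refine Finset.sum_eq_zero fun p hp => ?_
    rw [mono_eq_genProd, mono_eq_genProd, ← genProd_append]
    apply symSum_genProd hk
    intro h
    exact (Finset.mem_filter.1 hp).2 (pairEnds_injective_of_pairwise h)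
  rw [symSum_apply, Finset.sum_congr rfl (fun σ _ => hinv σ)] at h0
  simp only [Subgroup.mem_top, Finset.filter_true, Finset.sum_const, Finset.card_univ,
    Fintype.card_perm, Fintype.card_fin] at h0
  rw [← Nat.cast_smul_eq_nsmul k] at h0
  exact (smul_eq_zero.1 h0).resolve_left hk

open Classical in
theorem monoSum_mul_monoSum (hk : (n.factorial : k) ≠ 0) {m m' r q : ℕ}
    (x : Fin m → GradedMonoid A) (y : Fin r → GradedMonoid A) (z : Fin m' → GradedMonoid A)
    (t : Fin q → GradedMonoid A) : monoSum k N n x y * monoSum k N n z t =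
    ∑ p : Layout m r n × Layout m' q n with Function.Injective (pairEnds p.1 p.2),
      mono k N p.1 x y * mono k N p.2 z t := by
  rw [monoSum, monoSum, Finset.sum_mul_sum, ← Finset.sum_product', Finset.univ_product_univ,
    ← Finset.sum_filter_add_sum_filter_not _ (fun p : Layout m r n × Layout m' q n =>
      Function.Injective (pairEnds p.1 p.2)), sum_mono_mul_mono_eq_zero k N hk, add_zero]

/-- `2 q + 2 r` distinct end points do not fit into `n` points. -/
theorem monoSum_mul_monoSum_eq_zero (hk : (n.factorial : k) ≠ 0) {m m' r q : ℕ}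
    (h : n < 2 * q + 2 * r)
    (x : Fin m → GradedMonoid A) (y : Fin r → GradedMonoid A) (z : Fin m' → GradedMonoid A)
    (t : Fin q → GradedMonoid A) : monoSum k N n x y * monoSum k N n z t = 0 := by
  classical
  rw [monoSum_mul_monoSum k N hk, Finset.filter_false_of_mem, Finset.sum_empty]
  intro p _ hp
  have := Fintype.card_le_of_injective _ hp
  simp at this
  omega

/-- This evaluates one factor of `β` or `γ`. The letter `b` slides along the edge from `v` to `u`;
the sign for moving `p_u^*(a)` across the edge occurs twice. -/
theorem ed_mul_pl_pl_pl (u v : Fin n) (a b c : GradedMonoid A) :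
    ed k A N s(u, v) * (pl k N u a * (pl k N v b * pl k N u c)) =
      ed k A N s(u, v) * pl k N u (a * b * c) := by
  rw [pl_mul, pl_mul, ← mul_assoc, ed_pl, smul_mul_assoc, mul_assoc, ← mul_assoc (ed k A N _),
    ← ed_pl_slide, mul_assoc, ← mul_assoc (pl k N u a), ← smul_mul_assoc, ← ed_pl]
  simp only [mul_assoc]

omit hN in
theorem prod_finRange_add {M : Type*} [Monoid M] {q r : ℕ} (f : Fin (q + r) → M) :
    ((List.finRange (q + r)).map f).prod = ((List.finRange q).map fun i => f (Fin.castAdd r i)).prod *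
      ((List.finRange r).map fun i => f (Fin.natAdd q i)).prod := by
  rw [← List.ofFn_eq_map, List.ofFn_add, List.prod_append, List.ofFn_eq_map, List.ofFn_eq_map]
  rfl

section Letters

variable {l r q : ℕ} (x : Fin (l + 2 * q) → GradedMonoid A) (y : Fin r → GradedMonoid A)
  (z : Fin (l + 2 * r) → GradedMonoid A) (t : Fin q → GradedMonoid A)

variable {x y z t} in
/-- The generators in the product of two monomials, as a function of the letters. -/
def letterGen (x : Fin (l + 2 * q) → GradedMonoid A) (y : Fin r → GradedMonoid A)
    (z : Fin (l + 2 * r) → GradedMonoid A) (t : Fin q → GradedMonoid A)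
    (φ : Layout (l + 2 * q) r n) (φ' : Layout (l + 2 * r) q n) :
    Letter (l + 2 * q) r (l + 2 * r) q → Gen A n
  | .x i => .pull (φ (.inl i)) (x i)
  | .sy j => .edge (φ (.inr (.inl j))) (φ (.inr (.inr j))) (layout_ne φ j)
  | .y j => .pull (φ (.inr (.inl j))) (y j)
  | .z i => .pull (φ' (.inl i)) (z i)
  | .st j => .edge (φ' (.inr (.inl j))) (φ' (.inr (.inr j))) (layout_ne φ' j)
  | .t j => .pull (φ' (.inr (.inl j))) (t j)

omit hN in
theorem sourceWord_nodup (a r b q : ℕ) : (sourceWord a r b q).Nodup := by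
  have hx : ((List.finRange a).map (Letter.x : _ → Letter a r b q)).Nodup :=
    (List.nodup_finRange a).map fun _ _ h => by simpa using h
  have hz : ((List.finRange b).map (Letter.z : _ → Letter a r b q)).Nodup :=
    (List.nodup_finRange b).map fun _ _ h => by simpa using h
  have hy : ((List.finRange r).flatMap
      (fun j => [Letter.sy j, (Letter.y j : Letter a r b q)])).Nodup := by
    rw [List.nodup_flatMap]
    refine ⟨fun i _ => by simp, (List.nodup_finRange r).imp fun h => ?_⟩
    simp [List.Disjoint, Function.onFun, h]
  have ht : ((List.finRange q).flatMap
      (fun j => [Letter.st j, (Letter.t j : Letter a r b q)])).Nodup := by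
    rw [List.nodup_flatMap]
    refine ⟨fun i _ => by simp, (List.nodup_finRange q).imp fun h => ?_⟩
    simp [List.Disjoint, Function.onFun, h]
  unfold sourceWord
  refine ((hx.append hy ?_).append hz ?_).append ht ?_ <;>
  · intro c h1 h2
    cases c <;> simp at h1 h2

omit hN in
theorem sourceWord_perm (σ : Equiv.Perm (Fin (l + 2 * q))) (τ : Equiv.Perm (Fin (l + 2 * r))) :
    (sourceWord (l + 2 * q) r (l + 2 * r) q).Perm (targetWord σ τ) := by
  refine (List.subperm_of_subset (sourceWord_nodup _ _ _ _) ?_).perm_of_length_le ?_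
  · intro c _
    have hpos : ∀ (q : ℕ) (σ : Equiv.Perm (Fin (l + 2 * q))) (i : Fin (l + 2 * q)),
        (∃ j : Fin l, i = σ (Fin.castAdd _ j)) ∨ (∃ j : Fin q, i = σ (evenPos j)) ∨
          (∃ j : Fin q, i = σ (oddPos j)) := by
      intro q σ i
      obtain ⟨a, ha⟩ := (splitEquiv l q).surjective (σ⁻¹ i)
      rw [Equiv.Perm.eq_inv_iff_eq] at ha
      rcases a with a | a | a
      · exact Or.inl ⟨a, ha.symm⟩
      · exact Or.inr (Or.inl ⟨a, ha.symm⟩)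
      · exact Or.inr (Or.inr ⟨a, ha.symm⟩)
    unfold targetWord
    cases c with
    | x i =>
      rcases hpos q σ i with ⟨j, rfl⟩ | ⟨j, rfl⟩ | ⟨j, rfl⟩
      · simp
      · simpa using Or.inr ⟨j, Or.inl rfl⟩
      · simpa using Or.inr ⟨j, Or.inr rfl⟩
    | z i =>
      rcases hpos r τ i with ⟨j, rfl⟩ | ⟨j, rfl⟩ | ⟨j, rfl⟩
      · simp
      · simpa using Or.inr ⟨j, Or.inl rfl⟩
      · simpa using Or.inr ⟨j, Or.inr rfl⟩
    | _ => simp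
  · simp [targetWord, sourceWord, List.length_flatMap]
    omega

/-- Both sides are values of one function on words in the letters, at the source word and at the
target word. It obeys the Koszul rule for neighbours, so `koszul_eval` supplies the sign. The
inverses place the letter `x_{σ i}` on the point `breakFirst ψ (inl i)`, where it meets its
partners. -/
theorem mono_mul_mono (σ : Equiv.Perm (Fin (l + 2 * q))) (τ : Equiv.Perm (Fin (l + 2 * r)))
    (ψ : Layout l (q + r) n) :
    mono k N ((Equiv.sumCongr σ⁻¹ (Equiv.refl _)).trans (breakFirst ψ)) x y *
      mono k N ((Equiv.sumCongr τ⁻¹ (Equiv.refl _)).trans (breakLast ψ)) z t =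
    (((koszul (Letter.deg N x y z t) (sourceWord _ _ _ _) (targetWord σ τ) : ℤˣ) : ℤ) : k) •
      mono k N ψ (fun i => x (σ (Fin.castAdd _ i)) * z (τ (Fin.castAdd _ i)))
        (Fin.append (fun j => x (σ (evenPos j)) * x (σ (oddPos j)) * t j)
          (fun j => z (τ (evenPos j)) * z (τ (oddPos j)) * y j)) := by
  set φ := (Equiv.sumCongr σ⁻¹ (Equiv.refl _)).trans (breakFirst ψ) with hφ
  set φ' := (Equiv.sumCongr τ⁻¹ (Equiv.refl _)).trans (breakLast ψ) with hφ'
  have hsrc : mono k N φ x y * mono k N φ' z t =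
      genProd k A N ((sourceWord _ _ _ _).map (letterGen x y z t φ φ')) := by
    rw [mono_eq_genProd, mono_eq_genProd, ← genProd_append]
    simp [monoWord, sourceWord, List.map_flatMap, letterGen, Function.comp_def]
  have key := koszul_eval (k := k) (Letter.deg N x y z t)
    (fun w => genProd k A N (w.map (letterGen x y z t φ φ'))) (fun u a b v => by
      simp only [List.map_append, List.map_cons, genProd_append, genProd_cons]
      rw [← mul_assoc (E1.gen k A N n _), gen_comm, smul_mul_assoc, mul_smul_comm, mul_assoc]
      congr 2
      cases a <;> cases b <;> rfl)
    (sourceWord_perm σ τ) (sourceWord_nodup _ _ _ _)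
  rw [hsrc, key]
  congr 1
  have h1 : ∀ i, φ (.inl (σ i)) = breakFirst ψ (.inl i) := fun i => by simp [hφ]
  have h2 : ∀ i, φ' (.inl (τ i)) = breakLast ψ (.inl i) := fun i => by simp [hφ']
  have h3 : ∀ j, φ (.inr j) = breakFirst ψ (.inr j) := fun i => by simp [hφ]
  have h4 : ∀ j, φ' (.inr j) = breakLast ψ (.inr j) := fun i => by simp [hφ']
  have hpl : ∀ (i : Fin n) (a : GradedMonoid A), E1.gen k A N n (.pull i a) = pl k N i a :=
    fun _ _ => rfl
  unfold mono targetWord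
  rw [prod_finRange_add]
  simp only [List.map_append, genProd_append, List.map_flatMap, genProd, prod_flatMap,
    mul_assoc, List.map_cons, List.map_nil, List.prod_cons, List.prod_nil, mul_one, letterGen, h1, h2,
    h3, h4, Fin.append_left, Fin.append_right, breakFirst_castAdd, breakLast_castAdd,
    breakFirst_evenPos, breakFirst_oddPos, breakLast_evenPos, breakLast_oddPos, breakFirst_inr_inl,
    breakFirst_inr_inr, breakLast_inr_inl, breakLast_inr_inr, ← ed_mk, hpl, ed_mul_pl_pl_pl, pl_mul, List.prod_append]

/-- The product formula. -/
theorem psiLin_word_mul (hk : (n.factorial : k) ≠ 0) (h : l + 2 * (q + r) = n) :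
    psiLin k A N n (Cn.word k N (by omega) x y) * psiLin k A N n (Cn.word k N (by omega) z t) =
    psiLin k A N n (((l.factorial : ℕ) : k)⁻¹ • ∑ σ : Equiv.Perm (Fin (l + 2 * q)),
        ∑ τ : Equiv.Perm (Fin (l + 2 * r)),
          (((koszul (Letter.deg N x y z t) (sourceWord _ _ _ _) (targetWord σ τ) : ℤˣ) : ℤ) : k) •
            Cn.word k N h
              (fun i => x (σ (Fin.castAdd _ i)) * z (τ (Fin.castAdd _ i)))
              (Fin.append (fun j => x (σ (evenPos j)) * x (σ (oddPos j)) * t j)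
                (fun j => z (τ (evenPos j)) * z (τ (oddPos j)) * y j))) := by
  classical
  have hl : (l.factorial : k) ≠ 0 :=
    fun h0 => hk <| by
    obtain ⟨c, hc⟩ := Nat.factorial_dvd_factorial (show l ≤ n by omega)
    rw [hc, Nat.cast_mul, h0, zero_mul]
  simp only [map_smul, map_sum, psiLin_word, smul_mul_assoc, mul_smul_comm]
  rw [monoSum_mul_monoSum k N hk]
  have key := sum_layout_layout h (fun φ φ' => mono k N φ x y * mono k N φ' z t)
  -- The sums over `σ` and `τ` are reindexed by inverses, to fit `mono_mul_mono`.
  have e : ∀ ψ : Layout l (q + r) n, ∑ σ : Equiv.Perm (Fin (l + 2 * q)),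
      ∑ τ : Equiv.Perm (Fin (l + 2 * r)),
        mono k N ((Equiv.sumCongr σ (Equiv.refl _)).trans (breakFirst ψ)) x y *
          mono k N ((Equiv.sumCongr τ (Equiv.refl _)).trans (breakLast ψ)) z t =
      ∑ σ : Equiv.Perm (Fin (l + 2 * q)), ∑ τ : Equiv.Perm (Fin (l + 2 * r)),
        mono k N ((Equiv.sumCongr σ⁻¹ (Equiv.refl _)).trans (breakFirst ψ)) x y *
          mono k N ((Equiv.sumCongr τ⁻¹ (Equiv.refl _)).trans (breakLast ψ)) z t := by
    intro ψ
    rw [← Equiv.sum_comp (Equiv.inv _)]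
    refine Finset.sum_congr rfl fun σ _ => ?_
    rw [← Equiv.sum_comp (Equiv.inv _)]
    rfl
  simp only [e, mono_mul_mono] at key
  rw [← Nat.cast_smul_eq_nsmul k, ← inv_smul_eq_iff₀ hl] at key
  rw [← key, Finset.sum_comm]
  simp only [Finset.smul_sum, monoSum, smul_smul]
  refine Finset.sum_congr rfl fun σ _ => ?_
  rw [Finset.sum_comm]
  refine Finset.sum_congr rfl fun τ _ => Finset.sum_congr rfl fun ψ _ => ?_
  congr 1
  ring

end Letters

end Product

/-! ### A representation of `E₁` -/

section Slots

variable (k : Type v) [Field k] (A : ℕ → Type w) [∀ p, AddCommGroup (A p)]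
  [∀ p, Module k (A p)]

theorem totalSpace_ext {A : ℕ → Type w} [∀ p, AddCommGroup (A p)] [∀ p, Module k (A p)]
    {V : Type*} [AddCommGroup V] [Module k V] {f g : DirectSum ℕ A →ₗ[k] V}
    (h : ∀ a : GradedMonoid A, f (homog a) = g (homog a)) : f = g :=
  DirectSum.linearMap_ext _ fun p => LinearMap.ext fun a => h ⟨p, a⟩

/-- The sign operator `a ↦ (-1)^{d |a|} a`. -/
def par (d : ℤ) : DirectSum ℕ A →ₗ[k] DirectSum ℕ A :=
  DirectSum.toModule k ℕ _ fun p => sgn k (d * p) • DirectSum.lof k ℕ A p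

variable {A}

@[simp] theorem par_homog (d : ℤ) (a : GradedMonoid A) :
    par k A d (homog a) = sgn k (d * a.1) • homog a := by
  unfold par homog
  exact DirectSum.toModule_lof k a.1 a.2

section
variable [GradedMonoid.GMul A] [GradedComm k A]

/-- Left multiplication on the total space. -/
def leftMul (a : GradedMonoid A) : DirectSum ℕ A →ₗ[k] DirectSum ℕ A :=
  DirectSum.toModule k ℕ _ fun p => (DirectSum.lof k ℕ A (a.1 + p)).comp
    ({ toFun := fun b => GradedMonoid.GMul.mul a.2 b
       map_add' := GradedComm.mul_add k a.2
       map_smul' := fun c b => GradedComm.mul_smul c a.2 b } : A p →ₗ[k] A (a.1 + p))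

@[simp] theorem leftMul_homog (a b : GradedMonoid A) :
    leftMul k a (homog b) = homog (a * b) := by
  unfold leftMul homog
  exact DirectSum.toModule_lof k b.1 b.2

end

variable (A) in
/-- The slot `A ⊕ ε A`. -/
abbrev Slot : Type _ := DirectSum ℕ A × DirectSum ℕ A

theorem slot_ext {V : Type*} [AddCommGroup V] [Module k V] {f g : Slot A →ₗ[k] V}
    (h : ∀ a : GradedMonoid A, f (homog a, 0) = g (homog a, 0))
    (h' : ∀ a : GradedMonoid A, f (0, homog a) = g (0, homog a)) : f = g :=
  LinearMap.prod_ext (totalSpace_ext k h) (totalSpace_ext k h')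

variable (A) in
/-- The sign operator of a slot, `ε` being odd. -/
def parSlot (d : ℤ) : Module.End k (Slot A) := (par k A d).prodMap (sgn k d • par k A d)

variable (A) in
/-- Multiplication by `ε`. -/
def epsSlot : Module.End k (Slot A) := LinearMap.prod 0 (LinearMap.fst k _ _)

theorem parSlot_add (d e : ℤ) : parSlot k A (d + e) = parSlot k A d * parSlot k A e := by
  apply slot_ext <;> intro a <;> simp [parSlot, smul_smul, add_mul, sgn_add] <;> congr 1 <;> ring

theorem parSlot_zero : parSlot k A 0 = 1 := by
  apply slot_ext <;> intro a <;> simp [parSlot]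

theorem parSlot_mul_comm (d e : ℤ) :
    parSlot k A d * parSlot k A e = parSlot k A e * parSlot k A d := by
  rw [← parSlot_add, ← parSlot_add, add_comm]

theorem parSlot_epsSlot (d : ℤ) :
    parSlot k A d * epsSlot k A = sgn k d • (epsSlot k A * parSlot k A d) := by
  apply slot_ext <;> intro a <;> simp [parSlot, epsSlot]

theorem epsSlot_sq : epsSlot k A * epsSlot k A = 0 := by
  apply slot_ext <;> intro a <;> simp [epsSlot]

section
variable [GradedMonoid.GMul A] [GradedComm k A]

/-- Multiplication by an element of `A` on a slot. -/
def pullSlot (a : GradedMonoid A) : Module.End k (Slot A) :=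
  (leftMul k a).prodMap (sgn k a.1 • leftMul k a)

theorem parSlot_pullSlot (d : ℤ) (a : GradedMonoid A) :
    parSlot k A d * pullSlot k a = sgn k (d * a.1) • (pullSlot k a * parSlot k A d) := by
  have h : ∀ b : GradedMonoid A, (((a * b).1 : ℕ) : ℤ) = a.1 + b.1 := fun b => by
    change (((a.1 + b.1 : ℕ)) : ℤ) = _
    push_cast; rfl
  apply slot_ext <;> intro b <;>
    simp [parSlot, pullSlot, h, smul_smul, mul_add, sgn_add] <;> congr 1 <;> ring

theorem pullSlot_epsSlot (a : GradedMonoid A) :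
    pullSlot k a * epsSlot k A = sgn k a.1 • (epsSlot k A * pullSlot k a) := by
  apply slot_ext <;> intro b <;> simp [epsSlot, pullSlot]

theorem pullSlot_comm (a b : GradedMonoid A) [GradedMonoid.GOne A] [GradedAssoc A] :
    pullSlot k a * pullSlot k b = sgn k ((a.1 : ℤ) * b.1) • (pullSlot k b * pullSlot k a) := by
  have h : ∀ c : GradedMonoid A, homog (a * (b * c)) =
      sgn k ((a.1 : ℤ) * b.1) • homog (b * (a * c)) := by
    intro c
    rw [← GradedAssoc.assoc, ← GradedAssoc.assoc]
    have e : ∀ x y : GradedMonoid A, homog (x * y) = sgn k ((x.1 : ℤ) * y.1) • leftMul k y (homog x) :=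
      fun x y => by rw [leftMul_homog, GradedComm.comm (k := k)]
    rw [e (a * b) c, e (b * a) c, GradedComm.comm (k := k) a b, map_smul, smul_comm]
    congr 4
    change (((a.1 + b.1 : ℕ)) : ℤ) = ((b.1 + a.1 : ℕ) : ℤ)
    rw [add_comm]
  apply slot_ext <;> intro c
  · simp [pullSlot, h]
  · simp only [pullSlot, Module.End.mul_apply, LinearMap.prodMap_apply, map_zero,
      LinearMap.smul_apply, leftMul_homog, map_smul, h, Prod.smul_mk, smul_zero]
    congr 1
    simp only [smul_smul]
    congr 1
    ring

theorem pullSlot_mul (a b : GradedMonoid A) [GradedMonoid.GOne A] [GradedAssoc A] :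
    pullSlot k (a * b) = pullSlot k a * pullSlot k b := by
  have h : (((a * b).1 : ℕ) : ℤ) = a.1 + b.1 := by
    change (((a.1 + b.1 : ℕ)) : ℤ) = _
    push_cast; rfl
  apply slot_ext <;> intro c <;>
    simp [pullSlot, h, GradedAssoc.assoc, sgn_add, smul_smul] <;> congr 1 <;> ring

theorem pullSlot_one [GradedMonoid.GOne A] [GradedAssoc A] :
    pullSlot k (1 : GradedMonoid A) = 1 := by
  have h : sgn k (((1 : GradedMonoid A).1 : ℕ) : ℤ) = 1 := by
    change sgn k ((0 : ℕ) : ℤ) = 1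
    simp
  apply slot_ext <;> intro c <;> simp [pullSlot, GradedAssoc.one_mul, h]

theorem pullSlot_add {p : ℕ} (a b : A p) : pullSlot k (GradedMonoid.mk p (a + b)) =
    pullSlot k (GradedMonoid.mk p (a)) + pullSlot k (GradedMonoid.mk p (b)) := by
  have h : ∀ c : GradedMonoid A, homog ((GradedMonoid.mk p (a + b)) * c) =
      homog ((GradedMonoid.mk p (a)) * c) + homog ((GradedMonoid.mk p (b)) * c) := fun c => by
    change DirectSum.of A (p + c.1) (GradedMonoid.GMul.mul (a + b) c.2) = _
    rw [GradedComm.add_mul k, map_add]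
    rfl
  apply slot_ext <;> intro c
  · simp [pullSlot, h]
  · simp [pullSlot, h]
    rfl

theorem pullSlot_smul {p : ℕ} (c : k) (a : A p) : pullSlot k (GradedMonoid.mk p (c • a)) =
    c • pullSlot k (GradedMonoid.mk p (a)) := by
  have h : ∀ b : GradedMonoid A, homog ((GradedMonoid.mk p (c • a)) * b) =
      c • homog ((GradedMonoid.mk p (a)) * b) := fun b => by
    change DirectSum.lof k ℕ A (p + b.1) (GradedMonoid.GMul.mul (c • a) b.2) = _
    rw [GradedComm.smul_mul, map_smul]
    rfl
  apply slot_ext <;> intro b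
  · simp [pullSlot, h]
  · simp [pullSlot, h, smul_comm c]
    rfl

end

variable {s : ℕ}

variable (A s) in
/-- The tensor product of the slots. -/
abbrev Slots : Type _ := PiTensorProduct k fun _ : Fin s => Slot A

/-- The operator which acts on one slot, with a sign operator of degree `d` on the earlier slots. -/
def slotOp (p : Fin s) (d : ℤ) (f : Module.End k (Slot A)) : Module.End k (Slots k A s) :=
  PiTensorProduct.map (Function.update (fun i => if i < p then parSlot k A d else 1) p f)

theorem slotOp_add (p : Fin s) (d : ℤ) (f g : Module.End k (Slot A)) :
    slotOp k p d (f + g) = slotOp k p d f + slotOp k p d g := PiTensorProduct.map_update_add _ _ _ _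

theorem slotOp_smul (p : Fin s) (d : ℤ) (c : k) (f : Module.End k (Slot A)) :
    slotOp k p d (c • f) = c • slotOp k p d f := PiTensorProduct.map_update_smul _ _ _ _

theorem slotOp_zero (p : Fin s) (d : ℤ) : slotOp k p d (0 : Module.End k (Slot A)) = 0 := by
  simpa using slotOp_smul k p d 0 (0 : Module.End k (Slot A))

theorem slotOp_mul_self (p : Fin s) (d e : ℤ) (f g : Module.End k (Slot A)) :
    slotOp k p d f * slotOp k p e g = slotOp k p (d + e) (f * g) := by
  unfold slotOp
  rw [← PiTensorProduct.map_mul]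
  congr 1
  funext i
  by_cases h : i = p
  · subst h; simp
  · by_cases h' : i < p <;> simp [h, h', parSlot_add]

theorem slotOp_one (p : Fin s) : slotOp k p 0 (1 : Module.End k (Slot A)) = 1 := by
  unfold slotOp
  rw [← PiTensorProduct.map_one]
  congr 1
  funext i
  by_cases h : i = p
  · subst h; simp
  · by_cases h' : i < p <;> simp [h, h', parSlot_zero]

/-- The operator on the later slot acts on the earlier slot `p` through its sign operator only;
moving that past `f` gives the sign. -/
theorem slotOp_comm_of_lt {p q : Fin s} (hpq : p < q) {d e : ℤ} {f g : Module.End k (Slot A)}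
    (hf : parSlot k A e * f = sgn k (e * d) • (f * parSlot k A e)) :
    slotOp k q e g * slotOp k p d f = sgn k (e * d) • (slotOp k p d f * slotOp k q e g) := by
  unfold slotOp
  rw [← PiTensorProduct.map_mul, ← PiTensorProduct.map_mul]
  have h : (fun i => Function.update (fun i => if i < q then parSlot k A e else 1) q g i *
      Function.update (fun i => if i < p then parSlot k A d else 1) p f i) =
      Function.update (fun i => Function.update (fun i => if i < p then parSlot k A d else 1) p f i *
        Function.update (fun i => if i < q then parSlot k A e else 1) q g i) p
      (sgn k (e * d) • (f * parSlot k A e)) := by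
    funext i
    by_cases h1 : i = p
    · subst h1
      simp [hpq.ne, hpq, hf]
    by_cases h2 : i = q
    · subst h2
      simp [h1, hpq.not_gt]
    · by_cases h3 : i < p <;> by_cases h4 : i < q <;> simp [h1, h2, h3, h4, parSlot_mul_comm k d e]
  rw [h, PiTensorProduct.map_update_smul]
  congr 2
  rw [Function.update_eq_self_iff]
  simp [hpq.ne, hpq]

theorem slotOp_comm {p q : Fin s} (hpq : p ≠ q) {d e : ℤ} {f g : Module.End k (Slot A)}
    (hf : ∀ e, parSlot k A e * f = sgn k (e * d) • (f * parSlot k A e))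
    (hg : ∀ d, parSlot k A d * g = sgn k (d * e) • (g * parSlot k A d)) :
    slotOp k p d f * slotOp k q e g = sgn k (d * e) • (slotOp k q e g * slotOp k p d f) := by
  rcases lt_or_gt_of_ne hpq with h | h
  · rw [slotOp_comm_of_lt k h (hf e), mul_comm d e, sgn_smul_smul]
  · rw [slotOp_comm_of_lt k h (hg d)]

/-- Operators on increasing slots, applied to a tensor which is even in all slots. -/
theorem slotOp_list_prod_apply {ι : Type*} (L : List ι) (p : ι → Fin s) (d : ι → ℤ)
    (f : ι → Module.End k (Slot A)) (hL : L.Pairwise fun i j => p i < p j) (v w : Fin s → Slot A)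
    (hv : ∀ i e, parSlot k A e (v i) = v i) (hw : ∀ i ∈ L, w (p i) = f i (v (p i)))
    (hw' : ∀ q, (∀ i ∈ L, p i ≠ q) → w q = v q) :
    (L.map fun i => slotOp k (p i) (d i) (f i)).prod (PiTensorProduct.tprod k v) =
      PiTensorProduct.tprod k w := by
  induction L generalizing w with
  | nil =>
    have : w = v := funext fun q => hw' q (by simp)
    simp [this]
  | cons a L ih =>
    rw [List.pairwise_cons] at hL
    rw [List.map_cons, List.prod_cons, Module.End.mul_apply,
      -- The operators further to the right act first, on later slots. When the operator of `a`
      -- acts, its slot and all earlier slots still carry the entries of `v`, or equal them, and by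
      -- evenness its sign operators have no effect.
      ih hL.2 (Function.update w (p a) (v (p a)))]
    · unfold slotOp
      rw [PiTensorProduct.map_tprod]
      congr 1
      funext q
      by_cases h : q = p a
      · subst h; simp [hw a]
      by_cases h' : q < p a
      · have hq : w q = v q := hw' q fun i hi => by
          rcases List.mem_cons.1 hi with rfl | hi
          · exact fun e => h e.symm
          · exact (h'.trans (hL.1 i hi)).ne'
        simp [h, h', hq, hv]
      · simp [h, h']
    · intro i hi
      rw [Function.update_of_ne (hL.1 i hi).ne', hw i (by simp [hi])]
    · intro q hq
      by_cases h : q = p a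
      · subst h; simp
      · rw [Function.update_of_ne h]
        apply hw'
        intro i hi
        rcases List.mem_cons.1 hi with rfl | hi
        · exact fun e => h e.symm
        · exact hq i hi

end Slots

/-! ### The relations of `E₁` for the operators on slots -/

section Representation

variable (k : Type v) [Field k] {A : ℕ → Type w} [∀ p, AddCommGroup (A p)]
  [∀ p, Module k (A p)] [GradedMonoid.GMul A] [GradedMonoid.GOne A] [GradedComm k A] (N : ℕ)
  {n s : ℕ} (slot : Fin n → Fin s)

/-- The slot on which a generator acts. -/
def genSlot : Gen A n → Fin s
  | .pull i _ => slot i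
  | .edge i _ _ => slot i

/-- The action of a generator on its slot. The edges between different slots act by `0`. -/
def genAct : Gen A n → Module.End k (Slot A)
  | .pull _ a => pullSlot k a
  | .edge i j _ => if slot i = slot j then epsSlot k A else 0

/-- The operator of a generator. -/
def genOp (x : Gen A n) : Module.End k (Slots k A s) :=
  slotOp k (genSlot slot x) (x.deg N) (genAct k slot x)

theorem parSlot_genAct [hN : Fact (Even N)] (d : ℤ) (x : Gen A n) :
    parSlot k A d * genAct k slot x = sgn k (d * x.deg N) • (genAct k slot x * parSlot k A d) := by
  cases x with
  | pull i a => exact parSlot_pullSlot k d a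
  | edge i j h =>
    by_cases hij : slot i = slot j
    · have e : sgn k (d * ((N : ℤ) - 1)) = sgn k d := sgn_congr k (by
        have h : Even (N : ℤ) := by exact_mod_cast hN.out
        rw [show d * ((N : ℤ) - 1) - d = d * N - 2 * d by ring]
        exact (h.mul_left _).sub (even_two_mul _))
      simp [genAct, hij, Gen.deg, e, parSlot_epsSlot]
    · simp [genAct, hij]

variable [GradedAssoc A] [hN : Fact (Even N)]

theorem genAct_comm (x y : Gen A n) : genAct k slot x * genAct k slot y =
    sgn k (x.deg N * y.deg N) • (genAct k slot y * genAct k slot x) := by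
  have e : ∀ d : ℤ, sgn k (d * ((N : ℤ) - 1)) = sgn k d := fun d => sgn_congr k (by
        have h : Even (N : ℤ) := by exact_mod_cast hN.out
        rw [show d * ((N : ℤ) - 1) - d = d * N - 2 * d by ring]
        exact (h.mul_left _).sub (even_two_mul _))
  cases x with
  | pull i a =>
    cases y with
    | pull j b => exact pullSlot_comm k a b
    | edge j l h =>
      by_cases hij : slot j = slot l <;> simp [genAct, hij, Gen.deg, e, pullSlot_epsSlot]
  | edge i j h =>
    cases y with
    | pull l b =>
      by_cases hij : slot i = slot j <;>
        simp [genAct, hij, Gen.deg, mul_comm, e, pullSlot_epsSlot, sgn_smul_smul]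
    | edge i' j' h' =>
      by_cases hij : slot i = slot j <;> by_cases hij' : slot i' = slot j' <;>
        simp [genAct, hij, hij', epsSlot_sq]

theorem genOp_comm (x y : Gen A n) : genOp k N slot x * genOp k N slot y =
    sgn k (x.deg N * y.deg N) • (genOp k N slot y * genOp k N slot x) := by
  unfold genOp
  by_cases h : genSlot slot x = genSlot slot y
  · rw [h, slotOp_mul_self, slotOp_mul_self, genAct_comm k N, slotOp_smul, add_comm]
  · exact slotOp_comm k h (fun e => parSlot_genAct k N slot e x) (fun e => parSlot_genAct k N slot e y)

/-- The representation of `E₁` on the tensor product of the slots. At most two points may lie in the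
same slot. -/
def slotRep (hs : ∀ i j l, slot i = slot j → slot j = slot l → i = j ∨ j = l ∨ l = i) :
    E1 k A N n →ₐ[k] Module.End k (Slots k A s) :=
  RingQuot.liftAlgHom k ⟨FreeAlgebra.lift k (genOp k N slot), by
    intro x y h
    cases h with
    | add i p a b =>
      simp only [map_add, FreeAlgebra.lift_ι_apply]
      exact (congrArg _ (pullSlot_add k a b)).trans (slotOp_add k _ _ _ _)
    | smul i p c a =>
      simp only [map_smul, FreeAlgebra.lift_ι_apply]
      exact (congrArg _ (pullSlot_smul k c a)).trans (slotOp_smul k _ _ _ _)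
    | one i =>
      simp only [map_one, FreeAlgebra.lift_ι_apply]
      exact (congrArg _ (pullSlot_one k)).trans (slotOp_one k _)
    | mul i a b =>
      simp only [map_mul, FreeAlgebra.lift_ι_apply]
      refine Eq.trans ?_ (slotOp_mul_self k _ _ _ _ _).symm
      refine (congrArg _ (pullSlot_mul k a b)).trans ?_
      congr 1
    | comm x y =>
      simp only [map_mul, map_smul, FreeAlgebra.lift_ι_apply]
      exact genOp_comm k N slot x y
    | arnold i j l hij hjl hli =>
      -- A slot contains at most two points, so at most one of the three edges acts by something
      -- nonzero, and every product of two edges vanishes.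
      have h0 : ∀ i j h, slot i ≠ slot j → genOp (A := A) k N slot (.edge i j h) = 0 := by
        intro i j h hne
        simp [genOp, genAct, hne, slotOp_zero]
      simp only [map_add, map_mul, map_zero, FreeAlgebra.lift_ι_apply]
      have key := hs i j l
      by_cases h1 : slot i = slot j
      · have h2 : slot j ≠ slot l := fun h2 => by
          rcases key h1 h2 with h | h | h
          exacts [hij h, hjl h, hli h]
        have h3 : slot l ≠ slot i := fun h3 => h2 (h1 ▸ h3.symm)
        simp [h0 _ _ _ h2, h0 _ _ _ h3]
      · rw [h0 _ _ _ h1]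
        by_cases h2 : slot j = slot l
        · have h3 : slot l ≠ slot i := fun h3 => h1 (h3.symm.trans h2.symm)
          simp [h0 _ _ _ h3]
        · simp [h0 _ _ _ h2]
    | sq i j h =>
      simp only [map_mul, map_zero, FreeAlgebra.lift_ι_apply]
      unfold genOp
      rw [slotOp_mul_self]
      by_cases hij : slot i = slot j <;> simp [genAct, hij, epsSlot_sq, slotOp_zero]
    | symm i j h =>
      rw [sgn_N, one_smul]
      simp only [FreeAlgebra.lift_ι_apply]
      by_cases hij : slot i = slot j
      · simp [genOp, genAct, genSlot, hij, Gen.deg]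
      · have hij' : slot j ≠ slot i := fun h => hij h.symm
        simp [genOp, genAct, hij, hij', slotOp_zero]
    | slide i j h a =>
      simp only [map_mul, FreeAlgebra.lift_ι_apply]
      by_cases hij : slot i = slot j
      · simp [genOp, genAct, genSlot, hij, Gen.deg]
      · simp [genOp, genAct, hij, slotOp_zero]⟩

variable (hs : ∀ i j l, slot i = slot j → slot j = slot l → i = j ∨ j = l ∨ l = i)

theorem slotRep_gen (x : Gen A n) :
    slotRep k N slot hs (E1.gen k A N n x) = genOp k N slot x := by
  simp [slotRep, E1.gen]

theorem slotRep_pl (i : Fin n) (a : GradedMonoid A) :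
    slotRep k N slot hs (pl k N i a) = slotOp k (slot i) a.1 (pullSlot k a) :=
  slotRep_gen k N slot hs _

theorem slotRep_ed {i j : Fin n} (h : i ≠ j) : slotRep k N slot hs (ed k A N s(i, j)) =
    if slot i = slot j then slotOp k (slot i) ((N : ℤ) - 1) (epsSlot k A) else 0 := by
  rw [ed_mk k N h, slotRep_gen]
  by_cases hij : slot i = slot j <;> simp [genOp, genAct, genSlot, hij, Gen.deg, slotOp_zero]

end Representation

/-! ### Injectivity of `Ψ` -/

section LayoutFunctional

variable (k : Type v) [Field k] {A : ℕ → Type w} [∀ p, AddCommGroup (A p)]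
  [∀ p, Module k (A p)]

theorem wedge_swap (c : ℤ) {m : ℕ} {i j : Fin m} (h : (i : ℕ) + 1 = j) (x : Fin m → GradedMonoid A) :
    Power.wedge k c x = sgn k (((x i).1 + c) * ((x j).1 + c)) •
      Power.wedge k c (fun a => x (Equiv.swap i j a)) := by
  unfold Power.wedge
  rw [← Submodule.Quotient.mk_smul, Submodule.Quotient.eq]
  exact Submodule.subset_span ⟨x, i, j, h, rfl⟩

theorem perm_induction_adjacent {m : ℕ} {P : Equiv.Perm (Fin m) → Prop} (h1 : P 1)
    (hs : ∀ (π : Equiv.Perm (Fin m)) (i j : Fin m), (i : ℕ) + 1 = j → P π → P (π * Equiv.swap i j))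
    (π : Equiv.Perm (Fin m)) : P π := by
  cases m with
  | zero => rwa [Subsingleton.elim π 1]
  | succ m =>
    have hπ : π ∈ Submonoid.closure (Set.range fun i : Fin m => Equiv.swap i.castSucc i.succ) := by
      rw [Equiv.Perm.mclosure_swap_castSucc_succ]; trivial
    induction hπ using Submonoid.closure_induction_right with
    | one => exact h1
    | mul_right π hπ σ hσ ih =>
      obtain ⟨i, rfl⟩ := hσ
      exact hs π _ _ (by simp) ih

variable {m r n : ℕ}

/-- The slot of a point: the single points of a layout come first, then the pairs. -/
def layoutSlot (φ : Layout m r n) (v : Fin n) : Fin (m + r) :=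
  finSumFinEquiv (Sum.map id (Sum.elim id id) (φ.symm v))

theorem layoutSlot_eq_iff (φ : Layout m r n) {u v : Fin n} (h : u ≠ v) :
    layoutSlot φ u = layoutSlot φ v ↔
      ∃ j, s(u, v) = s(φ (.inr (.inl j)), φ (.inr (.inr j))) := by
  obtain ⟨a, rfl⟩ := φ.surjective u
  obtain ⟨b, rfl⟩ := φ.surjective v
  have h' : a ≠ b := fun e => h (congrArg φ e)
  unfold layoutSlot
  rw [finSumFinEquiv.injective.eq_iff]
  rcases a with a | a | a <;> rcases b with b | b | b <;>
    simp [Sym2.eq_iff, φ.injective.eq_iff] at h' ⊢ <;> tauto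

theorem layoutSlot_at_most_two (φ : Layout m r n) (i j l : Fin n)
    (h : layoutSlot φ i = layoutSlot φ j) (h' : layoutSlot φ j = layoutSlot φ l) :
    i = j ∨ j = l ∨ l = i := by
  obtain ⟨a, rfl⟩ := φ.surjective i
  obtain ⟨b, rfl⟩ := φ.surjective j
  obtain ⟨c, rfl⟩ := φ.surjective l
  unfold layoutSlot at h h'
  rw [finSumFinEquiv.injective.eq_iff] at h h'
  simp only [φ.injective.eq_iff]
  rcases a with a | a | a <;> rcases b with b | b | b <;> rcases c with c | c | c <;>
    simp at h h' ⊢ <;> grind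

variable (A m r) in
/-- The projection of the tensor product of the slots to `Λ^m(A) ⊗ Λ^r(s^c A)`. -/
def slotsProj (c : ℤ) : Slots k A (m + r) →ₗ[k] TensorProduct k (Power k A 0 m) (Power k A c r) :=
  (TensorProduct.map (Submodule.mkQ _) (Submodule.mkQ _)).comp <|
    (PiTensorProduct.tmulEquiv k (DirectSum ℕ A)).symm.toLinearMap.comp <|
      (PiTensorProduct.reindex k (fun _ : Fin (m + r) => DirectSum ℕ A)
        finSumFinEquiv.symm).toLinearMap.comp <|
        PiTensorProduct.map fun i => Sum.elim (fun _ => LinearMap.fst k _ _)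
          (fun _ => LinearMap.snd k _ _) (finSumFinEquiv.symm i)

theorem slotsProj_tprod (c : ℤ) (x : Fin m → GradedMonoid A) (y : Fin r → GradedMonoid A) :
    slotsProj k A m r c (PiTensorProduct.tprod k fun i =>
      Sum.elim (fun i => (homog (x i), 0)) (fun j => (0, homog (y j))) (finSumFinEquiv.symm i)) =
      Power.wedge k 0 x ⊗ₜ[k] Power.wedge k c y := by
  unfold slotsProj
  simp only [LinearMap.comp_apply, PiTensorProduct.map_tprod, LinearEquiv.coe_coe]
  rw [PiTensorProduct.reindex_tprod, PiTensorProduct.tmulEquiv_symm_apply]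
  simp
  rfl

variable [GradedMonoid.GMul A] [GradedMonoid.GOne A] [GradedComm k A] [GradedAssoc A] (N : ℕ)
  [hN : Fact (Even N)]

/-- The functional on `E₁` which reads off the letters of the monomials placed by a layout. -/
def layoutFun (φ : Layout m r n) :
    E1 k A N n →ₗ[k] TensorProduct k (Power k A 0 m) (Power k A ((N : ℤ) - 1) r) :=
  (slotsProj k A m r ((N : ℤ) - 1)).comp <|
    (LinearMap.applyₗ (PiTensorProduct.tprod k fun _ => (homog (1 : GradedMonoid A), 0))).comp
      (slotRep k N (layoutSlot φ) (layoutSlot_at_most_two φ)).toLinearMap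

/-- On the tensor `1 ⊗ ⋯ ⊗ 1`, the monomial acts by operators on increasing slots. The tensor is
even, so no signs arise: the letters `x_i` appear on the slots of single points and `ε y_j` on the
slots of pairs. -/
theorem layoutFun_mono_self (φ : Layout m r n) (x : Fin m → GradedMonoid A)
    (y : Fin r → GradedMonoid A) : layoutFun k N φ (mono k N φ x y) =
      Power.wedge k 0 x ⊗ₜ[k] Power.wedge k ((N : ℤ) - 1) y := by
  rw [← slotsProj_tprod]
  unfold layoutFun
  rw [LinearMap.comp_apply, LinearMap.comp_apply, LinearMap.applyₗ_apply_apply,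
    AlgHom.toLinearMap_apply]
  congr 1
  have e : slotRep k N (layoutSlot φ) (layoutSlot_at_most_two φ) (mono k N φ x y) =
      (((List.finRange m).map Sum.inl ++ (List.finRange r).map Sum.inr).map fun p =>
        slotOp k (finSumFinEquiv p)
          (Sum.elim (fun i => ((x i).1 : ℤ)) (fun j => ((N : ℤ) - 1) + (y j).1) p)
          (Sum.elim (fun i => pullSlot k (x i)) (fun j => epsSlot k A * pullSlot k (y j)) p)).prod := by
    unfold mono
    have h1 : ∀ i, layoutSlot φ (φ (.inl i)) = finSumFinEquiv (.inl i) := by simp [layoutSlot]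
    have h2 : ∀ j, layoutSlot φ (φ (.inr (.inl j))) = finSumFinEquiv (.inr j) := by simp [layoutSlot]
    have h3 : ∀ j, layoutSlot φ (φ (.inr (.inr j))) = finSumFinEquiv (.inr j) := by simp [layoutSlot]
    simp only [map_mul, map_list_prod, List.map_map, List.map_append, List.prod_append,
      Function.comp_def, slotRep_pl, slotRep_ed k N (layoutSlot φ) (layoutSlot_at_most_two φ)
        (layout_ne φ _), h1, h2, h3, if_true, slotOp_mul_self, Sum.elim_inl, Sum.elim_inr]
  rw [e]
  apply slotOp_list_prod_apply
  · rw [List.pairwise_append]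
    refine ⟨?_, ?_, ?_⟩
    · rw [List.pairwise_map]
      exact (List.pairwise_lt_finRange m).imp fun h => h
    · rw [List.pairwise_map]
      exact (List.pairwise_lt_finRange r).imp fun h => by simpa using h
    · intro a ha b hb
      simp only [List.mem_map] at ha hb
      obtain ⟨i, -, rfl⟩ := ha
      obtain ⟨j, -, rfl⟩ := hb
      rw [Fin.lt_def]
      simp
      omega
  · intro i e
    have h : sgn k (e * (((1 : GradedMonoid A).1 : ℕ) : ℤ)) = 1 := by
      change sgn k (e * ((0 : ℕ) : ℤ)) = 1
      simp
    simp [parSlot, h]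
  · intro p _
    rcases p with i | j
    · simp [pullSlot, GradedAssoc.mul_one]
    · simp [pullSlot, epsSlot, GradedAssoc.mul_one]
  · intro q hq
    exfalso
    obtain ⟨p, rfl⟩ := finSumFinEquiv.surjective q
    rcases p with i | j
    · exact hq (.inl i) (by simp) rfl
    · exact hq (.inr j) (by simp) rfl

theorem layoutFun_mono_eq_zero (φ : Layout m r n) {m' r' : ℕ} (φ' : Layout m' r' n) (j : Fin r')
    (h : layoutSlot φ (φ' (.inr (.inl j))) ≠ layoutSlot φ (φ' (.inr (.inr j))))
    (x : Fin m' → GradedMonoid A) (y : Fin r' → GradedMonoid A) :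
    layoutFun k N φ (mono k N φ' x y) = 0 := by
  unfold layoutFun
  rw [LinearMap.comp_apply, LinearMap.comp_apply, AlgHom.toLinearMap_apply]
  suffices e : slotRep k N (layoutSlot φ) (layoutSlot_at_most_two φ) (mono k N φ' x y) = 0 by
    rw [e, map_zero, map_zero]
  unfold mono
  rw [map_mul, map_list_prod, map_list_prod, List.map_map, List.map_map]
  rw [List.prod_eq_zero (l := (List.finRange r').map _), mul_zero]
  rw [List.mem_map]
  refine ⟨j, List.mem_finRange j, ?_⟩
  simp [slotRep_ed k N (layoutSlot φ) (layoutSlot_at_most_two φ) (layout_ne φ' _), h]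

-- A pair of a layout may be reversed: its edge is symmetric, and its letter slides to the other
-- end.
omit [GradedComm k A] [GradedAssoc A] in
theorem mono_congr {φ φ' : Layout m r n} (h : ∀ i, φ (.inl i) = φ' (.inl i))
    (h' : ∀ j, s(φ (.inr (.inl j)), φ (.inr (.inr j))) = s(φ' (.inr (.inl j)), φ' (.inr (.inr j))))
    (x : Fin m → GradedMonoid A) (y : Fin r → GradedMonoid A) :
    mono k N φ x y = mono k N φ' x y := by
  unfold mono
  congr 2
  · exact congrArg (fun f => List.map f _) (funext fun i => by rw [h])
  · refine congrArg (fun f => List.map f _) (funext fun j => ?_)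
    rw [h' j]
    rcases Sym2.eq_iff.1 (h' j) with ⟨e, -⟩ | ⟨e, -⟩
    · rw [e]
    · rw [e, ed_pl_slide]

omit [GradedMonoid.GMul A] [GradedMonoid.GOne A] [GradedComm k A] [GradedAssoc A] in
theorem exists_of_layoutSlot_eq {φ : Layout m r n} {m' r' : ℕ} {φ' : Layout m' r' n}
    (h : ∀ j, layoutSlot φ (φ' (.inr (.inl j))) = layoutSlot φ (φ' (.inr (.inr j)))) :
    ∃ ρ : Fin r' → Fin r, Function.Injective ρ ∧ ∀ j, s(φ' (.inr (.inl j)), φ' (.inr (.inr j))) =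
      s(φ (.inr (.inl (ρ j))), φ (.inr (.inr (ρ j)))) := by
  choose ρ hρ using fun j => (layoutSlot_eq_iff φ (layout_ne φ' j)).1 (h j)
  refine ⟨ρ, fun i j hij => ?_, hρ⟩
  have e : s(φ' (.inr (.inl i)), φ' (.inr (.inr i))) = s(φ' (.inr (.inl j)), φ' (.inr (.inr j))) := by
    rw [hρ, hρ, hij]
  have := Sym2.mem_mk_left (φ' (.inr (.inl i))) (φ' (.inr (.inr i)))
  rw [e, Sym2.mem_iff] at this
  simpa [φ'.injective.eq_iff] using this

/-- Under adjacent transpositions, which generate the permutations, the monomials and the wedges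
change by the same Koszul sign. -/
theorem layoutFun_mono_perm (φ : Layout m r n) (π : Equiv.Perm (Fin m)) (ρ : Equiv.Perm (Fin r))
    (x : Fin m → GradedMonoid A) (y : Fin r → GradedMonoid A) :
    layoutFun k N φ (mono k N ((Equiv.sumCongr π (Equiv.sumCongr ρ ρ)).trans φ) x y) =
      Power.wedge k 0 x ⊗ₜ[k] Power.wedge k ((N : ℤ) - 1) y := by
  induction π using perm_induction_adjacent generalizing x with
  | h1 =>
    induction ρ using perm_induction_adjacent generalizing y with
    | h1 =>
      have : (Equiv.sumCongr (1 : Equiv.Perm (Fin m)) (Equiv.sumCongr (1 : Equiv.Perm (Fin r))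
          (1 : Equiv.Perm (Fin r)))).trans φ = φ := by
        ext a; rcases a with a | a | a <;> rfl
      rw [this, layoutFun_mono_self]
    | hs ρ i j hij ih =>
      rw [mono_swap_right k N hij, wedge_swap k ((N : ℤ) - 1) hij y, map_smul,
        TensorProduct.tmul_smul, ← ih]
      congr 3
      ext a; rcases a with a | a | a <;> simp
  | hs π i j hij ih =>
    rw [mono_swap_left k N hij, wedge_swap k 0 hij x, map_smul, ← TensorProduct.smul_tmul', ← ih,
      add_zero, add_zero]
    congr 3
    ext a
    rcases a with a | a | a
    · change (φ (.inl ((π * Equiv.swap i j) (Equiv.swap i j a))) : ℕ) = φ (.inl (π a))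
      simp
    · rfl
    · rfl

/-- Both layouts have `r` pairs, so the pairs of `φ'` are all the pairs of `φ`. Up to reversal of
pairs, `φ'` is then `φ` after a permutation of the single positions and one of the pairs. -/
theorem layoutFun_mono {φ φ' : Layout m r n}
    (h : ∀ j, layoutSlot φ (φ' (.inr (.inl j))) = layoutSlot φ (φ' (.inr (.inr j))))
    (x : Fin m → GradedMonoid A) (y : Fin r → GradedMonoid A) :
    layoutFun k N φ (mono k N φ' x y) =
      Power.wedge k 0 x ⊗ₜ[k] Power.wedge k ((N : ℤ) - 1) y := by
  obtain ⟨ρ, hρ, hρ'⟩ := exists_of_layoutSlot_eq h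
  have hsurj := Finite.surjective_of_injective hρ
  have hex : ∀ i, ∃ i', φ' (.inl i) = φ (.inl i') := by
    intro i
    obtain ⟨a, ha⟩ := φ.surjective (φ' (.inl i))
    have hno : ∀ j, φ' (.inl i) ∉ s(φ (.inr (.inl j)), φ (.inr (.inr j))) := by
      intro j hj
      obtain ⟨j, rfl⟩ := hsurj j
      rw [← hρ', Sym2.mem_iff] at hj
      simp [φ'.injective.eq_iff] at hj
    rcases a with a | a | a
    · exact ⟨a, ha.symm⟩
    · exact absurd (by rw [← ha]; exact Sym2.mem_mk_left _ _) (hno a)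
    · exact absurd (by rw [← ha]; exact Sym2.mem_mk_right _ _) (hno a)
  choose π hπ using hex
  have hπ' : Function.Injective π := fun i j e => by
    have : φ' (.inl i) = φ' (.inl j) := by rw [hπ, hπ, e]
    simpa using this
  rw [← layoutFun_mono_perm k N φ (Equiv.ofBijective π (Finite.injective_iff_bijective.1 hπ'))
    (Equiv.ofBijective ρ ⟨hρ, hsurj⟩)]
  congr 1
  exact mono_congr k N (fun i => by simp [hπ]) (fun j => hρ' j) x y

/-- The permutations which preserve the slots of a layout. -/
def slotPerms (φ : Layout m r n) : Subgroup (Equiv.Perm (Fin n)) where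
  carrier := {g | ∀ u v, layoutSlot φ u = layoutSlot φ v → layoutSlot φ (g u) = layoutSlot φ (g v)}
  mul_mem' ha hb u v h := ha _ _ (hb _ _ h)
  one_mem' _ _ h := h
  inv_mem' {g} hg u v h := by
    -- Membership is an implication in one direction only; in a finite group `g⁻¹` is a power of
    -- `g`.
    have hpow : ∀ l : ℕ, ∀ u v, layoutSlot φ u = layoutSlot φ v →
        layoutSlot φ ((g ^ l) u) = layoutSlot φ ((g ^ l) v) := by
      intro l
      induction l with
      | zero => exact fun _ _ h => h
      | succ l ih =>
        intro u v h
        rw [pow_succ']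
        exact hg _ _ (ih _ _ h)
    have e : g⁻¹ = g ^ (orderOf g - 1) := by
      rw [inv_eq_iff_mul_eq_one, ← pow_succ', Nat.sub_add_cancel (orderOf_pos g), pow_orderOf_eq_one]
    rw [e]
    exact hpow _ _ _ h

-- The layouts in question are the `g ∘ φ` with `g` in the subgroup `slotPerms φ`, whose order
-- divides `n!`.
open Classical in
theorem card_compatible_ne_zero (hk : (n.factorial : k) ≠ 0) (φ : Layout m r n) :
    (((Finset.univ.filter fun φ' : Layout m r n => ∀ j, layoutSlot φ (φ' (.inr (.inl j))) =
      layoutSlot φ (φ' (.inr (.inr j)))).card : ℕ) : k) ≠ 0 := by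
  have key : (Finset.univ.filter fun φ' : Layout m r n => ∀ j, layoutSlot φ (φ' (.inr (.inl j))) =
      layoutSlot φ (φ' (.inr (.inr j)))).card = Nat.card (slotPerms φ) := by
    rw [Nat.card_eq_fintype_card, Fintype.card_subtype]
    refine Finset.card_bij' (fun φ' _ => φ.symm.trans φ') (fun g _ => φ.trans g) ?_ ?_ ?_ ?_
    · intro φ' hφ'
      simp only [Finset.mem_filter, Finset.mem_univ, true_and] at hφ' ⊢
      intro u v huv
      by_cases hne : u = v
      · rw [hne]
      obtain ⟨j, hj⟩ := (layoutSlot_eq_iff φ hne).1 huv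
      rcases Sym2.eq_iff.1 hj with ⟨rfl, rfl⟩ | ⟨rfl, rfl⟩
      · simpa using hφ' j
      · simpa using (hφ' j).symm
    · intro g hg
      simp only [Finset.mem_filter, Finset.mem_univ, true_and] at hg ⊢
      intro j
      exact hg _ _ (by simp [layoutSlot])
    · intro φ' _
      ext; simp
    · intro φ' _
      ext; simp
  rw [key]
  exact card_subgroup_ne_zero hk _

theorem layoutFun_monoSum (hk : (n.factorial : k) ≠ 0) (φ : Layout m r n) : ∃ c : k, c ≠ 0 ∧
    ∀ (x : Fin m → GradedMonoid A) (y : Fin r → GradedMonoid A),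
      layoutFun k N φ (monoSum k N n x y) =
        c • (Power.wedge k 0 x ⊗ₜ[k] Power.wedge k ((N : ℤ) - 1) y) := by
  classical
  refine ⟨_, card_compatible_ne_zero k hk φ, fun x y => ?_⟩
  rw [monoSum, map_sum, Nat.cast_smul_eq_nsmul, ← Finset.sum_const, Finset.sum_filter]
  refine Finset.sum_congr rfl fun φ' _ => ?_
  split_ifs with h
  · exact layoutFun_mono k N h x y
  · push Not at h
    obtain ⟨j, hj⟩ := h
    exact layoutFun_mono_eq_zero k N φ φ' j hj x y

/-- More pairs cannot be injected into fewer, so in every layout of the sum some edge joins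
different slots. -/
theorem layoutFun_monoSum_eq_zero (φ : Layout m r n) {m' r' : ℕ} (hr : r < r')
    (x : Fin m' → GradedMonoid A) (y : Fin r' → GradedMonoid A) :
    layoutFun k N φ (monoSum k N n x y) = 0 := by
  rw [monoSum, map_sum]
  refine Finset.sum_eq_zero fun φ' _ => ?_
  by_cases h : ∀ j, layoutSlot φ (φ' (.inr (.inl j))) = layoutSlot φ (φ' (.inr (.inr j)))
  · obtain ⟨ρ, hρ, -⟩ := exists_of_layoutSlot_eq h
    have := Fintype.card_le_of_injective ρ hρ
    simp at this
    omega
  · push Not at h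
    obtain ⟨j, hj⟩ := h
    exact layoutFun_mono_eq_zero k N φ φ' j hj x y

/-- By triangularity: the functional of a layout with `r` pairs kills the components with more pairs
and is a nonzero scalar on the component with `r` pairs. The components of an element of the kernel
thus vanish in order of increasing `r`. -/
theorem psiLin_injective (hk : (n.factorial : k) ≠ 0) :
    Function.Injective (psiLin k A N n) := by
  classical
  rw [injective_iff_map_eq_zero]
  intro u hu
  have hlayout : ∀ q : {q : ℕ × ℕ // q.1 + 2 * q.2 = n}, Nonempty (Layout q.1.1 q.1.2 n) := fun q =>
    ⟨Fintype.equivOfCardEq (by simp; have := q.2; omega)⟩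
  let C := fun q : {q : ℕ × ℕ // q.1 + 2 * q.2 = n} =>
    TensorProduct k (Power k A 0 q.1.1) (Power k A ((N : ℤ) - 1) q.1.2)
  have hT : ∀ q : {q : ℕ × ℕ // q.1 + 2 * q.2 = n}, ∃ T : E1 k A N n →ₗ[k] C q,
      (∀ q', q.1.2 < q'.1.2 → ∀ v, T (psiLin k A N n (DirectSum.lof k _ C q' v)) = 0) ∧
      ∃ c : k, c ≠ 0 ∧ ∀ v, T (psiLin k A N n (DirectSum.lof k _ C q v)) = c • v := by
    intro q
    obtain ⟨φ⟩ := hlayout q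
    refine ⟨layoutFun k N φ, fun q' hq' => ?_, ?_⟩
    · suffices h : (layoutFun k N φ).comp ((psiLin k A N n).comp (DirectSum.lof k _ C q')) = 0 from
        fun v => LinearMap.congr_fun h v
      apply TensorProduct.ext
      apply power_ext
      intro x
      apply power_ext
      intro y
      change layoutFun k N φ (psiLin k A N n (Cn.word k N q'.2 x y)) = 0
      rw [psiLin_word, map_smul, layoutFun_monoSum_eq_zero k N φ hq', smul_zero]
    · obtain ⟨c, hc, h⟩ := layoutFun_monoSum (A := A) k N hk φ
      have h2 : (2 : k)⁻¹ ^ q.1.2 ≠ 0 := by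
        by_cases hr : q.1.2 = 0
        · simp [hr]
        · have h2 : ((2 : ℕ) : k) ≠ 0 := natCast_ne_zero_of_le hk two_pos (by have := q.2; omega)
          exact pow_ne_zero _ (inv_ne_zero (by exact_mod_cast h2))
      refine ⟨(2 : k)⁻¹ ^ q.1.2 * c, mul_ne_zero h2 hc, ?_⟩
      suffices h : (layoutFun k N φ).comp ((psiLin k A N n).comp (DirectSum.lof k _ C q)) =
        ((2 : k)⁻¹ ^ q.1.2 * c) • LinearMap.id from fun v => LinearMap.congr_fun h v
      apply TensorProduct.ext
      apply power_ext
      intro x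
      apply power_ext
      intro y
      change layoutFun k N φ (psiLin k A N n (Cn.word k N q.2 x y)) = ((2 : k)⁻¹ ^ q.1.2 * c) •
        (Power.wedge k 0 x ⊗ₜ[k] Power.wedge k ((N : ℤ) - 1) y)
      rw [psiLin_word, map_smul, h, smul_smul]
  have key : ∀ R : ℕ, ∀ q : {q : ℕ × ℕ // q.1 + 2 * q.2 = n}, q.1.2 = R → u q = 0 := by
    intro R
    induction R using Nat.strong_induction_on with
    | _ R ih =>
    intro q hq
    obtain ⟨T, hT1, c, hc, hT2⟩ := hT q
    have h1 : u = ∑ q' ∈ u.support, DirectSum.lof k _ C q' (u q') :=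
      (DirectSum.sum_support_of u).symm
    have h2 : T (psiLin k A N n u) = c • u q := by
      conv_lhs => rw [h1, map_sum, map_sum]
      rw [Finset.sum_eq_single q]
      · exact hT2 _
      · intro q' _ hne
        rcases lt_trichotomy q'.1.2 q.1.2 with h | h | h
        · rw [ih _ (hq ▸ h) q' rfl, map_zero, map_zero, map_zero]
        · exfalso
          apply hne
          apply Subtype.ext
          apply Prod.ext
          · have := q.2
            have := q'.2
            omega
          · exact h
        · exact hT1 q' h _
      · intro h
        rw [DFinsupp.notMem_support_iff.1 h, map_zero, map_zero, map_zero]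
    rw [hu, map_zero] at h2
    exact (smul_eq_zero.1 h2.symm).resolve_left hc
  exact DFinsupp.ext fun q => key _ q rfl

end LayoutFunctional

/-! ### The isomorphism and the product -/

section Isomorphism

variable (k : Type v) [Field k] (A : ℕ → Type w) [∀ p, AddCommGroup (A p)]
  [∀ p, Module k (A p)] [GradedMonoid.GMul A] [GradedMonoid.GOne A] [GradedComm k A] [GradedAssoc A]
  (N : ℕ) {n : ℕ} [hN : Fact (Even N)]

/-- The isomorphism `Ψ`. -/
def psi (hk : (n.factorial : k) ≠ 0) : Cn k A N n ≃ₗ[k] E1.invariants k A N n :=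
  LinearEquiv.ofBijective
    ((psiLin k A N n).codRestrict (Subalgebra.toSubmodule (E1.invariants k A N n))
      (psiLin_mem k A N))
    ⟨fun _ _ h => psiLin_injective k N hk (congrArg Subtype.val h), fun z => by
      obtain ⟨u, hu⟩ := range_psiLin k N hk z.2
      exact ⟨u, Subtype.ext hu⟩⟩

theorem coe_psi (hk : (n.factorial : k) ≠ 0) (u : Cn k A N n) :
    (psi k A N hk u : E1 k A N n) = psiLin k A N n u := rfl

/-- For the converse, averaging yields a bihomogeneous preimage, which must be `u` by injectivity.
-/
theorem psi_mem_bihomogeneous_iff (hk : (n.factorial : k) ≠ 0) (t r : ℕ) (u : Cn k A N n) :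
    u ∈ Cn.bihomogeneous k N n t r ↔
      (psi k A N hk u : E1 k A N n) ∈ E1.bihomogeneous k A N n t r := by
  refine ⟨fun h => psiLin_mem_bihomogeneous k N h, fun h => ?_⟩
  obtain ⟨u', hu', e⟩ := mem_map_psiLin k N hk (psi k A N hk u).2 h
  rw [coe_psi] at e
  rwa [← psiLin_injective k N hk e]

/-- The product of `C_n`, transported from the invariants of `E₁`. -/
def cnMul (hk : (n.factorial : k) ≠ 0) : Cn k A N n →ₗ[k] Cn k A N n →ₗ[k] Cn k A N n :=
  ((LinearMap.mul k (E1.invariants k A N n)).compl₁₂ (psi k A N hk).toLinearMap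
    (psi k A N hk).toLinearMap).compr₂ (psi k A N hk).symm.toLinearMap

theorem psi_cnMul (hk : (n.factorial : k) ≠ 0) (u w : Cn k A N n) :
    psi k A N hk (cnMul k A N hk u w) = psi k A N hk u * psi k A N hk w := by
  simp [cnMul]

theorem psiLin_cnMul (hk : (n.factorial : k) ≠ 0) (u w : Cn k A N n) :
    psiLin k A N n (cnMul k A N hk u w) = psiLin k A N n u * psiLin k A N n w :=
  congrArg Subtype.val (psi_cnMul k A N hk u w)

variable {A}

theorem isProduct_cnMul (hk : (n.factorial : k) ≠ 0) : IsProduct k N (cnMul k A N hk) where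
  formula l r q h x y z t := by
    apply psiLin_injective k N hk
    rw [psiLin_cnMul]
    exact psiLin_word_mul k N x y z t hk h
  eq_zero m r m' q h h' x y z t hlt := by
    apply psiLin_injective k N hk
    rw [psiLin_cnMul, psiLin_word, psiLin_word, smul_mul_smul_comm,
      monoSum_mul_monoSum_eq_zero k N hk hlt, smul_zero, map_zero]

omit [GradedComm k A] [GradedAssoc A] hN in
theorem IsProduct.unique {μ μ' : Cn k A N n →ₗ[k] Cn k A N n →ₗ[k] Cn k A N n}
    (hμ : IsProduct k N μ) (hμ' : IsProduct k N μ') : μ = μ' := by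
  apply cn_ext
  intro m r h x y
  apply cn_ext
  intro m' q h' z t
  by_cases hlt : n < 2 * q + 2 * r
  · rw [hμ.eq_zero m r m' q h h' x y z t hlt, hμ'.eq_zero m r m' q h h' x y z t hlt]
  · obtain ⟨l, hl⟩ : ∃ l, l + 2 * (q + r) = n := ⟨n - 2 * (q + r), by omega⟩
    obtain rfl : m = l + 2 * q := by omega
    obtain rfl : m' = l + 2 * r := by omega
    rw [hμ.formula l r q hl x y z t, hμ'.formula l r q hl x y z t]

end Isomorphism

/-! ### Dual bases and the diagonal class -/

section DualBases

variable {k : Type v} [Field k] {A : ℕ → Type w} [∀ p, AddCommGroup (A p)]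
  [∀ p, Module k (A p)] [GradedMonoid.GMul A] [GradedMonoid.GOne A]

/-- `T` takes the coefficient of `Ω` in the component of degree `N`. In terms of `T` the duality
`T(b_i b'_j) = δ_{ij}` holds for all `i`, `j`, without a condition on degrees. -/
theorem IsDualBases.exists_trace {N m : ℕ} {Ω : A N} {b b' : Fin m → GradedMonoid A}
    (hb : IsDualBases k Ω b b') : ∃ T : DirectSum ℕ A →ₗ[k] k,
      (∀ a : GradedMonoid A, a.1 ≠ N → T (homog a) = 0) ∧
      ∀ i j, T (homog (b i * b' j)) = if i = j then 1 else 0 := by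
  obtain ⟨f, hf⟩ := LinearMap.exists_leftInverse_of_injective (LinearMap.toSpanSingleton k _ Ω)
    (LinearMap.ker_eq_bot.2 (smul_left_injective k hb.omega_ne_zero))
  have hΩ : f Ω = 1 := by simpa using LinearMap.congr_fun hf 1
  have hT : ∀ a : GradedMonoid A, a.1 ≠ N →
      (f.comp (DirectSum.component k ℕ A N)) (homog a) = 0 := by
    intro a ha
    have : DirectSum.component k ℕ A N (homog a) = 0 := DirectSum.of_eq_of_ne _ _ _ (Ne.symm ha)
    rw [LinearMap.comp_apply, this, map_zero]
  refine ⟨f.comp (DirectSum.component k ℕ A N), hT, fun i j => ?_⟩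
  by_cases h : (b i).1 + (b' j).1 = N
  · rw [hb.dual i j h]
    split_ifs
    · have : DirectSum.component k ℕ A N (homog (A := A) ⟨N, Ω⟩) = Ω := DirectSum.of_eq_same _ _
      rw [LinearMap.comp_apply, this, hΩ]
    · simp
  · rw [hT _ h, if_neg]
    rintro rfl
    exact h (hb.deg_add i)

variable [GradedComm k A]

variable (k A) in
/-- The product of the total space. -/
def mulTot : DirectSum ℕ A →ₗ[k] DirectSum ℕ A →ₗ[k] DirectSum ℕ A :=
  DirectSum.toModule k ℕ _ fun p =>
    { toFun := fun a => leftMul k (GradedMonoid.mk p a)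
      map_add' := fun a b => totalSpace_ext k fun c => by
        rw [LinearMap.add_apply, leftMul_homog, leftMul_homog, leftMul_homog]
        change DirectSum.of A (p + c.1) (GradedMonoid.GMul.mul (a + b) c.2) = _
        rw [GradedComm.add_mul k, map_add]
        rfl
      map_smul' := fun c a => totalSpace_ext k fun b => by
        rw [RingHom.id_apply, LinearMap.smul_apply, leftMul_homog, leftMul_homog]
        change DirectSum.lof k ℕ A (p + b.1) (GradedMonoid.GMul.mul (c • a) b.2) = _
        rw [GradedComm.smul_mul, map_smul]
        rfl }

@[simp] theorem mulTot_homog (a : GradedMonoid A) : mulTot k A (homog a) = leftMul k a := by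
  unfold mulTot homog
  exact DirectSum.toModule_lof k a.1 a.2

section
variable {N m : ℕ} [hN : Fact (Even N)] {b b' : Fin m → GradedMonoid A}
  {T : DirectSum ℕ A →ₗ[k] k}

/-- As `N` is even, `q ≡ p` and `p q ≡ p ^ 2 ≡ p` modulo `2`. -/
theorem sgn_mul_eq_of_add_eq {p q : ℕ} (h : p + q = N) : sgn k ((p : ℤ) * q) = sgn k p := by
  apply sgn_congr
  have h1 : Even ((p : ℤ) + q) := by exact_mod_cast h ▸ hN.out
  have h2 : Even ((p : ℤ) * (p + 1)) := Int.even_mul_succ_self p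
  rw [show (p : ℤ) * q - p = p * (p + q) - p * (p + 1) by ring]
  exact (h1.mul_left _).sub h2

theorem sgn_eq_of_add_eq {p q : ℕ} (h : p + q = N) : sgn k (p : ℤ) = sgn k (q : ℤ) := by
  apply sgn_congr
  have h1 : Even ((p : ℤ) + q) := by exact_mod_cast h ▸ hN.out
  rw [show (p : ℤ) - q = p + q - 2 * q by ring]
  exact h1.sub (even_two_mul _)

/-- A trace is graded symmetric. -/
theorem trace_comm (hT : ∀ a : GradedMonoid A, a.1 ≠ N → T (homog a) = 0) (x y : DirectSum ℕ A) :
    T (mulTot k A x y) = T (mulTot k A (par k A 1 y) x) := by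
  suffices h : (mulTot k A).compr₂ T = (((mulTot k A).comp (par k A 1)).compr₂ T).flip from
    LinearMap.congr_fun₂ h x y
  apply totalSpace_ext
  intro a
  apply totalSpace_ext
  intro b
  simp only [LinearMap.compr₂_apply, LinearMap.flip_apply, LinearMap.comp_apply, mulTot_homog,
    par_homog, map_smul, LinearMap.smul_apply, leftMul_homog, one_mul]
  by_cases h : a.1 + b.1 = N
  · rw [GradedComm.comm (k := k) a b, map_smul, sgn_mul_eq_of_add_eq h, sgn_eq_of_add_eq h]
  · rw [hT (a * b) h, hT (b * a) (fun h' => h ((add_comm _ _).trans h')), smul_zero]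

variable (hspan : Submodule.span k (Set.range fun i => homog (b i)) = ⊤)
  (hT : ∀ a : GradedMonoid A, a.1 ≠ N → T (homog a) = 0)
  (hdual : ∀ i j, T (homog (b i * b' j)) = if i = j then 1 else 0)

-- On a basis vector `b_s` this is the duality.
include hspan hdual in
theorem sum_trace_smul_left (w : DirectSum ℕ A) :
    ∑ q, T (mulTot k A w (homog (b' q))) • homog (b q) = w := by
  suffices h : ∑ q, (T.comp ((mulTot k A).flip (homog (b' q)))).smulRight (homog (b q)) =
      LinearMap.id by
    simpa using LinearMap.congr_fun h w
  refine LinearMap.ext_on_range hspan fun s => ?_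
  simp [hdual]

include hspan hdual hT

/-- This is the symmetry of the diagonal class, tested on a bilinear map. Both sides are expanded in
the values `B(b_s, b_q)`; the coefficient is `T(b'_q b'_s)` on the left, and on the right the same
by the graded symmetry of the trace. -/
theorem sum_bilin_swap {V : Type*} [AddCommGroup V] [Module k V]
    (B : DirectSum ℕ A →ₗ[k] DirectSum ℕ A →ₗ[k] V) :
    ∑ q, B (homog (b' q)) (homog (b q)) = ∑ q, B (homog (b q)) (par k A 1 (homog (b' q))) := by
  have h1 : ∀ q, B (homog (b' q)) (homog (b q)) =
      ∑ s, T (mulTot k A (homog (b' q)) (homog (b' s))) • B (homog (b s)) (homog (b q)) := by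
    intro q
    conv_lhs => rw [← sum_trace_smul_left hspan hdual (homog (b' q))]
    simp
  have h2 : ∀ s, B (homog (b s)) (par k A 1 (homog (b' s))) =
      ∑ q, T (mulTot k A (homog (b' q)) (homog (b' s))) • B (homog (b s)) (homog (b q)) := by
    intro s
    conv_lhs => rw [← sum_trace_smul_left hspan hdual (par k A 1 (homog (b' s)))]
    simp only [map_sum, map_smul]
    exact Finset.sum_congr rfl fun q _ => by rw [trace_comm hT (homog (b' q))]
  rw [Finset.sum_congr rfl fun q _ => h1 q, Finset.sum_congr rfl fun s _ => h2 s, Finset.sum_comm]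

theorem sum_trace_smul_right (w : DirectSum ℕ A) :
    ∑ q, T (mulTot k A (homog (b q)) w) • homog (b' q) = w := by
  have h := sum_bilin_swap hspan hT hdual
    (LinearMap.flip ((LinearMap.lsmul k (DirectSum ℕ A)).comp (T.comp ((mulTot k A).flip w))))
  simp only [LinearMap.flip_apply, LinearMap.comp_apply, LinearMap.lsmul_apply] at h
  rw [h]
  conv_rhs => rw [← sum_trace_smul_left hspan hdual w]
  exact Finset.sum_congr rfl fun q _ => by rw [← trace_comm hT w]

/-- Moving an operator and its adjoint across the diagonal class. -/
theorem sum_bilin_adjoint {V : Type*} [AddCommGroup V] [Module k V]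
    (B : DirectSum ℕ A →ₗ[k] DirectSum ℕ A →ₗ[k] V) {f g : DirectSum ℕ A →ₗ[k] DirectSum ℕ A}
    (hfg : ∀ x y, T (mulTot k A (f x) y) = T (mulTot k A x (g y))) :
    ∑ q, B (f (homog (b q))) (homog (b' q)) = ∑ q, B (homog (b q)) (g (homog (b' q))) := by
  have h1 : ∀ q, B (f (homog (b q))) (homog (b' q)) =
      ∑ s, T (mulTot k A (homog (b q)) (g (homog (b' s)))) • B (homog (b s)) (homog (b' q)) := by
    intro q
    conv_lhs => rw [← sum_trace_smul_left hspan hdual (f (homog (b q)))]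
    simp [hfg]
  have h2 : ∀ s, B (homog (b s)) (g (homog (b' s))) =
      ∑ q, T (mulTot k A (homog (b q)) (g (homog (b' s)))) • B (homog (b s)) (homog (b' q)) := by
    intro s
    conv_lhs => rw [← sum_trace_smul_right hspan hT hdual (g (homog (b' s)))]
    simp
  rw [Finset.sum_congr rfl fun q _ => h1 q, Finset.sum_congr rfl fun s _ => h2 s, Finset.sum_comm]

end

variable (k) in
/-- The diagonal class `p_{ij}^*(Δ)`. -/
def diag (N : ℕ) {n m : ℕ} (b b' : Fin m → GradedMonoid A) (i j : Fin n) : E1 k A N n :=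
  ∑ q, sgn k (b' q).1 • (pl k N i (b q) * pl k N j (b' q))

variable {N m n : ℕ} [hN : Fact (Even N)] {Ω : A N} {b b' : Fin m → GradedMonoid A}
  (hb : IsDualBases k Ω b b')

omit [GradedComm k A] in
theorem diag_eq (i j : Fin n) : diag k N b b' i j =
    ∑ q, ((LinearMap.mul k (E1 k A N n)).compl₁₂ (plLin k N i) ((plLin k N j).comp (par k A 1)))
      (homog (b q)) (homog (b' q)) := by
  simp [diag]

include hb

theorem diag_symm (i j : Fin n) : diag k N b b' i j = diag k N b b' j i := by
  obtain ⟨T, hT, hdual⟩ := hb.exists_trace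
  have h := sum_bilin_swap hb.span_eq_top hT hdual
    ((LinearMap.mul k (E1 k A N n)).compl₁₂ (plLin k N i) (plLin k N j))
  rw [diag_eq]
  simp only [LinearMap.compl₁₂_apply, LinearMap.comp_apply, LinearMap.mul_apply'] at h ⊢
  rw [← h, diag]
  refine Finset.sum_congr rfl fun q _ => ?_
  rw [plLin_homog, plLin_homog, pl_comm k N i j, mul_comm, sgn_mul_eq_of_add_eq (hb.deg_add q),
    sgn_eq_of_add_eq (hb.deg_add q)]

/-- For the pairing given by the trace, left multiplication by `a` is its own adjoint up to signs,
and an adjoint can be moved across the diagonal class by `sum_bilin_adjoint`. The signs cancel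
because `|b_q| + |b'_q| = N` is even. This is compatibility of `d₁` with the relation `p_i^*(a)
e_{ij} = p_j^*(a) e_{ij}`. -/
theorem pl_mul_diag [GradedAssoc A] (i j : Fin n) (a : GradedMonoid A) :
    pl k N i a * diag k N b b' i j = pl k N j a * diag k N b b' i j := by
  obtain ⟨T, hT, hdual⟩ := hb.exists_trace
  have hadj : ∀ x y, T (mulTot k A (leftMul k a x) y) =
      T (mulTot k A x ((sgn k a.1 • (leftMul k a).comp (par k A a.1)) y)) := by
    intro x y
    suffices h : ((mulTot k A).comp (leftMul k a)).compr₂ T =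
        ((mulTot k A).compl₂ (sgn k a.1 • (leftMul k a).comp (par k A a.1))).compr₂ T from
      LinearMap.congr_fun₂ h x y
    apply totalSpace_ext
    intro x
    apply totalSpace_ext
    intro y
    simp only [LinearMap.compr₂_apply, LinearMap.compl₂_apply, LinearMap.comp_apply, mulTot_homog,
      LinearMap.smul_apply, leftMul_homog, par_homog, map_smul, smul_smul, ← sgn_add]
    have e : T (homog (a * x * y)) = sgn k ((a.1 : ℤ) * x.1) * T (homog (x * (a * y))) := by
      have h := congrArg (fun w => T (mulTot k A w (homog y))) (GradedComm.comm (k := k) a x)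
      simp only [map_smul, LinearMap.smul_apply, mulTot_homog, leftMul_homog, smul_eq_mul] at h
      rw [h, GradedAssoc.assoc]
    rw [e, smul_eq_mul]
    by_cases h : x.1 + (a.1 + y.1) = N
    · congr 1
      apply sgn_congr
      have h1 : Even ((x.1 : ℤ) + (a.1 + y.1)) := by exact_mod_cast h ▸ hN.out
      have h2 : Even ((a.1 : ℤ) * (a.1 + 1)) := Int.even_mul_succ_self _
      rw [show (a.1 : ℤ) * x.1 - (a.1 + a.1 * y.1) = a.1 * (x.1 + (a.1 + y.1)) - a.1 * (a.1 + 1)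
        - 2 * (a.1 * y.1) by ring]
      exact ((h1.mul_left _).sub h2).sub (even_two_mul _)
    · rw [hT (x * (a * y)) h, mul_zero, mul_zero]
  have h := sum_bilin_adjoint hb.span_eq_top hT hdual ((LinearMap.mul k (E1 k A N n)).compl₁₂
    (plLin k N i) ((plLin k N j).comp (par k A 1))) hadj
  have hl : pl k N i a * diag k N b b' i j = ∑ q, ((LinearMap.mul k (E1 k A N n)).compl₁₂
      (plLin k N i) ((plLin k N j).comp (par k A 1))) (leftMul k a (homog (b q))) (homog (b' q)) := by
    simp [diag, Finset.mul_sum, pl_mul, mul_assoc]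
  rw [hl, h, diag, Finset.mul_sum]
  refine Finset.sum_congr rfl fun q _ => ?_
  have hd : (((a * b' q).1 : ℕ) : ℤ) = a.1 + (b' q).1 := by
    change (((a.1 + (b' q).1 : ℕ)) : ℤ) = _
    push_cast; rfl
  simp only [LinearMap.compl₁₂_apply, LinearMap.comp_apply, LinearMap.mul_apply',
    LinearMap.smul_apply, par_homog, map_smul, leftMul_homog, plLin_homog, pl_mul, mul_smul_comm,
    smul_smul, ← sgn_add, hd]
  rw [← mul_assoc (pl k N j a), pl_comm k N j i, smul_mul_assoc, smul_smul, ← sgn_add, mul_assoc]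
  congr 1
  apply sgn_congr
  have h1 : Even (((b q).1 : ℤ) + (b' q).1) := by exact_mod_cast hb.deg_add q ▸ hN.out
  rw [show (a.1 : ℤ) + a.1 * (b' q).1 + 1 * (a.1 + (b' q).1) - ((b' q).1 + a.1 * (b q).1) =
    2 * (a.1 + a.1 * (b' q).1) - a.1 * ((b q).1 + (b' q).1) by ring]
  exact (even_two_mul _).sub (h1.mul_left _)

end DualBases

/-! ### The differential of `E₁` -/

section Differential

variable (k : Type v) [Field k] {A : ℕ → Type w} [∀ p, AddCommGroup (A p)]
  [∀ p, Module k (A p)] [GradedMonoid.GMul A] [GradedMonoid.GOne A] (N : ℕ) {n m : ℕ}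

theorem deg_eq_bideg (x : Gen A n) : x.deg N = x.bideg.1 + x.bideg.2 * ((N : ℤ) - 1) := by
  cases x <;> simp [Gen.deg, Gen.bideg]

theorem gen_mem_bihomogeneous (x : Gen A n) :
    E1.gen k A N n x ∈ E1.bihomogeneous k A N n x.bideg.1 x.bideg.2 := by
  have := genProd_mem k N [x] (t := x.bideg.1) (r := x.bideg.2) (by simp)
  simpa [genProd] using this

theorem diag_mem_bihomogeneous {b b' : Fin m → GradedMonoid A} (h : ∀ q, (b q).1 + (b' q).1 = N)
    (i j : Fin n) : diag k N b b' i j ∈ E1.bihomogeneous k A N n N 0 :=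
  Submodule.sum_mem _ fun q _ => Submodule.smul_mem _ _ <| by
    have := mul_mem_bihomogeneous k N (pl_mem_bihomogeneous k N i (b q))
      (pl_mem_bihomogeneous k N j (b' q))
    rwa [h q] at this

theorem perm_diag (b b' : Fin m → GradedMonoid A) (σ : Equiv.Perm (Fin n)) (i j : Fin n) :
    E1.perm k A N n σ (diag k N b b' i j) = diag k N b b' (σ i) (σ j) := by
  simp [diag, map_sum]

/-- The value of the differential on a generator. -/
def genDiff (b b' : Fin m → GradedMonoid A) : Gen A n → E1 k A N n
  | .pull _ _ => 0
  | .edge i j _ => diag k N b b' i j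

/-- A generator, as a triangular matrix which records the differential. -/
def genMatrix (b b' : Fin m → GradedMonoid A) (x : Gen A n) : Matrix (Fin 2) (Fin 2) (E1 k A N n) :=
  !![sgn k (x.deg N) • E1.gen k A N n x, genDiff k N b b' x; 0, E1.gen k A N n x]

variable [GradedComm k A] [GradedAssoc A] [hN : Fact (Even N)] {Ω : A N}
  {b b' : Fin m → GradedMonoid A}

omit [GradedComm k A] [GradedAssoc A] in
theorem diag_comm (h : ∀ q, (b q).1 + (b' q).1 = N) (i j : Fin n) (x : E1 k A N n) {t r : ℕ}
    (hx : x ∈ E1.bihomogeneous k A N n t r) :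
    diag k N b b' i j * x = x * diag k N b b' i j := by
  rw [bihomogeneous_comm k N (diag_mem_bihomogeneous k N h i j) hx, sgn_even, one_smul]
  have hN' : Even (N : ℤ) := by exact_mod_cast hN.out
  simpa using hN'.mul_right _

theorem diag_mul_slide (hb : IsDualBases k Ω b b') (i j l : Fin n) :
    ed k A N s(j, l) * diag k N b b' i j = ed k A N s(j, l) * diag k N b b' i l := by
  rw [diag, diag, Finset.mul_sum, Finset.mul_sum]
  refine Finset.sum_congr rfl fun q _ => ?_
  rw [mul_smul_comm, mul_smul_comm, pl_comm k N i j, pl_comm k N i l, mul_smul_comm, mul_smul_comm,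
    ← mul_assoc, ed_pl_slide, mul_assoc]

variable (hb : IsDualBases k Ω b b')

-- The upper right entry is the graded Leibniz rule. Well-definedness of the derivation on the
-- quotient `E₁` thus becomes the statement that these matrices satisfy the defining relations.
omit [GradedComm k A] [GradedAssoc A] in
theorem genMatrix_mul (x y : Gen A n) : genMatrix k N b b' x * genMatrix k N b b' y =
    !![sgn k (x.deg N) • sgn k (y.deg N) • (E1.gen k A N n x * E1.gen k A N n y),
      sgn k (x.deg N) • (E1.gen k A N n x * genDiff k N b b' y) +
        genDiff k N b b' x * E1.gen k A N n y;
      0, E1.gen k A N n x * E1.gen k A N n y] := by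
  unfold genMatrix
  rw [Matrix.mul_fin_two]
  simp [smul_comm (sgn k (y.deg N))]

include hb in
omit [GradedComm k A] [GradedAssoc A] in
theorem genDiff_comm (x y : Gen A n) : genDiff k N b b' x * E1.gen k A N n y =
    E1.gen k A N n y * genDiff k N b b' x := by
  cases x with
  | pull i a => simp [genDiff]
  | edge i j h => exact diag_comm k N hb.deg_add i j _ (gen_mem_bihomogeneous k N y)

include hb in
omit [GradedComm k A] [GradedAssoc A] in
theorem sgn_smul_genDiff (x : Gen A n) (c : ℤ) :
    sgn k (c * x.deg N) • genDiff k N b b' x = sgn k c • genDiff k N b b' x := by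
  cases x with
  | pull i a => simp [genDiff]
  | edge i j h =>
    congr 1
    apply sgn_congr
    change Even (c * ((N : ℤ) - 1) - c)
    have h : Even (N : ℤ) := by exact_mod_cast hN.out
    rw [show c * ((N : ℤ) - 1) - c = c * N - 2 * c by ring]
    exact (h.mul_left _).sub (even_two_mul _)

/-- The matrices of the differential, as a representation of `E₁`. -/
def diffRep : E1 k A N n →ₐ[k] Matrix (Fin 2) (Fin 2) (E1 k A N n) :=
  RingQuot.liftAlgHom k ⟨FreeAlgebra.lift k (genMatrix k N b b'), by
    intro x y h
    cases h with
    | add i p a a' =>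
      simp only [map_add, FreeAlgebra.lift_ι_apply]
      have := pl_add k N i a a'
      unfold pl at this
      ext u v
      fin_cases u <;> fin_cases v <;> simp [genMatrix, genDiff, this, Gen.deg]
    | smul i p c a =>
      simp only [map_smul, FreeAlgebra.lift_ι_apply]
      have := pl_smul k N i c a
      unfold pl at this
      ext u v
      fin_cases u <;> fin_cases v <;> simp [genMatrix, genDiff, this, Gen.deg, smul_comm c]
    | one i =>
      simp only [map_one, FreeAlgebra.lift_ι_apply]
      have := pl_one (A := A) k N i
      unfold pl at this
      have h0 : ((1 : GradedMonoid A).1 : ℕ) = 0 := rfl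
      ext u v
      fin_cases u <;> fin_cases v <;> simp [genMatrix, genDiff, this, Gen.deg, h0]
    | mul i a a' =>
      simp only [map_mul, FreeAlgebra.lift_ι_apply]
      rw [genMatrix_mul]
      have := pl_mul k N i a a'
      unfold pl at this
      have h0 : (((a * a').1 : ℕ) : ℤ) = a.1 + a'.1 := by
        change (((a.1 + a'.1 : ℕ)) : ℤ) = _
        push_cast; rfl
      ext u v
      fin_cases u <;> fin_cases v <;>
        simp [genMatrix, genDiff, this, Gen.deg, h0, sgn_add, smul_smul]
    | comm x y =>
      simp only [map_mul, map_smul, FreeAlgebra.lift_ι_apply]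
      rw [genMatrix_mul, genMatrix_mul]
      have h1 := gen_comm k N x y
      have h2 : sgn k (x.deg N) • (E1.gen k A N n x * genDiff k N b b' y) =
          sgn k (x.deg N * y.deg N) • (genDiff k N b b' y * E1.gen k A N n x) := by
        rw [← genDiff_comm k N hb, ← smul_mul_assoc, ← smul_mul_assoc, sgn_smul_genDiff k N hb]
      have h3 : genDiff k N b b' x * E1.gen k A N n y = sgn k (x.deg N * y.deg N) •
          sgn k (y.deg N) • (E1.gen k A N n y * genDiff k N b b' x) := by
        rw [← genDiff_comm k N hb, smul_comm, ← smul_mul_assoc, mul_comm (x.deg N),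
          sgn_smul_genDiff k N hb, smul_mul_assoc, sgn_smul_smul]
      ext u v
      fin_cases u <;> fin_cases v
      · simp only [Fin.zero_eta, Matrix.of_apply, Matrix.cons_val', Matrix.cons_val_zero,
          Matrix.smul_apply]
        rw [h1]
        simp only [smul_smul]
        congr 1
        ring
      · simp [h2, h3, add_comm]
      · simp
      · simp [h1]
    | arnold i j l hij hjl hli =>
      simp only [map_add, map_mul, map_zero, FreeAlgebra.lift_ι_apply]
      rw [genMatrix_mul, genMatrix_mul, genMatrix_mul]
      have h1 := arnold (A := A) k N i j l
      rw [ed_mk k N hij, ed_mk k N hjl, ed_mk k N hli] at h1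
      have hs : ∀ (i j : Fin n) h, sgn k ((Gen.edge i j h : Gen A n).deg N) = -1 := fun i j h =>
        sgn_odd k (odd_pred N)
      -- The classes `Δ` have even degree `N` and are central. Next to `e_{jl}` the class `Δ_{ij}`
      -- may be replaced by `Δ_{li}`, so the six terms cancel in pairs with the same edge.
      have h2 : ∀ i j l (h : j ≠ l), E1.gen k A N n (.edge j l h) * diag k N b b' i j =
          E1.gen k A N n (.edge j l h) * diag k N b b' l i := by
        intro i j l h
        rw [← ed_mk k N h, diag_mul_slide k N hb, diag_symm hb]
      have h3 := fun i j u v h => diag_comm k N hb.deg_add (n := n) i j _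
        (gen_mem_bihomogeneous k N (.edge u v h))
      ext u v
      fin_cases u <;> fin_cases v
      · simpa [hs] using h1
      · simp only [Fin.zero_eta, Fin.mk_one, Matrix.add_apply, Matrix.of_apply, Matrix.cons_val',
          Matrix.cons_val_zero, Matrix.cons_val_one, Matrix.zero_apply, hs, neg_smul, one_smul,
          genDiff, h3, Matrix.cons_val_fin_one]
        rw [h2 i j l hjl, h2 j l i hli, h2 l i j hij]
        abel
      · simp
      · simpa using h1
    | sq i j h =>
      simp only [map_mul, map_zero, FreeAlgebra.lift_ι_apply]
      rw [genMatrix_mul]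
      have h1 := ed_sq (A := A) k N s(i, j)
      rw [ed_mk k N h] at h1
      have hs : sgn k ((Gen.edge i j h : Gen A n).deg N) = -1 := sgn_odd k (odd_pred N)
      have h3 := fun i j u v h => diag_comm k N hb.deg_add (n := n) i j _
        (gen_mem_bihomogeneous k N (.edge u v h))
      ext u v
      fin_cases u <;> fin_cases v <;> simp [h1, hs, genDiff, h3]
    | symm i j h =>
      rw [sgn_N, one_smul]
      simp only [FreeAlgebra.lift_ι_apply]
      have h1 : E1.gen k A N n (.edge i j h) = E1.gen k A N n (.edge j i h.symm) := by
        rw [← ed_mk k N h, ← ed_mk k N h.symm, Sym2.eq_swap]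
      have h2 : genDiff k N b b' (.edge i j h) = genDiff k N b b' (.edge j i h.symm) :=
        diag_symm hb i j
      unfold genMatrix
      rw [h1, h2]
      rfl
    | slide i j h a =>
      simp only [map_mul, FreeAlgebra.lift_ι_apply]
      rw [genMatrix_mul, genMatrix_mul]
      have h1 := pl_ed_slide k N i j a
      rw [ed_mk k N h] at h1
      have h2 := pl_mul_diag hb i j a
      unfold pl at h1 h2
      ext u v
      fin_cases u <;> fin_cases v <;> simp [h1, genDiff, Gen.deg, h2]⟩

theorem diffRep_gen (x : Gen A n) :
    diffRep k N hb (E1.gen k A N n x) = genMatrix k N b b' x := by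
  simp [diffRep, E1.gen]

/-- The differential of `E₁`. -/
def e1Diff : E1 k A N n →ₗ[k] E1 k A N n :=
  (LinearMap.proj (R := k) (φ := fun _ : Fin 2 => E1 k A N n) 1).comp
    ((LinearMap.proj (R := k) (φ := fun _ : Fin 2 => Fin 2 → E1 k A N n) 0).comp
      (diffRep k N hb).toLinearMap)

theorem e1Diff_apply (x : E1 k A N n) : e1Diff k N hb x = diffRep k N hb x 0 1 := rfl

theorem diffRep_genProd (w : List (Gen A n)) : diffRep k N hb (genProd k A N w) =
    !![sgn k (((w.map Gen.bideg).sum.1 : ℤ) + (w.map Gen.bideg).sum.2 * ((N : ℤ) - 1)) •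
        genProd k A N w, e1Diff k N hb (genProd k A N w); 0, genProd k A N w] := by
  induction w with
  | nil =>
    ext u v
    fin_cases u <;> fin_cases v <;> simp [genProd, e1Diff_apply]
  | cons x w ih =>
    have h : diffRep k N hb (genProd k A N (x :: w)) = genMatrix k N b b' x *
        diffRep k N hb (genProd k A N w) := by rw [genProd_cons, map_mul, diffRep_gen]
    have h' : e1Diff k N hb (genProd k A N (x :: w)) = (genMatrix k N b b' x *
        diffRep k N hb (genProd k A N w)) 0 1 := by rw [e1Diff_apply, h]
    rw [h', h, ih, genMatrix, Matrix.mul_fin_two, genProd_cons]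
    ext u v
    fin_cases u <;> fin_cases v
    · simp only [List.map_cons, List.sum_cons, deg_eq_bideg, sgn_add, smul_smul]
      simp [sgn_add, smul_smul, add_mul]
      congr 1
      ring
    · simp
    · simp
    · simp

theorem isE1Differential_e1Diff : IsE1Differential k N n b b' (e1Diff k N hb) where
  leibniz t r x hx y := by
    -- The lower right entry of the matrix of an element is the element itself and the upper left
    -- one is its sign twist, so the upper right entry of a matrix product is the Leibniz rule.
    have h : ∀ y : E1 k A N n, diffRep k N hb y 1 1 = y := by
      intro y
      let f : E1 k A N n →ₗ[k] E1 k A N n :=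
        (LinearMap.proj (R := k) (φ := fun _ : Fin 2 => E1 k A N n) 1).comp
          ((LinearMap.proj (R := k) (φ := fun _ : Fin 2 => Fin 2 → E1 k A N n) 1).comp
            (diffRep k N hb).toLinearMap)
      have : f = LinearMap.id := e1_ext k N fun w => by
        change diffRep k N hb (genProd k A N w) 1 1 = _
        rw [diffRep_genProd]; rfl
      exact LinearMap.congr_fun this y
    have h' : diffRep k N hb x 0 0 = sgn k (t + r * ((N : ℤ) - 1)) • x := by
      induction hx using Submodule.span_induction with
      | mem x hx =>
        obtain ⟨w, hw, rfl⟩ := hx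
        have := diffRep_genProd k N hb w
        rw [hw] at this
        exact congrFun (congrFun this 0) 0
      | zero => simp
      | add x y _ _ hx hy => rw [map_add, Matrix.add_apply, hx, hy, smul_add]
      | smul c x _ hx => rw [map_smul, Matrix.smul_apply, hx, smul_comm]
    rw [e1Diff_apply, map_mul, Matrix.mul_apply, Fin.sum_univ_two, h, h', smul_mul_assoc, add_comm]
    rfl
  pull i a := by
    rw [e1Diff_apply, diffRep_gen]; rfl
  edge i j h := by
    rw [e1Diff_apply, diffRep_gen]; rfl

omit [GradedComm k A] [GradedAssoc A] hN

variable {k N} {d : E1 k A N n →ₗ[k] E1 k A N n} (hd : IsE1Differential k N n b b' d)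

include hd

theorem IsE1Differential.map_gen (x : Gen A n) : d (E1.gen k A N n x) = genDiff k N b b' x := by
  cases x with
  | pull i a => exact hd.pull i a
  | edge i j h => exact hd.edge i j h

theorem IsE1Differential.map_one : d 1 = 0 := by
  have := hd.leibniz 0 0 1 (one_mem_bihomogeneous k N) 1
  simpa using this

theorem IsE1Differential.map_genProd_cons (x : Gen A n) (w : List (Gen A n)) :
    d (genProd k A N (x :: w)) = genDiff k N b b' x * genProd k A N w +
      sgn k (x.deg N) • (E1.gen k A N n x * d (genProd k A N w)) := by
  rw [genProd_cons, hd.leibniz _ _ _ (gen_mem_bihomogeneous k N x), hd.map_gen, deg_eq_bideg]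

theorem IsE1Differential.unique {d' : E1 k A N n →ₗ[k] E1 k A N n}
    (hd' : IsE1Differential k N n b b' d') : d = d' := by
  apply e1_ext
  intro w
  induction w with
  | nil =>
    change d 1 = d' 1
    rw [hd.map_one, hd'.map_one]
  | cons x w ih => rw [hd.map_genProd_cons, hd'.map_genProd_cons, ih]

theorem IsE1Differential.map_perm (σ : Equiv.Perm (Fin n)) (x : E1 k A N n) :
    d (E1.perm k A N n σ x) = E1.perm k A N n σ (d x) := by
  suffices h : d.comp (E1.perm k A N n σ).toLinearMap = (E1.perm k A N n σ).toLinearMap.comp d from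
    LinearMap.congr_fun h x
  apply e1_ext
  intro w
  change d (E1.perm k A N n σ (genProd k A N w)) = E1.perm k A N n σ (d (genProd k A N w))
  induction w with
  | nil =>
    change d (E1.perm k A N n σ 1) = E1.perm k A N n σ (d 1)
    rw [_root_.map_one, hd.map_one, map_zero]
  | cons x w ih =>
    have h1 : (x.perm σ).deg N = x.deg N := by cases x <;> rfl
    have h2 : E1.perm k A N n σ (genDiff k N b b' x) = genDiff k N b b' (x.perm σ) := by
      cases x with
      | pull i a => exact map_zero _
      | edge i j h => exact perm_diag k N b b' σ i j
    rw [perm_genProd] at ih ⊢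
    rw [List.map_cons, hd.map_genProd_cons, hd.map_genProd_cons, ih, h1, map_add, map_mul, map_smul,
      map_mul, h2, perm_gen, perm_genProd]

/-- Induction on words. `Δ` is built from classes killed by `d`, so `d Δ = 0`; the two terms `Δ · d
w` cancel because `e_{ij}` is odd and `Δ` is even. -/
theorem IsE1Differential.map_map [hN : Fact (Even N)] (hdeg : ∀ q, (b q).1 + (b' q).1 = N)
    (x : E1 k A N n) : d (d x) = 0 := by
  have hpull : ∀ (w : List (Gen A n)) (i : Fin n) (a : GradedMonoid A) (y : E1 k A N n),
      d (pl k N i a * y) = sgn k a.1 • (pl k N i a * d y) := by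
    intro w i a y
    rw [hd.leibniz _ _ _ (pl_mem_bihomogeneous k N i a)]
    have : d (pl k N i a) = 0 := hd.pull i a
    rw [this]
    simp
  have hdiag : ∀ i j : Fin n, d (diag k N b b' i j) = 0 := by
    intro i j
    rw [diag, map_sum]
    refine Finset.sum_eq_zero fun q _ => ?_
    have : d (pl k N j (b' q)) = 0 := hd.pull j _
    rw [map_smul, hpull [], this]
    simp
  suffices h : d.comp d = 0 from LinearMap.congr_fun h x
  apply e1_ext
  intro w
  change d (d (genProd k A N w)) = 0
  induction w with
  | nil =>
    change d (d 1) = 0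
    rw [hd.map_one, map_zero]
  | cons x w ih =>
    rw [hd.map_genProd_cons, map_add, map_smul, hd.leibniz _ _ _ (gen_mem_bihomogeneous k N x), ih,
      hd.map_gen]
    cases x with
    | pull i a => simp [genDiff]
    | edge i j h =>
      have h1 : sgn k ((Gen.edge i j h : Gen A n).deg N) = -1 := sgn_odd k (odd_pred N)
      rw [h1]
      change d (diag k N b b' i j * _) + _ • (diag k N b b' i j * _ + _) = 0
      rw [hd.leibniz _ _ _ (diag_mem_bihomogeneous k N hdeg i j), hdiag, sgn_even k (a := _ + _)]
      · simp
      · simpa using hN.out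

theorem IsE1Differential.map_genProd_mem [hN : Fact (Even N)]
    (hdeg : ∀ q, (b q).1 + (b' q).1 = N) (w : List (Gen A n)) :
    ((w.map Gen.bideg).sum.2 = 0 → d (genProd k A N w) = 0) ∧
    ∀ t r, (w.map Gen.bideg).sum = (t, r + 1) →
      d (genProd k A N w) ∈ E1.bihomogeneous k A N n (t + N) r := by
  induction w with
  | nil => exact ⟨fun _ => hd.map_one, fun t r h => by simp [Prod.ext_iff] at h⟩
  | cons x w ih =>
    rw [hd.map_genProd_cons, List.map_cons, List.sum_cons]
    obtain ⟨h1, h2⟩ := ih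
    cases x with
    | pull i a =>
      refine ⟨fun h => ?_, fun t r h => ?_⟩
      · rw [h1 (by simpa [Gen.bideg] using h)]
        simp [genDiff]
      · rw [Prod.ext_iff] at h
        simp only [Gen.bideg, Prod.fst_add, Prod.snd_add, zero_add] at h
        have h3 := mul_mem_bihomogeneous k N (pl_mem_bihomogeneous k N i a)
          (h2 _ r (Prod.ext rfl h.2))
        rw [zero_add, ← add_assoc, h.1] at h3
        rw [genDiff, zero_mul, zero_add]
        exact Submodule.smul_mem _ _ h3
    | edge i j hij =>
      refine ⟨fun h => by simp [Gen.bideg] at h, fun t r h => ?_⟩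
      rw [Prod.ext_iff] at h
      simp only [Gen.bideg, Prod.fst_add, Prod.snd_add, zero_add] at h
      obtain ⟨ht, hr⟩ := h
      have hr' : (w.map Gen.bideg).sum.2 = r := by omega
      refine Submodule.add_mem _ ?_ (Submodule.smul_mem _ _ ?_)
      · have h3 := mul_mem_bihomogeneous k N (diag_mem_bihomogeneous k N hdeg i j)
          (genProd_mem k N w (Prod.ext ht hr'))
        rwa [zero_add, add_comm N] at h3
      · cases r with
        | zero => rw [h1 hr', mul_zero]; exact Submodule.zero_mem _
        | succ r =>
          have h3 := mul_mem_bihomogeneous k N (gen_mem_bihomogeneous k N (.edge i j hij))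
            (h2 t r (Prod.ext ht hr'))
          simpa [Gen.bideg, add_comm 1 r] using h3

theorem IsE1Differential.map_mem [hN : Fact (Even N)] (hdeg : ∀ q, (b q).1 + (b' q).1 = N)
    {t r : ℕ} {x : E1 k A N n} (hx : x ∈ E1.bihomogeneous k A N n t (r + 1)) :
    d x ∈ E1.bihomogeneous k A N n (t + N) r := by
  induction hx using Submodule.span_induction with
  | mem x hx =>
    obtain ⟨w, hw, rfl⟩ := hx
    exact (hd.map_genProd_mem hdeg w).2 t r hw
  | zero => simp
  | add x y _ _ hx hy => rw [map_add]; exact Submodule.add_mem _ hx hy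
  | smul c x _ hx => rw [map_smul]; exact Submodule.smul_mem _ _ hx

theorem IsE1Differential.map_eq_zero [hN : Fact (Even N)] (hdeg : ∀ q, (b q).1 + (b' q).1 = N)
    {t : ℕ} {x : E1 k A N n} (hx : x ∈ E1.bihomogeneous k A N n t 0) : d x = 0 := by
  induction hx using Submodule.span_induction with
  | mem x hx =>
    obtain ⟨w, hw, rfl⟩ := hx
    exact (hd.map_genProd_mem hdeg w).1 (by rw [hw])
  | zero => simp
  | add x y _ _ hx hy => rw [map_add, hx, hy, add_zero]
  | smul c x _ hx => rw [map_smul, hx, smul_zero]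

end Differential

/-! ### The differential of `C_n` -/

section BreakPair

variable {m r n : ℕ}

/-- The positions in a word in which the letter `s y_i` has been replaced by two letters, put at the
end of the first part. -/
def breakEquiv (m : ℕ) (i : Fin (r + 1)) :
    Fin (m + 2) ⊕ (Fin r ⊕ Fin r) ≃ Fin m ⊕ (Fin (r + 1) ⊕ Fin (r + 1)) :=
  Equiv.ofBijective (Sum.elim (Fin.append .inl ![.inr (.inl i), .inr (.inr i)])
    (fun a => .inr (Sum.map i.succAbove i.succAbove a))) <| by
    rw [Fintype.bijective_iff_surjective_and_card]
    refine ⟨?_, by simp; omega⟩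
    rintro (a | a | a)
    · exact ⟨.inl (Fin.castAdd 2 a), by simp⟩
    · rcases eq_or_ne a i with rfl | h
      · exact ⟨.inl (Fin.natAdd m 0), by simp⟩
      · obtain ⟨j, rfl⟩ := Fin.exists_succAbove_eq h
        exact ⟨.inr (.inl j), rfl⟩
    · rcases eq_or_ne a i with rfl | h
      · exact ⟨.inl (Fin.natAdd m 1), by simp⟩
      · obtain ⟨j, rfl⟩ := Fin.exists_succAbove_eq h
        exact ⟨.inr (.inr j), rfl⟩

/-- The layouts in which the `i`-th pair has been broken up. -/
def breakPair (m n : ℕ) (i : Fin (r + 1)) : Layout m (r + 1) n ≃ Layout (m + 2) r n where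
  toFun φ := (breakEquiv m i).trans φ
  invFun φ := (breakEquiv m i).symm.trans φ
  left_inv φ := by ext; simp
  right_inv φ := by ext; simp

variable (i : Fin (r + 1)) (φ : Layout m (r + 1) n)

@[simp] theorem breakPair_castAdd (j : Fin m) :
    breakPair m n i φ (.inl (Fin.castAdd 2 j)) = φ (.inl j) := by
  simp [breakPair, breakEquiv]

@[simp] theorem breakPair_natAdd_zero :
    breakPair m n i φ (.inl (Fin.natAdd m 0)) = φ (.inr (.inl i)) := by
  simp [breakPair, breakEquiv]

@[simp] theorem breakPair_natAdd_one :
    breakPair m n i φ (.inl (Fin.natAdd m 1)) = φ (.inr (.inr i)) := by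
  simp [breakPair, breakEquiv]

@[simp] theorem breakPair_inr_inl (j : Fin r) :
    breakPair m n i φ (.inr (.inl j)) = φ (.inr (.inl (i.succAbove j))) := by
  simp [breakPair, breakEquiv]

@[simp] theorem breakPair_inr_inr (j : Fin r) :
    breakPair m n i φ (.inr (.inr j)) = φ (.inr (.inr (i.succAbove j))) := by
  simp [breakPair, breakEquiv]

end BreakPair

/-! ### The differential of a monomial and its transport to `C_n` -/

section Differential

variable (k : Type v) [Field k] {A : ℕ → Type w} [∀ p, AddCommGroup (A p)]
  [∀ p, Module k (A p)] [GradedMonoid.GMul A] [GradedMonoid.GOne A] (N : ℕ) {n m r m₀ : ℕ}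

variable {N} in
/-- The derivative of a product, with the differentiated factor moved to the front. -/
theorem map_prod_of_leibniz (d : E1 k A N n →ₗ[k] E1 k A N n) (h1 : d 1 = 0)
    (B D : Fin (r + 1) → E1 k A N n) (c e : Fin (r + 1) → ℤ)
    (hd : ∀ i z, d (B i * z) = D i * z + sgn k (c i) • (B i * d z))
    (hc : ∀ i j, B j * D i = sgn k (e i * c j) • (D i * B j)) :
    d ((List.finRange (r + 1)).map B).prod =
      ∑ i, sgn k ((e i + 1) * ∑ j ∈ Finset.univ.filter (fun j => j < i), c j) •
        (D i * ((List.finRange r).map fun j => B (i.succAbove j)).prod) := by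
  induction r with
  | zero =>
    have := hd 0 1
    simpa [List.finRange_succ, h1] using this
  | succ r ih =>
    rw [List.finRange_succ, List.map_cons, List.prod_cons, hd, List.map_map,
      ih (B ∘ Fin.succ) (D ∘ Fin.succ) (c ∘ Fin.succ) (e ∘ Fin.succ) (fun i => hd _)
        (fun i j => hc _ _), Fin.sum_univ_succ (n := r + 1)]
    congr 1
    · simp [Function.comp_def]
    · rw [Finset.mul_sum, Finset.smul_sum]
      refine Finset.sum_congr rfl fun i _ => ?_
      simp only [Function.comp_apply]
      rw [List.finRange_succ, List.map_cons, List.prod_cons, List.map_map, mul_smul_comm,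
        ← mul_assoc, hc, smul_mul_assoc, smul_smul, smul_smul, ← sgn_add, ← sgn_add, mul_assoc]
      simp only [Finset.sum_filter, Fin.sum_univ_succ (n := r + 1), Fin.succ_pos, if_true,
        Fin.succ_lt_succ_iff, Fin.succ_succAbove_zero, Fin.succ_succAbove_succ, Function.comp_def]
      congr 2
      ring

variable [hN : Fact (Even N)] {b b' : Fin m₀ → GradedMonoid A}

variable {k N} {d : E1 k A N n →ₗ[k] E1 k A N n} (hd : IsE1Differential k N n b b' d)

omit hN in
include hd in
theorem IsE1Differential.map_pl_mul (i : Fin n) (a : GradedMonoid A) (z : E1 k A N n) :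
    d (pl k N i a * z) = sgn k a.1 • (pl k N i a * d z) := by
  rw [hd.leibniz _ _ _ (pl_mem_bihomogeneous k N i a)]
  have : d (pl k N i a) = 0 := hd.pull i a
  rw [this]
  simp

omit hN in
include hd in
theorem IsE1Differential.map_prod_pl_mul {ι : Type*} (f : ι → Fin n) (x : ι → GradedMonoid A)
    (z : E1 k A N n) (l : List ι) : d ((l.map fun i => pl k N (f i) (x i)).prod * z) =
      sgn k (l.map fun i => ((x i).1 : ℤ)).sum • ((l.map fun i => pl k N (f i) (x i)).prod * d z) := by
  induction l with
  | nil => simp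
  | cons a l ih =>
    simp only [List.map_cons, List.prod_cons, List.sum_cons]
    rw [mul_assoc, hd.map_pl_mul, ih, mul_smul_comm, smul_smul, sgn_add, mul_assoc]

include hd in
theorem IsE1Differential.map_ed {i j : Fin n} (h : i ≠ j) :
    d (ed k A N s(i, j)) = diag k N b b' i j := by
  rw [ed_mk k N h]
  exact hd.edge i j h

theorem diag_mul_pl (hdeg : ∀ q, (b q).1 + (b' q).1 = N) (i j : Fin n) (a : GradedMonoid A)  :
    diag k N b b' i j * pl k N i a =
      ∑ q, sgn k (b' q).1 • (pl k N i a * pl k N i (b q) * pl k N j (b' q)) := by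
  rw [diag_comm k N hdeg i j _ (pl_mem_bihomogeneous k N i a), diag, Finset.mul_sum]
  simp only [mul_smul_comm, mul_assoc]

-- Differentiating the `i`-th block replaces its edge by `Δ`. Each term of `Δ` puts `b_q` and `b'_q`
-- on the two ends of the pair; together with `y_i` they become the two new single letters of the
-- layout `breakPair m n i φ`.
include hd in
theorem IsE1Differential.map_mono (hdeg : ∀ q, (b q).1 + (b' q).1 = N) (φ : Layout m (r + 1) n)
    (x : Fin m → GradedMonoid A) (y : Fin (r + 1) → GradedMonoid A) [GradedAssoc A]  :
    d (mono k N φ x y) = ∑ i : Fin (r + 1), ∑ q,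
      sgn k ((b' q).1 + (∑ j, (x j).1) +
        ((y i).1 + 1) * ∑ j ∈ Finset.univ.filter (fun j => j < i), ((y j).1 + 1)) •
      mono k N (breakPair m n i φ) (Fin.append x ![y i * b q, b' q])
        (fun j => y (i.succAbove j)) := by
  have hN' : Even (N : ℤ) := by exact_mod_cast hN.out
  have hx : ((List.finRange m).map fun i => ((x i).1 : ℤ)).sum = ((∑ j, (x j).1 : ℕ) : ℤ) := by
    rw [← List.ofFn_eq_map, List.sum_ofFn]
    push_cast; rfl
  unfold mono
  rw [hd.map_prod_pl_mul, hx]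
  rw [map_prod_of_leibniz k d hd.map_one
    (fun j => ed k A N s(φ (.inr (.inl j)), φ (.inr (.inr j))) * pl k N (φ (.inr (.inl j))) (y j))
    (fun j => diag k N b b' (φ (.inr (.inl j))) (φ (.inr (.inr j))) *
      pl k N (φ (.inr (.inl j))) (y j))
    (fun j => (y j).1 + ((N : ℤ) - 1)) (fun j => N + (y j).1) ?_ ?_]
  · rw [Finset.mul_sum, Finset.smul_sum]
    refine Finset.sum_congr rfl fun i _ => ?_
    rw [diag_mul_pl hdeg, Finset.sum_mul, Finset.smul_sum, Finset.mul_sum, Finset.smul_sum]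
    refine Finset.sum_congr rfl fun q _ => ?_
    rw [smul_mul_assoc, mul_smul_comm, mul_smul_comm, smul_smul, smul_smul, ← sgn_add, ← sgn_add]
    have e1 : ∀ z z' : E1 k A N n, z = z' → ∀ s s', sgn k s = sgn k s' → sgn k s • z =
      sgn k s' • z' := by
      rintro z _ rfl s s' h
      rw [h]
    apply e1
    · rw [prod_finRange_add]
      simp [List.finRange_succ, pl_mul, mul_assoc]
    · apply sgn_congr
      push_cast
      -- The exponents agree modulo `2` because `N - 1` is odd.
      have : Even (∑ j ∈ Finset.univ.filter (fun j => j < i), ((y j).1 + ((N : ℤ) - 1)) -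
          ∑ j ∈ Finset.univ.filter (fun j => j < i), (((y j).1 : ℤ) + 1)) := by
        rw [← Finset.sum_sub_distrib]
        refine Finset.even_sum _ fun j _ => ?_
        rw [show ((y j).1 + ((N : ℤ) - 1)) - (((y j).1 : ℤ) + 1) = N - 2 * 1 by ring]
        exact hN'.sub (even_two_mul _)
      set S := ∑ j ∈ Finset.univ.filter (fun j => j < i), ((y j).1 + ((N : ℤ) - 1))
      set T := ∑ j ∈ Finset.univ.filter (fun j => j < i), (((y j).1 : ℤ) + 1)
      have e : ∀ a b c : ℤ, Even (a + (N + b + 1) * S + c - (c + a + (b + 1) * T)) := by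
        intro a b c
        rw [show a + (N + b + 1) * S + c - (c + a + (b + 1) * T) =
          N * S + (b + 1) * (S - T) by ring]
        exact (hN'.mul_right S).add (this.mul_left (b + 1))
      exact e _ _ _
  · intro j z
    rw [mul_assoc, hd.leibniz _ _ _ (ed_mem_bihomogeneous k N _), hd.map_ed (layout_ne φ j),
      hd.map_pl_mul, mul_smul_comm, smul_smul, ← sgn_add, mul_assoc, mul_assoc]
    congr 3
    push_cast
    ring
  · intro i j
    have h1 := mul_mem_bihomogeneous k N (diag_mem_bihomogeneous k N hdeg (φ (.inr (.inl i)))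
      (φ (.inr (.inr i)))) (pl_mem_bihomogeneous k N (φ (.inr (.inl i))) (y i))
    have h2 := block_mem k N (φ (.inr (.inl j))) (φ (.inr (.inr j))) (φ (.inr (.inl j))) (y j)
    rw [bihomogeneous_comm k N h2 h1]
    congr 2
    push_cast
    ring

-- `breakPair` is a bijection between layouts, so the broken monomials add up to sums of the form
-- `monoSum` again. Of the normalization `2^{-(r+1)}` the new words use `2^{-r}`, and the factor
-- `1/2` is left over.
include hd in
theorem IsE1Differential.map_psiLin_word [GradedAssoc A] (hdeg : ∀ q, (b q).1 + (b' q).1 = N)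
    (h : m + 2 * (r + 1) = n) (x : Fin m → GradedMonoid A) (y : Fin (r + 1) → GradedMonoid A) :
    d (psiLin k A N n (Cn.word k N h x y)) = psiLin k A N n
      ((2 : k)⁻¹ • ∑ i : Fin (r + 1), ∑ q,
        sgn k ((b' q).1 + (∑ j, (x j).1) +
            ((y i).1 + 1) * ∑ j ∈ Finset.univ.filter (fun j => j < i), ((y j).1 + 1)) •
          Cn.word k N (show (m + 2) + 2 * r = n by omega)
            (Fin.append x ![y i * b q, b' q]) (fun j => y (i.succAbove j))) := by
  simp only [map_smul, map_sum, psiLin_word, monoSum]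
  simp only [hd.map_mono hdeg]
  rw [pow_succ', mul_smul, Finset.sum_comm]
  congr 1
  rw [Finset.smul_sum]
  refine Finset.sum_congr rfl fun i _ => ?_
  rw [Finset.sum_comm, Finset.smul_sum]
  refine Finset.sum_congr rfl fun q _ => ?_
  rw [← Finset.smul_sum, smul_comm, Equiv.sum_comp (breakPair m n i) fun φ => mono k N φ _ _]

include hd in
theorem IsE1Differential.map_mem_invariants {x : E1 k A N n} (hx : x ∈ E1.invariants k A N n) :
    d x ∈ E1.invariants k A N n := fun σ => by
  rw [← hd.map_perm, hx σ]

variable [GradedAssoc A] [GradedComm k A] (hk : (n.factorial : k) ≠ 0)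

/-- The differential of `C_n`, transported from the invariants of `E₁`. -/
def cnDiff : Cn k A N n →ₗ[k] Cn k A N n :=
  ((psi k A N hk).symm.toLinearMap.comp (d.restrict (p := Subalgebra.toSubmodule (E1.invariants k A N n))
    (q := Subalgebra.toSubmodule (E1.invariants k A N n)) fun _ hx => hd.map_mem_invariants hx)).comp
    (psi k A N hk).toLinearMap

theorem psiLin_cnDiff (u : Cn k A N n) :
    psiLin k A N n (cnDiff hd hk u) = d (psiLin k A N n u) := by
  rw [← coe_psi k A N hk]
  simp only [cnDiff, LinearMap.comp_apply, LinearEquiv.coe_coe, LinearEquiv.apply_symm_apply]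
  rfl

theorem psi_cnDiff (u : Cn k A N n) :
    (psi k A N hk (cnDiff hd hk u) : E1 k A N n) = d (psi k A N hk u) :=
  psiLin_cnDiff hd hk u

theorem differentialFormula_cnDiff (hdeg : ∀ q, (b q).1 + (b' q).1 = N) :
    DifferentialFormula k N b b' (cnDiff hd hk) := by
  intro m r h x y
  apply psiLin_injective k N hk
  rw [psiLin_cnDiff, hd.map_psiLin_word hdeg]

theorem cnDiff_cnDiff (hdeg : ∀ q, (b q).1 + (b' q).1 = N) (u : Cn k A N n) :
    cnDiff hd hk (cnDiff hd hk u) = 0 := by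
  apply psiLin_injective k N hk
  rw [psiLin_cnDiff, psiLin_cnDiff, hd.map_map hdeg, map_zero]

theorem isDifferential_cnDiff (hdeg : ∀ q, (b q).1 + (b' q).1 = N) :
    IsDifferential k N b b' (cnMul k A N hk) (cnDiff hd hk) where
  map_zero_part t u hu := by
    apply psiLin_injective k N hk
    rw [psiLin_cnDiff, map_zero]
    exact hd.map_eq_zero hdeg (psiLin_mem_bihomogeneous k N hu)
  map_succ_part t r u hu := by
    rw [psi_mem_bihomogeneous_iff k A N hk, psi_cnDiff]
    exact hd.map_mem hdeg (psiLin_mem_bihomogeneous k N hu)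
  leibniz t r u hu w := by
    apply psiLin_injective k N hk
    rw [psiLin_cnDiff, psiLin_cnMul, hd.leibniz t r _ (psiLin_mem_bihomogeneous k N hu), map_add,
      map_smul, psiLin_cnMul, psiLin_cnMul, psiLin_cnDiff, psiLin_cnDiff]
  unit_formula m h a := by
    have h1 : ((1 : GradedMonoid A).1 : ℕ) = 0 := rfl
    have e : ∀ i : Fin 1, (fun j : Fin 0 => (![a] : Fin 1 → GradedMonoid A) (i.succAbove j)) = ![] :=
      fun i => Subsingleton.elim _ _
    rw [differentialFormula_cnDiff hd hk hdeg m 0 h]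
    simp only [e]
    simp [h1]

end Differential

/-! ### Generators of the algebra `C_n` -/

section Generators

variable (k : Type v) [Field k] {A : ℕ → Type w} [∀ p, AddCommGroup (A p)]
  [∀ p, Module k (A p)] [GradedMonoid.GMul A] [GradedMonoid.GOne A] (N : ℕ) {n m r q l m₀ : ℕ}
  [hN : Fact (Even N)]

theorem mono_one_left (φ : Layout m r n) (y : Fin r → GradedMonoid A) :
    mono k N φ (fun _ => 1) y = ((List.finRange r).map fun j =>
      ed k A N s(φ (.inr (.inl j)), φ (.inr (.inr j))) * pl k N (φ (.inr (.inl j))) (y j)).prod := by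
  simp [mono, pl_one]

/-- With unit letters the terms for `σ` and `τ` do not depend on the permutations, so the product is
a single `monoSum` with coefficient `±(l + 2 q)! (l + 2 r)! / l!`. -/
theorem monoSum_one_mul_monoSum_one (hk : (n.factorial : k) ≠ 0) (h : l + 2 * (q + r) = n)
    (y : Fin r → GradedMonoid A) (t : Fin q → GradedMonoid A) : ∃ c : k, c ≠ 0 ∧
    monoSum k N n (fun _ : Fin (l + 2 * q) => 1) y * monoSum k N n (fun _ : Fin (l + 2 * r) => 1) t =
      c • monoSum k N n (fun _ : Fin l => 1) (Fin.append t y) := by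
  classical
  have hf : ∀ j ≤ n, (j.factorial : k) ≠ 0 := fun j hj h0 => hk <| by
    obtain ⟨c, hc⟩ := Nat.factorial_dvd_factorial hj
    rw [hc, Nat.cast_mul, h0, zero_mul]
  have h1 : ((1 : GradedMonoid A).1 : ℕ) = 0 := rfl
  let s : k := sgn k ((((∑ i, (y i).1 : ℕ) : ℤ) + r * ((N : ℤ) - 1)) *
    (((∑ i, (t i).1 : ℕ) : ℤ) + q * ((N : ℤ) - 1)))
  have hmono : ∀ (ψ : Layout l (q + r) n) (σ : Equiv.Perm (Fin (l + 2 * q)))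
      (τ : Equiv.Perm (Fin (l + 2 * r))),
      mono k N ((Equiv.sumCongr σ (Equiv.refl _)).trans (breakFirst ψ)) (fun _ => 1) y *
        mono k N ((Equiv.sumCongr τ (Equiv.refl _)).trans (breakLast ψ)) (fun _ => 1) t =
      s • mono k N ψ (fun _ => 1) (Fin.append t y) := by
    intro ψ σ τ
    have h2 := mono_mem k N ((Equiv.sumCongr σ (Equiv.refl _)).trans (breakFirst ψ)) (fun _ => 1) y
    have h3 := mono_mem k N ((Equiv.sumCongr τ (Equiv.refl _)).trans (breakLast ψ)) (fun _ => 1) t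
    rw [bihomogeneous_comm k N h2 h3]
    simp only [h1, Finset.sum_const_zero, zero_add]
    congr 1
    rw [mono_one_left, mono_one_left, mono_one_left, prod_finRange_add]
    simp
  have key := sum_layout_layout h (fun φ φ' => mono k N φ (fun _ => (1 : GradedMonoid A)) y *
    mono k N φ' (fun _ => 1) t)
  rw [← monoSum_mul_monoSum k N hk] at key
  simp only [hmono, Finset.sum_const, Finset.card_univ, Fintype.card_perm, Fintype.card_fin,
    ← Nat.cast_smul_eq_nsmul k, ← Finset.smul_sum] at key
  rw [← inv_smul_eq_iff₀ (hf l (by omega))] at key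
  refine ⟨_, ?_, by rw [← key, monoSum, smul_smul, smul_smul, smul_smul]⟩
  exact mul_ne_zero (mul_ne_zero (mul_ne_zero (inv_ne_zero (hf l (by omega)))
    (hf _ (by omega))) (hf _ (by omega))) (sgn_ne_zero k _)

variable {k N} {W : Submodule k (E1 k A N n)}

theorem monoSum_one_mem (hk : (n.factorial : k) ≠ 0)
    (h0 : ∀ x : Fin n → GradedMonoid A, monoSum k N n x ![] ∈ W)
    (h1 : ∀ (m : ℕ) (_ : m + 2 * 1 = n) (a : GradedMonoid A), ∀ w ∈ W,
      monoSum k N n (fun _ : Fin m => 1) ![a] * w ∈ W)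
    (h : m + 2 * r = n) (y : Fin r → GradedMonoid A) :
    monoSum k N n (fun _ : Fin m => 1) y ∈ W := by
  induction r generalizing m with
  | zero =>
    obtain rfl : m = n := by omega
    rw [Subsingleton.elim y ![]]
    exact h0 _
  | succ r ih =>
    obtain ⟨c, hc, e⟩ := monoSum_one_mul_monoSum_one k N hk (l := m) (q := r) (r := 1) h
      ![y (Fin.last r)] (Fin.init y)
    rw [Fin.append_right_eq_snoc, Matrix.cons_val_zero, Fin.snoc_init_self] at e
    rw [← Submodule.smul_mem_iff W hc, ← e]
    exact h1 _ (by omega) _ _ (ih (by omega) _)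

/-- Adjacent transpositions carry `a` through units, which have degree `0`, so no sign appears. -/
theorem monoSum_update_one {x : Fin m → GradedMonoid A} {s : ℕ} (hs : s < m)
    (hx : ∀ i : Fin m, s ≤ i → x i = 1) (y : Fin r → GradedMonoid A) (a : GradedMonoid A)
    (i : Fin m) (hi : s ≤ i) : monoSum k N n (Function.update x i a) y =
      monoSum k N n (Function.update x ⟨s, hs⟩ a) y := by
  suffices h : ∀ i, s ≤ i → ∀ hi : i < m, monoSum k N n (Function.update x ⟨i, hi⟩ a) y =
      monoSum k N n (Function.update x ⟨s, hs⟩ a) y from h i hi i.2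
  intro i hi
  induction i, hi using Nat.le_induction with
  | base => exact fun _ => rfl
  | succ i hi ih =>
    intro hi'
    rw [← ih (by omega), monoSum_swap_left k N (i := ⟨i, by omega⟩) (j := ⟨i + 1, hi'⟩) rfl]
    have e1 : Function.update x ⟨i + 1, hi'⟩ a ⟨i, by omega⟩ = 1 := by
      rw [Function.update_of_ne (by simp)]
      exact hx _ hi
    rw [e1]
    have e2 : ((1 : GradedMonoid A).1 : ℕ) = 0 := rfl
    rw [e2]
    simp only [Nat.cast_zero, zero_mul, sgn_zero, one_smul]
    congr 1
    funext j
    rcases eq_or_ne j ⟨i, by omega⟩ with rfl | hj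
    · simp
    rcases eq_or_ne j ⟨i + 1, hi'⟩ with rfl | hj'
    · rw [Equiv.swap_apply_right, e1, Function.update_of_ne (by simp)]
      exact (hx _ (Nat.le_succ_of_le hi)).symm
    · rw [Equiv.swap_apply_of_ne_of_ne hj hj', Function.update_of_ne hj', Function.update_of_ne hj]

/-- Induction on the number `s` such that the letters `x_i` with `i ≥ s` are units. Multiplying by
the invariant `∑_v p_v^*(a)` attaches `a` to each letter in turn. Attached to one of the remaining
units it gives the wanted sum, up to a common sign; attached to any other letter it leaves all
letters from position `s` on equal to `1`, a case known by induction. If all `x_i` are units,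
products of the generators `e_0 ∧ ⋯ ∧ e_0 ⊗ s a` suffice. -/
theorem monoSum_mem_of_generators [GradedAssoc A] (hk : (n.factorial : k) ≠ 0)
    (h0 : ∀ t, ∀ z ∈ E1.invariants k A N n, z ∈ E1.bihomogeneous k A N n t 0 →
      z ∈ W ∧ ∀ w ∈ W, z * w ∈ W)
    (h1 : ∀ (m : ℕ) (_ : m + 2 * 1 = n) (a : GradedMonoid A), ∀ w ∈ W,
      monoSum k N n (fun _ : Fin m => 1) ![a] * w ∈ W)
    (h : m + 2 * r = n) (x : Fin m → GradedMonoid A) (y : Fin r → GradedMonoid A) :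
    monoSum k N n x y ∈ W := by
  suffices hs : ∀ s ≤ m, ∀ (x : Fin m → GradedMonoid A) (y : Fin r → GradedMonoid A),
      (∀ i : Fin m, s ≤ i → x i = 1) → monoSum k N n x y ∈ W from
    hs m le_rfl x y fun i hi => absurd i.2 (by omega)
  intro s
  induction s with
  | zero =>
    intro _ x y hx
    obtain rfl : x = fun _ => 1 := funext fun i => hx i (Nat.zero_le _)
    refine monoSum_one_mem hk (fun x => ?_) h1 h y
    exact (h0 _ _ (fun σ => perm_monoSum k N σ x ![]) (monoSum_mem k N x ![])).1
  | succ s ih =>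
    intro hsm x y hx
    have ih := ih (by omega)
    set i₀ : Fin m := ⟨s, hsm⟩ with hi₀
    set a := x i₀ with ha
    set x' := Function.update x i₀ 1 with hx'
    have hx1 : ∀ i : Fin m, s ≤ i → x' i = 1 := by
      intro i hi
      rcases eq_or_ne i i₀ with rfl | hne
      · simp [hx']
      · rw [hx', Function.update_of_ne hne]
        refine hx i (lt_of_le_of_ne hi fun h => hne (Fin.ext h.symm))
    have hx2 : Function.update x' i₀ a = x := by simp [hx', ha]
    let T : E1 k A N n := ∑ v, pl k N v a
    have hT : ∀ w ∈ W, T * w ∈ W := by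
      refine (h0 a.1 T (fun σ => ?_) (Submodule.sum_mem _ fun v _ => pl_mem_bihomogeneous k N v a)).2
      simp only [T, map_sum, perm_pl]
      exact Equiv.sum_comp σ fun v => pl k N v a
    choose c _ hc using fun j => pl_mul_mono_right (n := n) k N x' y j a
    -- The points of a layout are its single points and the two ends of each pair. Both ends
    -- contribute equally, hence the factor `2 * c j`.
    have key : T * monoSum k N n x' y =
        ∑ i : Fin m, sgn k ((a.1 : ℤ) * ∑ j ∈ Finset.univ.filter (fun j => j < i), ((x' j).1 : ℤ)) •
          monoSum k N n (Function.update x' i (a * x' i)) y +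
        ∑ j : Fin r, (2 * c j) • monoSum k N n x' (Function.update y j (a * y j)) := by
      have e : ∀ φ : Layout m r n, T * mono k N φ x' y =
          ∑ i : Fin m, sgn k ((a.1 : ℤ) *
            ∑ j ∈ Finset.univ.filter (fun j => j < i), ((x' j).1 : ℤ)) •
            mono k N φ (Function.update x' i (a * x' i)) y +
          ∑ j : Fin r, (2 * c j) • mono k N φ x' (Function.update y j (a * y j)) := by
        intro φ
        rw [Finset.sum_mul, ← Equiv.sum_comp φ, Fintype.sum_sum_type, Fintype.sum_sum_type,
          ← Finset.sum_add_distrib]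
        congr 1
        · exact Finset.sum_congr rfl fun i _ => pl_mul_mono_left k N φ x' y i a
        · refine Finset.sum_congr rfl fun j _ => ?_
          rw [hc j φ _ (Or.inl rfl), hc j φ _ (Or.inr rfl), ← add_smul, two_mul]
      rw [monoSum, Finset.mul_sum, Finset.sum_congr rfl fun φ _ => e φ, Finset.sum_add_distrib,
        Finset.sum_comm, Finset.sum_comm (s := Finset.univ) (t := Finset.univ (α := Fin r))]
      simp only [monoSum, Finset.smul_sum]
    have hlow : ∀ i : Fin m, ¬ s ≤ i → monoSum k N n (Function.update x' i (a * x' i)) y ∈ W := by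
      intro i hi
      refine ih _ y fun j hj => ?_
      rw [Function.update_of_ne (by rintro rfl; exact hi hj)]
      exact hx1 j hj
    have hhigh : ∀ i : Fin m, s ≤ i →
        sgn k ((a.1 : ℤ) * ∑ j ∈ Finset.univ.filter (fun j => j < i), ((x' j).1 : ℤ)) •
          monoSum k N n (Function.update x' i (a * x' i)) y =
        sgn k ((a.1 : ℤ) * ∑ j, ((x' j).1 : ℤ)) • monoSum k N n x y := by
      intro i hi
      rw [hx1 i hi, GradedAssoc.mul_one, monoSum_update_one hsm hx1 y a i hi, ← hi₀, hx2]
      congr 3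
      refine Finset.sum_subset (Finset.subset_univ _) fun j _ hj => ?_
      have hj' : s ≤ j := by
        simp only [Finset.mem_filter, Finset.mem_univ, true_and, not_lt, Fin.le_def] at hj
        omega
      rw [hx1 j hj']
      rfl
    -- The wanted term occurs once for every `i ≥ s`; the number of such `i` lies between `1` and
    -- `n` and is invertible.
    have hcount : 0 < (Finset.univ.filter fun i : Fin m => s ≤ (i : ℕ)).card :=
      Finset.card_pos.2 ⟨i₀, by simp [hi₀]⟩
    have hcount' : (Finset.univ.filter fun i : Fin m => s ≤ (i : ℕ)).card ≤ n :=
      (Finset.card_le_univ _).trans (by simp; omega)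
    have hmem := hT _ (ih x' y hx1)
    rw [key, Submodule.add_mem_iff_left _ (Submodule.sum_mem _ fun j _ =>
      Submodule.smul_mem _ _ (ih x' _ hx1)),
      ← Finset.sum_filter_add_sum_filter_not _ (fun i : Fin m => s ≤ (i : ℕ)),
      Submodule.add_mem_iff_left _ (Submodule.sum_mem _ fun i hi => Submodule.smul_mem _ _
        (hlow i (Finset.mem_filter.1 hi).2)),
      Finset.sum_congr rfl fun i hi => hhigh i (Finset.mem_filter.1 hi).2, Finset.sum_const,
      ← Nat.cast_smul_eq_nsmul k, Submodule.smul_mem_iff _ (natCast_ne_zero_of_le hk hcount hcount'),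
      Submodule.smul_mem_iff _ (sgn_ne_zero k _)] at hmem
    exact hmem

/-- Two differentials agree on words without `s`-letters, where both vanish, and on the words `e_0 ∧
⋯ ∧ e_0 ⊗ s a`. By the Leibniz rule the subspace where they agree is stable under multiplication by
these elements, and they generate. -/
theorem IsDifferential.unique [GradedAssoc A] [GradedComm k A] (hk : (n.factorial : k) ≠ 0)
    {b b' : Fin m₀ → GradedMonoid A} {d d' : Cn k A N n →ₗ[k] Cn k A N n}
    (hd : IsDifferential k N b b' (cnMul k A N hk) d)
    (hd' : IsDifferential k N b b' (cnMul k A N hk) d') : d = d' := by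
  have hmul : ∀ t r, ∀ u ∈ Cn.bihomogeneous k N n t r, d u = d' u → ∀ w,
      w ∈ (LinearMap.eqLocus d d').map (psiLin k A N n) →
      psiLin k A N n u * w ∈ (LinearMap.eqLocus d d').map (psiLin k A N n) := by
    rintro t r u hu e _ ⟨w, hw, rfl⟩
    refine ⟨cnMul k A N hk u w, ?_, psiLin_cnMul k A N hk u w⟩
    have hw' : d w = d' w := hw
    change d _ = d' _
    rw [hd.leibniz t r u hu, hd'.leibniz t r u hu, e, hw']
  apply cn_ext
  intro m r h x y
  have key : monoSum k N n x y ∈ (LinearMap.eqLocus d d').map (psiLin k A N n) := by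
    refine monoSum_mem_of_generators hk (fun t z hz hzt => ?_) (fun m h a => ?_) h x y
    · obtain ⟨u, hu⟩ := (psi k A N hk).surjective ⟨z, hz⟩
      have hu' : psiLin k A N n u = z := congrArg Subtype.val hu
      have hut : u ∈ Cn.bihomogeneous k N n t 0 := by
        rw [psi_mem_bihomogeneous_iff k A N hk, coe_psi, hu']
        exact hzt
      have e : d u = d' u := by rw [hd.map_zero_part t u hut, hd'.map_zero_part t u hut]
      refine ⟨⟨u, e, hu'⟩, fun w hw => ?_⟩
      rw [← hu']
      exact hmul t 0 u hut e w hw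
    · have h2 : (2 : k) ≠ 0 := by
        exact_mod_cast natCast_ne_zero_of_le hk (j := 2) (by omega) (by omega)
      intro w hw
      have e : monoSum k N n (fun _ : Fin m => 1) ![a] =
          (2 : k) • psiLin k A N n (Cn.word k N h (fun _ => 1) ![a]) := by
        rw [psiLin_word, pow_one, smul_inv_smul₀ h2]
      rw [e, smul_mul_assoc]
      refine Submodule.smul_mem _ _ (hmul _ 1 _ (Submodule.subset_span ⟨m, h, _, _, rfl, rfl⟩) ?_ w hw)
      rw [hd.unit_formula m h a, hd'.unit_formula m h a]
  have key' : psiLin k A N n (Cn.word k N h x y) ∈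
      (LinearMap.eqLocus d d').map (psiLin k A N n) := by
    rw [psiLin_word]
    exact Submodule.smul_mem _ _ key
  obtain ⟨u, hu, e⟩ := key'
  rw [← psiLin_injective k N hk e]
  exact hu

end Generators

end

end CohenTaylor

/-! ### The theorem for singular cohomology -/

open CohenTaylor
theorem mainTheorem1 {k : Type*} [Field k] (n N : ℕ)
    (hk : ringChar k = 0 ∨ n < ringChar k) (hN : Even N)
    (M : Type*) [TopologicalSpace M] [T2Space M] [CompactSpace M]
    [ChartedSpace (EuclideanSpace ℝ (Fin N)) M] :
    ∃ μ : Cn k (H k M) N n →ₗ[k] Cn k (H k M) N n →ₗ[k] Cn k (H k M) N n,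
      IsProduct k N μ ∧ (∀ μ', IsProduct k N μ' → μ' = μ) ∧
      ∃ Ψ : Cn k (H k M) N n ≃ₗ[k] E1.invariants k (H k M) N n,
        (∀ u w, Ψ (μ u w) = Ψ u * Ψ w) ∧
        (∀ t r u, u ∈ Cn.bihomogeneous k N n t r ↔
          (Ψ u : E1 k (H k M) N n) ∈ E1.bihomogeneous k (H k M) N n t r) ∧
        ∀ (Ω : H k M N) (m : ℕ) (b b' : Fin m → GradedMonoid (H k M)), IsDualBases k Ω b b' →
          ∃ d₁ : E1 k (H k M) N n →ₗ[k] E1 k (H k M) N n,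
            IsE1Differential k N n b b' d₁ ∧
            (∀ d₁', IsE1Differential k N n b b' d₁' → d₁' = d₁) ∧
            (∀ w, d₁ (d₁ w) = 0) ∧
            ∃ d : Cn k (H k M) N n →ₗ[k] Cn k (H k M) N n,
              IsDifferential k N b b' μ d ∧
              (∀ d', IsDifferential k N b b' μ d' → d' = d) ∧
              DifferentialFormula k N b b' d ∧
              (∀ w, d (d w) = 0) ∧
              ∀ w, (Ψ (d w) : E1 k (H k M) N n) = d₁ (Ψ w) := by
  haveI : Fact (Even N) := ⟨hN⟩
  -- A prime larger than `n` does not divide `n!`. This is the only form in which the characteristic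
  -- enters.
  have hn : (n.factorial : k) ≠ 0 := by
    intro h0
    have h1 : ringChar k ∣ n.factorial := ringChar.dvd h0
    rcases hk with h | h
    · rw [h, zero_dvd_iff] at h1
      exact Nat.factorial_ne_zero n h1
    · rcases CharP.char_is_prime_or_zero k (ringChar k) with hp | hp
      · exact absurd ((Nat.Prime.dvd_factorial hp).1 h1) (by omega)
      · omega
  refine ⟨cnMul k (H k M) N hn, isProduct_cnMul k N hn,
    fun μ' h => h.unique k N (isProduct_cnMul k N hn), psi k (H k M) N hn, psi_cnMul k (H k M) N hn,
    psi_mem_bihomogeneous_iff k (H k M) N hn, fun Ω m b b' hb => ?_⟩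
  have h1 := isE1Differential_e1Diff (n := n) k N hb
  exact ⟨e1Diff k N hb, h1, fun d h => h.unique h1, h1.map_map hb.deg_add, cnDiff h1 hn,
    isDifferential_cnDiff h1 hn hb.deg_add,
    fun d h => h.unique hn (isDifferential_cnDiff h1 hn hb.deg_add),
    differentialFormula_cnDiff h1 hn hb.deg_add, cnDiff_cnDiff h1 hn hb.deg_add, psi_cnDiff h1 hn⟩
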